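/- **Setting.** Let $K$ be a field of characteristic $0$ (for instance $\mathbb{C}$). Let $G$ be a finite connected directed plane graph (loops and multiple edges allowed) in which any two distinct bounded faces share at most one edge. Fix linear orders on the edges and on the bounded faces. For a bounded face $F$ and an edge $e$ let $\varepsilon_{F,e}$ be $1$ (resp. $-1$) if $e$ lies on the boundary cycle of $F$ and points clockwise (resp. counterclockwise) around $F$, and $0$ if $e$ is not on the boundary cycle of $F$ (in particular if $F$ lies on both sides of $e$). For edge labels $(x+a_ey)^2$ with $a=(a_e)_e\in K^{E(G)}$, the extended cycle basis matrix $M^{\mathsf{ext}}_G(a)$ has one column for each edge $e$ and, for each bounded face $F$, three rows with entries $\varepsilon_{F,e}a_e^t$, $t=0,1,2$. The labels $a$ are *in special position* for $G$ if $\operatorname{rank} M^{\mathsf{ext}}_G(a)<\max_b \operatorname{rank} M^{\mathsf{ext}}_G(b)$. For a set $S$ of bounded faces, $G_S$ is the subgraph of all vertices and edges on faces in $S$, with $S$ as its set of faces; write $e_S$ and $f_S=|S|$ for its numbers of edges and faces. The contraction $G\backslash G_S$ has edges $E(G)\setminus E(G_S)$ and faces those not in $S$, the two ends of every edge of $G_S$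 being identified. A nonempty $S$ is *contractible* if $e_S\le 3f_S$, and *minimal contractible* if moreover no nonempty proper subset of $S$ is contractible. The same notions are used for graphs obtained from $G$ by contractions and for the subgraphs $G_S$ of such graphs, and special position for such a graph is regarded as a condition on $a\in K^{E(G)}$ that depends only on the labels of its edges. For a graph $H$ with face set $\mathcal F$ and a set $C$ of edges of $H$, an *edge-injective function* with values in $C$ assigns to each $F\in\mathcal F$ a set $\varphi(F)\subseteq C$ of three edges on the boundary of $F$, such that $\varphi(F)\cap\varphi(F')=\emptyset$ for $F\ne F'$. Let $N_{F,\varphi(F)}$ be the $3\times3$ matrix $(\varepsilon_{F,e}a_e^t)_{t,\,e}$, $t=0,1,2$, $e\in\varphi(F)$ in increasing order; its determinant is, up to sign, a Vandermonde determinant. Let $\operatorname{sgn}(\varphi)$ be $-1$ to the number of pairs of faces $F<F'$ with edges $e\in\varphi(F)$, $e'\in\varphi(F')$, $e'<e$. Put $$p_{H,C}=\sum_{\varphi}\operatorname{sgn}(\varphi)\prod_{F\in\mathcal F}\det N_{F,\varphi(F)}\in K[a_e : e\in E(G)],$$ the sum being over all edge-injective functions on $H$ with values in $C$. **Theorem.**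 Let $k\ge0$, $G'_1=G$, and for $i=1,\dots,k$ let $S_i$ be a minimal contractible set of faces of $G'_i$ and $G'_{i+1}=G'_i\backslash G_{S_i}$, where $G_{S_i}$ is formed in $G'_i$. Assume that $G'_{k+1}$ has no contractible proper subset of its set of faces, and that within each $G'_i$, $1\le i\le k+1$, no two distinct minimal contractible sets of faces have subgraphs that share an edge. Then: 1. For $i\le k$, $a$ is in special position for $G_{S_i}$ if and only if $\operatorname{rank}M^{\mathsf{ext}}_{G_{S_i}}(a)<e_{G_{S_i}}$, and the set $\mathcal V_i$ of such $a$ is an algebraic variety. Likewise, $a$ is in special position for $G'_{k+1}$ if and only if $\operatorname{rank}M^{\mathsf{ext}}_{G'_{k+1}}(a)<\min(e,3f)$, where $f$ is the number of faces of $G'_{k+1}$ and $e$ the number of its edges on the boundary of some face, and the set $\mathcal V_{k+1}$ of such $a$ is an algebraic variety. 2. The union $\bigcup_{i=1}^{k+1}\mathcal V_i$ is an algebraic variety, and it is the locus of edge labels in special position for $G$. 3. For $i\le k$ one of the following holds: * $e_{G_{S_i}}-3f_{G_{S_i}}=-2$, $G_{S_i}$ has a single edge, and $\mathcal V_i=\emptyset$;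 * $e_{G_{S_i}}-3f_{G_{S_i}}=-1$, $G_{S_i}$ has exactly two edges $e_j,e_{j'}$, and $\mathcal V_i$ is the hypersurface $a_j-a_{j'}=0$; * $e_{G_{S_i}}-3f_{G_{S_i}}=0$, the polynomial $p_{G_{S_i},E(G_{S_i})}$ is nonzero, and $\mathcal V_i$ is the hypersurface on which it vanishes. 4. If $e\ge3f$ (with $e,f$ as in 1), then $\mathcal V_{k+1}=\bigcap_C\{a: p_{G'_{k+1},C}(a)=0\}$, where $C$ runs over all sets of $3f$ edges of $G'_{k+1}$. -/

import Mathlib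

/-- A finite connected directed plane graph (loops and multiple edges allowed), given by its
rotation system. A dart is a pair `(e, b)`: the edge `e` traversed along its direction (`b = true`)
or against it (`b = false`). `rot` sends a dart to the next dart, counterclockwise, with the same
source, so the vertices are the orbits of `rot`. `side d` is the face to the right of `d`, that is,
the face around which `d` points clockwise; `none` is the unbounded face and the elements of `F` are
the bounded faces. The faces are the orbits of "arrive at the end of `d`, then turn to the next
dart". Euler's formula says that the surface is the sphere. -/
structure PlaneGraph (V E F : Type*) [Fintype V] [Fintype E] [Fintype F] where
  src : E × Bool → V
  rot : Equiv.Perm (E × Bool)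
  rot_orbit : ∀ d d', rot.SameCycle d d' ↔ src d = src d'
  side : E × Bool → Option F
  side_orbit : ∀ d d',
    Equiv.Perm.SameCycle (((Equiv.refl E).prodCongr Equiv.boolNot).trans rot) d d' ↔
      side d = side d'
  side_surjective : Nonempty E → Function.Surjective side
  nonempty : Nonempty V
  connected : ∀ u v : V,
    Relation.ReflTransGen (fun x y => ∃ e b, src (e, b) = x ∧ src (e, !b) = y) u v
  euler : Fintype.card V + (Fintype.card F + 1) = Fintype.card E + 2

namespace PlaneGraph

variable {V E F : Type*} [Fintype V] [Fintype E] [Fintype F]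

open scoped Classical in
/-- The entry of the cycle basis matrix: `1` if `e` is on the boundary of `f` and points clockwise
around `f`, `-1` if it points counterclockwise, `0` if `e` is not on the boundary cycle of `f`
(in particular if `f` is on both sides of `e`). -/
noncomputable def bd (G : PlaneGraph V E F) (f : F) (e : E) : ℤ :=
  (if G.side (e, true) = some f then 1 else 0) - (if G.side (e, false) = some f then 1 else 0)

/-- Any two distinct bounded faces share at most one edge. -/
def ShareAtMostOneEdge (G : PlaneGraph V E F) : Prop :=
  ∀ f f' : F, f ≠ f' → ∀ e e' : E,
    G.bd f e ≠ 0 → G.bd f' e ≠ 0 → G.bd f e' ≠ 0 → G.bd f' e' ≠ 0 → e = e'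

/-- A graph with marked bounded faces, obtained from `G` by contracting subgraphs and passing to
subgraphs: its vertices are the classes under `glue` of the elements of `verts`, and the edges and
faces are those in `edges` and `faces`. The boundary of a face consists of those of its edges in `G`
that are still present, with the same orientation. -/
structure Minor (G : PlaneGraph V E F) where
  verts : Set V
  glue : Setoid V
  edges : Finset E
  faces : Finset F

/-- `G` itself, with all its bounded faces. -/
def whole (G : PlaneGraph V E F) : G.Minor where
  verts := Set.univ
  glue := ⊥
  edges := Finset.univ
  faces := Finset.univ

namespace Minor

variable {G : PlaneGraph V E F}

open scoped Classical in
/-- The edges on the boundary of some face in `S`. -/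
noncomputable def edgesOn (H : G.Minor) (S : Finset F) : Finset E :=
  H.edges.filter (fun e => ∃ f ∈ S, G.bd f e ≠ 0)

/-- The subgraph `H_S`: all vertices and edges on any face in `S`, with `S` as its faces. -/
noncomputable def sub (H : G.Minor) (S : Finset F) : G.Minor where
  verts := {v | v ∈ H.verts ∧ ∃ e ∈ H.edgesOn S, ∃ b, H.glue v (G.src (e, b))}
  glue := H.glue
  edges := H.edgesOn S
  faces := S

open scoped Classical in
/-- The contraction of `H` along `H_S`: the edges and faces of `H_S` are removed, and the two ends
of each removed edge are identified. -/
noncomputable def contract (H : G.Minor) (S : Finset F) : G.Minor where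
  verts := H.verts
  glue := H.glue ⊔ Relation.EqvGen.setoid
    (fun u v => ∃ e ∈ H.edgesOn S, u = G.src (e, true) ∧ v = G.src (e, false))
  edges := H.edges \ H.edgesOn S
  faces := H.faces \ S

/-- The result of contracting successively along `S 0, …, S (n - 1)`. -/
noncomputable def contractSeq (H : G.Minor) (S : ℕ → Finset F) : ℕ → G.Minor
  | 0 => H
  | n + 1 => (contractSeq H S n).contract (S n)

/-- `S` is a contractible set of faces: nonempty, with `e_S ≤ 3 f_S`. -/
def IsContractible (H : G.Minor) (S : Finset F) : Prop :=
  S ⊆ H.faces ∧ S.Nonempty ∧ (H.edgesOn S).card ≤ 3 * S.card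

/-- `S` is contractible and no proper subset of it is. -/
def IsMinimalContractible (H : G.Minor) (S : Finset F) : Prop :=
  H.IsContractible S ∧ ∀ T, T ⊂ S → ¬ H.IsContractible T

/-- The extended cycle basis matrix for the edge labels `(x + a e * y) ^ 2`. -/
noncomputable def Mext {K : Type*} [Field K] (H : G.Minor) (a : E → K) :
    Matrix (H.faces × Fin 3) H.edges K :=
  fun r e => (G.bd r.1 e : K) * a e ^ (r.2 : ℕ)

/-- The edge labels are in special position for `H` if the rank of the extended cycle basis matrix
is smaller than expected, i.e. smaller than the largest rank over all choices of labels. -/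
def InSpecialPosition {K : Type*} [Field K] (H : G.Minor) (a : E → K) : Prop :=
  ∃ b : E → K, (H.Mext a).rank < (H.Mext b).rank

/-- The locus of edge labels in special position for `H`. -/
def specialLocus (K : Type*) [Field K] (H : G.Minor) : Set (E → K) :=
  {a | H.InSpecialPosition a}

variable [LinearOrder E]

/-- A map `φ` from faces to unordered triples of edges is edge-injective with values in the edge set
`C`: every `φ f` consists of edges in `C` on the boundary of `f`, and different faces get disjoint
triples. -/
def IsEdgeInjective (H : G.Minor) (C : Finset E) (φ : H.faces → {A : Finset E // A.card = 3}) :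
    Prop :=
  (∀ f, ∀ e ∈ (φ f).1, e ∈ C ∧ G.bd f e ≠ 0) ∧
    ∀ f f', f ≠ f' → Disjoint (φ f).1 (φ f').1

/-- The `3 × 3` matrix with the three rows of the face `f` and the columns of the edges in `A`, in
increasing order, the labels being indeterminates. -/
noncomputable def faceMatrix (K : Type*) [Field K] (G : PlaneGraph V E F) (f : F)
    (A : {A : Finset E // A.card = 3}) : Matrix (Fin 3) (Fin 3) (MvPolynomial E K) :=
  fun t j => (G.bd f (A.1.orderEmbOfFin A.2 j) : MvPolynomial E K) *
    MvPolynomial.X (A.1.orderEmbOfFin A.2 j) ^ (t : ℕ)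

variable [LinearOrder F]

/-- The sign of the permutation that lists the edges of `φ f`, in increasing order, face after
face: `(-1)` to the number of pairs of faces `f < f'` with edges `e ∈ φ f`, `e' ∈ φ f'`, `e' < e`. -/
noncomputable def shuffleSign (H : G.Minor) (φ : H.faces → {A : Finset E // A.card = 3}) : ℤ :=
  (-1) ^ (Finset.univ.filter (fun p : (H.faces × E) × (H.faces × E) =>
    p.1.2 ∈ (φ p.1.1).1 ∧ p.2.2 ∈ (φ p.2.1).1 ∧ p.1.1 < p.2.1 ∧ p.2.2 < p.1.2)).card

open scoped Classical in
/-- The sum, over all edge-injective functions `φ` with values in `C`, of the signed products of the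
determinants of the matrices of the faces `f` with columns `φ f`. -/
noncomputable def edgeInjectivePoly (K : Type*) [Field K] (H : G.Minor) (C : Finset E) :
    MvPolynomial E K :=
  ∑ φ ∈ Finset.univ.filter (H.IsEdgeInjective C),
    (H.shuffleSign φ : MvPolynomial E K) * ∏ f : H.faces, (faceMatrix K G f (φ f)).det

end Minor

end PlaneGraph

/-- The set of zeros of a polynomial. -/
def polyZeros {E K : Type*} [Field K] (p : MvPolynomial E K) : Set (E → K) :=
  {a | MvPolynomial.eval a p = 0}

/-- The set of common zeros of a set of polynomials. -/
def IsAlgebraicVariety {E K : Type*} [Field K] (Z : Set (E → K)) : Prop :=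
  ∃ P : Set (MvPolynomial E K), Z = ⋂ p ∈ P, polyZeros p

/-!
Contracting along `S i` makes the extended cycle basis matrix block triangular, because the rows of
`S i` vanish on the columns that remain. Generically the columns of each such block are independent
and the last matrix has full rank. A defect of one block cannot be made up for elsewhere: even on
all columns, the rows of `S i` have rank at most the number of edges of the block. This number is
`3 |S i|`, unless `S i` is a single face with at most two edges; such a face has lost no edge in
earlier contractions, since minimal contractible sets share no edges.

The generic ranks come from Rado's theorem on independent transversals, applied to the sets of all
columns that an edge can have. These sets for the edges in `X` span at least `3 |Φ| - 3 c`
dimensions, where `c` is the number of bounded faces formed by merging the faces in `Φ` across `X`.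
Inside these faces lie few edges of `X`, by Euler's formula and as distinct faces share at most one
edge; outside them lie few edges at all, as no proper subset of `Φ` is contractible.

The polynomials are the maximal minors, expanded along the blocks of three rows of each face.
-/

namespace PlaneGraph

variable {V E F : Type*} [Fintype V] [Fintype E] [Fintype F]

section Planarity

lemma sum_mul_bd {R : Type*} [CommRing R] (G : PlaneGraph V E F) (y : F → R) (e : E) :
    ∑ f, y f * (G.bd f e : R) =
      (G.side (e, true)).elim 0 y - (G.side (e, false)).elim 0 y := by
  classical
  have sum_mul_ite (o : Option F) : ∑ f, y f * (if o = some f then 1 else 0) = o.elim 0 y := by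
    cases o <;> simp
  simp only [bd, Int.cast_sub, Int.cast_ite, Int.cast_one, Int.cast_zero, mul_sub,
    Finset.sum_sub_distrib, sum_mul_ite]

variable (R : Type*) [CommRing R]

/-- The coboundary map of the graph `G`, from functions on the vertices to functions on the
edges. -/
def coboundary (G : PlaneGraph V E F) : (V → R) →ₗ[R] (E → R) where
  toFun x e := x (G.src (e, false)) - x (G.src (e, true))
  map_add' x y := by ext e; simp only [Pi.add_apply]; ring
  map_smul' c x := by ext e; simp only [Pi.smul_apply, smul_eq_mul, RingHom.id_apply]; ring

/-- The boundary map of the dual graph, from functions on the edges to functions on the bounded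
faces: it sums a function over the boundary cycle of each face. -/
noncomputable def faceSum (G : PlaneGraph V E F) : (E → R) →ₗ[R] (F → R) :=
  Matrix.mulVecLin fun f e => (G.bd f e : R)

variable {R}

lemma coboundary_apply (G : PlaneGraph V E F) (x : V → R) (e : E) :
    G.coboundary R x e = x (G.src (e, false)) - x (G.src (e, true)) := rfl

lemma faceSum_apply (G : PlaneGraph V E F) (z : E → R) (f : F) :
    G.faceSum R z f = ∑ e, (G.bd f e : R) * z e := rfl

lemma faceSum_coboundary (G : PlaneGraph V E F) (x : V → R) :
    G.faceSum R (G.coboundary R x) = 0 := by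
  classical
  ext f
  let next : Equiv.Perm (E × Bool) := ((Equiv.refl E).prodCongr Equiv.boolNot).trans G.rot
  let onFace (d : E × Bool) : R := if G.side d = some f then 1 else 0
  have side_next (d) : G.side (next d) = G.side d :=
    ((G.side_orbit d (next d)).1 ⟨1, by simp [next]⟩).symm
  have src_next (e b) : G.src (next (e, b)) = G.src (e, !b) :=
    ((G.rot_orbit (e, !b) (next (e, b))).1 ⟨1, by simp [next]⟩).symm
  have reindex : ∑ d, onFace d * x (G.src (next d)) = ∑ d, onFace d * x (G.src d) := by
    rw [← Equiv.sum_comp next (fun d => onFace d * x (G.src d))]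
    simp only [onFace, side_next]
  calc G.faceSum R (G.coboundary R x) f
      = ∑ d, onFace d * x (G.src (next d)) - ∑ d, onFace d * x (G.src d) := by
        rw [faceSum_apply, ← Finset.sum_sub_distrib, Fintype.sum_prod_type]
        refine Finset.sum_congr rfl fun e _ => ?_
        simp only [Fintype.sum_bool, src_next, coboundary_apply, bd, onFace, Bool.not_true,
          Bool.not_false, Int.cast_sub, Int.cast_ite, Int.cast_one, Int.cast_zero]
        ring
    _ = 0 := by rw [reindex, sub_self]

lemma eq_of_coboundary_eq_zero (G : PlaneGraph V E F) {x : V → R} (h : G.coboundary R x = 0)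
    (u v : V) : x u = x v := by
  have edge (e) : x (G.src (e, false)) = x (G.src (e, true)) := sub_eq_zero.1 (congrFun h e)
  induction G.connected u v with
  | refl => rfl
  | tail _ step ih =>
    obtain ⟨e, b, rfl, rfl⟩ := step
    rw [ih]
    cases b
    · exact edge e
    · exact (edge e).symm

lemma eq_of_reverse_of_rot_invariant (G : PlaneGraph V E F) {α : Type*} {y : E × Bool → α}
    (hrev : ∀ e b, y (e, !b) = y (e, b)) (hrot : ∀ d, y (G.rot d) = y d) (d d' : E × Bool) :
    y d = y d' := by
  have same_src (d d') (hd : G.src d = G.src d') : y d = y d' := by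
    obtain ⟨n, rfl⟩ := ((G.rot_orbit d d').2 hd).exists_nat_pow_eq
    clear hd
    induction n with
    | zero => rfl
    | succ n ih => rw [pow_succ', Equiv.Perm.mul_apply, hrot, ih]
  obtain ⟨v, hv⟩ : ∃ v, G.src d' = v := ⟨_, rfl⟩
  induction G.connected (G.src d) v generalizing d' with
  | refl => exact same_src _ _ hv.symm
  | tail _ step ih =>
    obtain ⟨e, b, hsrc, htgt⟩ := step
    rw [ih (e, b) hsrc, ← hrev e b]
    exact same_src _ _ (htgt.trans hv.symm)

lemma eq_zero_of_elim_side_eq (G : PlaneGraph V E F) {y : F → R}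
    (h : ∀ e, (G.side (e, true)).elim 0 y = (G.side (e, false)).elim 0 y) : y = 0 := by
  have const := G.eq_of_reverse_of_rot_invariant (y := fun d => (G.side d).elim 0 y)
    (fun e b => by cases b; exacts [h e, (h e).symm]) (fun ⟨e, b⟩ => by
      have turn : G.side (e, !b) = G.side (G.rot (e, b)) := (G.side_orbit _ _).1 ⟨1, by simp⟩
      rw [← turn]
      cases b; exacts [h e, (h e).symm])
  ext f
  cases isEmpty_or_nonempty E with
  | inl hE =>
    have euler := G.euler
    have := Fintype.card_pos_iff.2 G.nonempty
    have := Fintype.card_pos_iff.2 ⟨f⟩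
    rw [Fintype.card_eq_zero (α := E)] at euler
    omega
  | inr hE =>
    obtain ⟨d, hd⟩ := G.side_surjective hE (some f)
    obtain ⟨d', hd'⟩ := G.side_surjective hE none
    simpa [hd, hd'] using const d d'

variable {K : Type*} [Field K]

lemma faceSum_surjective (G : PlaneGraph V E F) : Function.Surjective (G.faceSum K) := by
  classical
  rw [← LinearMap.dualMap_injective_iff, injective_iff_map_eq_zero]
  intro φ hφ
  have hy : (fun f => φ (Pi.single f 1)) = 0 := by
    refine G.eq_zero_of_elim_side_eq fun e => ?_
    have single_edge : G.faceSum K (Pi.single e 1) =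
        ∑ f, (G.bd f e : K) • Pi.single f (1 : K) := by
      ext f
      simp [faceSum_apply, Pi.single_apply]
    have hφe := LinearMap.congr_fun hφ (Pi.single e 1)
    rw [LinearMap.dualMap_apply, single_edge, map_sum] at hφe
    rw [← sub_eq_zero, ← sum_mul_bd]
    simpa [mul_comm] using hφe
  refine LinearMap.pi_ext' fun f => LinearMap.ext_ring ?_
  simpa using congrFun hy f

lemma finrank_ker_coboundary (G : PlaneGraph V E F) :
    Module.finrank K (LinearMap.ker (G.coboundary K)) = 1 := by
  obtain ⟨v⟩ := G.nonempty
  have hker : LinearMap.ker (G.coboundary K) = Submodule.span K {fun _ => (1 : K)} := by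
    ext x
    rw [LinearMap.mem_ker, Submodule.mem_span_singleton]
    constructor
    · intro hx
      exact ⟨x v, funext fun u => by simp [G.eq_of_coboundary_eq_zero hx u v]⟩
    · rintro ⟨c, rfl⟩
      ext e
      simp [coboundary_apply]
  rw [hker, finrank_span_singleton fun h => one_ne_zero (congrFun h v)]

/-- Exactness comes from a dimension count: this is where Euler's formula enters. -/
lemma ker_faceSum (G : PlaneGraph V E F) :
    LinearMap.ker (G.faceSum K) = LinearMap.range (G.coboundary K) := by
  refine (Submodule.eq_of_le_of_finrank_eq ?_ ?_).symm
  · rintro _ ⟨x, rfl⟩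
    exact G.faceSum_coboundary x
  · have dim_edges := LinearMap.finrank_range_add_finrank_ker (G.faceSum K)
    have dim_verts := LinearMap.finrank_range_add_finrank_ker (G.coboundary K)
    have euler := G.euler
    rw [LinearMap.range_eq_top.2 G.faceSum_surjective, finrank_top] at dim_edges
    rw [finrank_ker_coboundary] at dim_verts
    simp only [Module.finrank_fintype_fun_eq_card] at dim_edges dim_verts
    omega

end Planarity

end PlaneGraph

namespace PlaneGraph

variable {V E F : Type*} [Fintype V] [Fintype E] [Fintype F]

section Incidence

lemma bd_ne_zero_iff (G : PlaneGraph V E F) (f : F) (e : E) :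
    G.bd f e ≠ 0 ↔ (G.side (e, true) = some f ∧ G.side (e, false) ≠ some f) ∨
      (G.side (e, false) = some f ∧ G.side (e, true) ≠ some f) := by
  unfold bd
  by_cases h1 : G.side (e, true) = some f <;> by_cases h2 : G.side (e, false) = some f <;>
    simp [h1, h2]

lemma cast_bd_ne_zero_iff {R : Type*} [Ring R] [Nontrivial R] (G : PlaneGraph V E F) (f : F)
    (e : E) : (G.bd f e : R) ≠ 0 ↔ G.bd f e ≠ 0 := by
  unfold bd
  split_ifs <;> simp

lemma eq_or_eq_of_bd_ne_zero (G : PlaneGraph V E F) {f f' f'' : F} {e : E} (hne : f ≠ f')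
    (hf : G.bd f e ≠ 0) (hf' : G.bd f' e ≠ 0) (hf'' : G.bd f'' e ≠ 0) : f'' = f ∨ f'' = f' := by
  rw [bd_ne_zero_iff] at hf hf' hf''
  grind

lemma bd_add_bd_eq_zero (G : PlaneGraph V E F) {f f' : F} {e : E} (hne : f ≠ f')
    (hf : G.bd f e ≠ 0) (hf' : G.bd f' e ≠ 0) : G.bd f e + G.bd f' e = 0 := by
  rw [bd_ne_zero_iff] at hf hf'
  unfold bd
  rcases hf with ⟨_, _⟩ | ⟨_, _⟩ <;> rcases hf' with ⟨_, _⟩ | ⟨_, _⟩ <;> simp_all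

lemma faceSum_eq_sum_of_support {R : Type*} [CommRing R] (G : PlaneGraph V E F) {J : Finset E}
    {z : E → R} (hz : ∀ e ∉ J, z e = 0) (f : F) :
    G.faceSum R z f = ∑ e ∈ J, (G.bd f e : R) * z e := by
  rw [faceSum_apply]
  exact (Finset.sum_subset J.subset_univ fun e _ he => by rw [hz e he, mul_zero]).symm

end Incidence

section CutSpace

/-- Two vertices are related if they lie in the same component of the graph without the edges in
`J`. -/
def componentSetoid (G : PlaneGraph V E F) (J : Finset E) : Setoid V :=
  Relation.EqvGen.setoid fun u v => ∃ e ∉ J, u = G.src (e, true) ∧ v = G.src (e, false)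

/-- The coboundary map of the graph obtained by contracting all edges outside `J`, extended by zero
to those edges. -/
def contractedCoboundary (R : Type*) [CommRing R] (G : PlaneGraph V E F) (J : Finset E) :
    (Quotient (G.componentSetoid J) → R) →ₗ[R] (E → R) :=
  G.coboundary R ∘ₗ LinearMap.funLeft R R (Quotient.mk _)

variable {R : Type*} [CommRing R]

lemma contractedCoboundary_apply (G : PlaneGraph V E F) (J : Finset E)
    (w : Quotient (G.componentSetoid J) → R) (e : E) :
    G.contractedCoboundary R J w e = w ⟦G.src (e, false)⟧ - w ⟦G.src (e, true)⟧ := rfl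

lemma contractedCoboundary_apply_of_notMem (G : PlaneGraph V E F) {J : Finset E}
    (w : Quotient (G.componentSetoid J) → R) {e : E} (he : e ∉ J) :
    G.contractedCoboundary R J w e = 0 := by
  have same_class : (⟦G.src (e, true)⟧ : Quotient (G.componentSetoid J)) = ⟦G.src (e, false)⟧ :=
    Quotient.sound (.rel _ _ ⟨e, he, rfl, rfl⟩)
  rw [contractedCoboundary_apply, same_class, sub_self]

lemma coboundary_mem_range_contractedCoboundary (G : PlaneGraph V E F) {J : Finset E} {x : V → R}
    (hx : ∀ e ∉ J, G.coboundary R x e = 0) :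
    G.coboundary R x ∈ LinearMap.range (G.contractedCoboundary R J) := by
  have const_on_classes (u v : V) (huv : G.componentSetoid J u v) : x u = x v := by
    induction huv with
    | rel u v h =>
      obtain ⟨e, he, rfl, rfl⟩ := h
      exact (sub_eq_zero.1 (hx e he)).symm
    | refl => rfl
    | symm _ _ _ ih => exact ih.symm
    | trans _ _ _ _ _ ih1 ih2 => exact ih1.trans ih2
  exact ⟨fun q => Quotient.lift x const_on_classes q, rfl⟩

variable {K : Type*} [Field K]

open scoped Classical in
lemma finrank_range_contractedCoboundary_lt (G : PlaneGraph V E F) (J : Finset E) :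
    Module.finrank K (LinearMap.range (G.contractedCoboundary K J)) <
      Fintype.card (Quotient (G.componentSetoid J)) := by
  obtain ⟨v⟩ := G.nonempty
  have one_mem_ker : (fun _ => 1) ∈ LinearMap.ker (G.contractedCoboundary K J) := by
    ext e
    simp [contractedCoboundary_apply]
  have ker_pos : 0 < Module.finrank K (LinearMap.ker (G.contractedCoboundary K J)) := by
    rw [Module.finrank_pos_iff_exists_ne_zero]
    exact ⟨⟨_, one_mem_ker⟩, fun h => one_ne_zero (congrFun (congrArg Subtype.val h) ⟦v⟧)⟩
  have rank_nullity := LinearMap.finrank_range_add_finrank_ker (G.contractedCoboundary K J)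
  rw [Module.finrank_fintype_fun_eq_card] at rank_nullity
  omega

open scoped Classical in
/-- A function on `J` with zero sum around each face is a coboundary, by exactness, so it comes
from the graph in which the edges outside `J` are contracted. -/
lemma card_lt_card_add_card_quotient (G : PlaneGraph V E F) {J : Finset E} (R : Finset F)
    (hR : ∀ z : E → K, (∀ e ∉ J, z e = 0) → (∀ f ∈ R, G.faceSum K z f = 0) → G.faceSum K z = 0) :
    J.card < R.card + Fintype.card (Quotient (G.componentSetoid J)) := by
  let extend := Function.ExtendByZero.linearMap K (Subtype.val : J → E)
  have extend_injective : Function.Injective extend := fun x y h => funext fun e => by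
    simpa [extend, Subtype.val_injective.extend_apply] using congrFun h e
  let faceSumOn : (J → K) →ₗ[K] (R → K) :=
    LinearMap.funLeft K K Subtype.val ∘ₗ G.faceSum K ∘ₗ extend
  have ker_le : (LinearMap.ker faceSumOn).map extend ≤
      LinearMap.range (G.contractedCoboundary K J) := by
    rintro _ ⟨z, hz, rfl⟩
    have support : ∀ e ∉ J, extend z e = 0 := fun e he =>
      Function.extend_apply' _ _ _ fun ⟨e', h⟩ => he (h ▸ e'.2)
    have mem_ker : extend z ∈ LinearMap.ker (G.faceSum K) :=
      hR _ support fun f hf => congrFun hz ⟨f, hf⟩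
    rw [ker_faceSum] at mem_ker
    obtain ⟨x, hx⟩ := mem_ker
    rw [← hx] at support ⊢
    exact G.coboundary_mem_range_contractedCoboundary support
  have finrank_ker_le := Submodule.finrank_mono ker_le
  rw [← (Submodule.equivMapOfInjective extend extend_injective _).finrank_eq] at finrank_ker_le
  have rank_nullity := LinearMap.finrank_range_add_finrank_ker faceSumOn
  have finrank_range_le := Submodule.finrank_le (LinearMap.range faceSumOn)
  have := G.finrank_range_contractedCoboundary_lt (K := K) J
  simp only [Module.finrank_fintype_fun_eq_card, Fintype.card_coe] at rank_nullity finrank_range_le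
  omega

open scoped Classical in
/-- Every vertex of the contracted graph gives a cut, which contains at least three edges of `I`,
and every edge belongs to at most two such cuts. -/
lemma three_mul_card_quotient_le (G : PlaneGraph V E F) {J I : Finset E}
    (hQ : 1 < Fintype.card (Quotient (G.componentSetoid J)))
    (hcut : ∀ z : E → K, (∀ e ∉ J, z e = 0) → G.faceSum K z = 0 → z ≠ 0 →
      3 ≤ (I.filter fun e => z e ≠ 0).card) :
    3 * Fintype.card (Quotient (G.componentSetoid J)) ≤ 2 * I.card := by
  let cut (q : Quotient (G.componentSetoid J)) : E → K :=
    G.contractedCoboundary K J (Pi.single q 1)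
  have cut_ne_zero (q) : cut q ≠ 0 := by
    intro h
    obtain ⟨q', hq'⟩ := Fintype.exists_ne_of_one_lt_card hQ q
    obtain ⟨u, rfl⟩ := Quotient.exists_rep q
    obtain ⟨v, rfl⟩ := Quotient.exists_rep q'
    have := G.eq_of_coboundary_eq_zero h u v
    simp [LinearMap.funLeft_apply, hq'] at this
  have three_le_card_cut (q) : 3 ≤ (I.filter fun e => cut q e ≠ 0).card :=
    hcut _ (fun _ he => G.contractedCoboundary_apply_of_notMem _ he) (G.faceSum_coboundary _)
      (cut_ne_zero q)
  have card_cuts_le_two (e : E) : (Finset.univ.filter fun q => cut q e ≠ 0).card ≤ 2 := by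
    refine (Finset.card_le_card (t := {⟦G.src (e, false)⟧, ⟦G.src (e, true)⟧}) ?_).trans
      Finset.card_le_two
    intro q hq
    by_contra hn
    simp only [Finset.mem_insert, Finset.mem_singleton, not_or] at hn
    refine (Finset.mem_filter.1 hq).2 ?_
    simp only [cut, contractedCoboundary_apply, Pi.single_eq_of_ne' hn.1,
      Pi.single_eq_of_ne' hn.2, sub_self]
  rw [mul_comm 3, mul_comm 2, ← smul_eq_mul, ← smul_eq_mul, ← Finset.card_univ,
    ← Finset.sum_const, ← Finset.sum_const]
  calc ∑ _q : Quotient (G.componentSetoid J), 3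
      ≤ ∑ q, (I.filter fun e => cut q e ≠ 0).card :=
        Finset.sum_le_sum fun q _ => three_le_card_cut q
    _ = ∑ e ∈ I, (Finset.univ.filter fun q => cut q e ≠ 0).card := by
        simp only [Finset.card_filter]
        exact Finset.sum_comm
    _ ≤ ∑ _e ∈ I, 2 := Finset.sum_le_sum fun e _ => card_cuts_le_two e

open scoped Classical in
lemma card_le_or_three_mul_card_add_one_le (G : PlaneGraph V E F) {J I : Finset E} (R : Finset F)
    (hR : ∀ z : E → K, (∀ e ∉ J, z e = 0) → (∀ f ∈ R, G.faceSum K z f = 0) → G.faceSum K z = 0)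
    (hcut : ∀ z : E → K, (∀ e ∉ J, z e = 0) → G.faceSum K z = 0 → z ≠ 0 →
      3 ≤ (I.filter fun e => z e ≠ 0).card) :
    J.card ≤ R.card ∨ 3 * (J.card + 1) ≤ 2 * I.card + 3 * R.card := by
  have := G.card_lt_card_add_card_quotient R hR
  rcases le_or_gt (Fintype.card (Quotient (G.componentSetoid J))) 1 with hQ | hQ
  · left; omega
  · have := G.three_mul_card_quotient_le hQ hcut
    right; omega

end CutSpace

section SharedEdges

/-- Every face in `X` has at most one edge in `I` that is on no other face in `X`. -/
def AtMostOneOuterEdge (G : PlaneGraph V E F) (X : Finset F) (I : Finset E) : Prop :=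
  ∀ f ∈ X, ∀ e ∈ I, ∀ e' ∈ I, G.bd f e ≠ 0 → G.bd f e' ≠ 0 →
    (∀ g ∈ X, g ≠ f → G.bd g e = 0) → (∀ g ∈ X, g ≠ f → G.bd g e' = 0) → e = e'

variable {K : Type*} [Field K]

lemma exists_ne_of_sum_bd_mul_eq_zero {G : PlaneGraph V E F} {I : Finset E} {z : E → K} {f : F}
    (hz : ∑ e ∈ I, (G.bd f e : K) * z e = 0) {e : E} (he : e ∈ I) (hze : z e ≠ 0)
    (hfe : G.bd f e ≠ 0) : ∃ e' ∈ I, e' ≠ e ∧ z e' ≠ 0 ∧ G.bd f e' ≠ 0 := by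
  by_contra! h
  rw [Finset.sum_eq_single e] at hz
  · exact mul_ne_zero ((G.cast_bd_ne_zero_iff f e).2 hfe) hze hz
  · intro e' he' hne
    by_cases hze' : z e' = 0
    · rw [hze', mul_zero]
    · rw [h e' he' hne hze', Int.cast_zero, zero_mul]
  · exact fun h => absurd he h

open scoped Classical in
/-- A cycle of the dual graph with only two edges would have two faces sharing both of them. -/
lemma three_le_card_support {G : PlaneGraph V E F} (hG : G.ShareAtMostOneEdge)
    {X : Finset F} {I : Finset E} (htouch : ∀ e ∈ I, ∃ f ∈ X, G.bd f e ≠ 0)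
    (houter : G.AtMostOneOuterEdge X I)
    {z : E → K} (hz : ∀ f ∈ X, ∑ e ∈ I, (G.bd f e : K) * z e = 0)
    (hne : ∃ e ∈ I, z e ≠ 0) : 3 ≤ (I.filter fun e => z e ≠ 0).card := by
  obtain ⟨e, he, hze⟩ := hne
  obtain ⟨f, hf, hfe⟩ := htouch e he
  obtain ⟨e', he', hee', hze', hfe'⟩ := exists_ne_of_sum_bd_mul_eq_zero (hz f hf) he hze hfe
  by_contra hlt
  have transfer : ∀ x ∈ I, z x ≠ 0 → ∀ y ∈ I, z y ≠ 0 → x ≠ y → ∀ g ∈ X, G.bd g x ≠ 0 →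
      G.bd g y ≠ 0 := by
    intro x hx hzx y hy hzy hxy g hg hgx
    obtain ⟨w, hw, hwx, hzw, hgw⟩ := exists_ne_of_sum_bd_mul_eq_zero (hz g hg) hx hzx hgx
    by_cases hwy : w = y
    · exact hwy ▸ hgw
    · exact absurd (Finset.two_lt_card.2 ⟨x, by simp [hx, hzx], y, by simp [hy, hzy],
        w, by simp [hw, hzw], hxy, hwx.symm, Ne.symm hwy⟩) hlt
  by_cases hex : ∃ g ∈ X, g ≠ f ∧ G.bd g e ≠ 0
  · obtain ⟨g, hg, hgf, hge⟩ := hex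
    exact hee' (hG g f hgf e e' hge hfe (transfer e he hze e' he' hze' hee'.symm g hg hge)
      hfe').symm
  · push Not at hex
    refine hee' (houter f hf e he e' he' hfe hfe' hex fun g hg hgf => ?_).symm
    by_contra hge'
    exact transfer e' he' hze' e he hze hee' g hg hge' (hex g hg hgf)

open scoped Classical in
/-- The edges that are on the boundary of two different faces in `B`. -/
noncomputable def sharedEdges (G : PlaneGraph V E F) (B : Finset F) : Finset E :=
  Finset.univ.filter fun e => ∃ f ∈ B, ∃ f' ∈ B, f ≠ f' ∧ G.bd f e ≠ 0 ∧ G.bd f' e ≠ 0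

lemma mem_sharedEdges {G : PlaneGraph V E F} {B : Finset F} {e : E} :
    e ∈ G.sharedEdges B ↔ ∃ f ∈ B, ∃ f' ∈ B, f ≠ f' ∧ G.bd f e ≠ 0 ∧ G.bd f' e ≠ 0 := by
  simp [sharedEdges]

lemma bd_eq_zero_of_mem_sharedEdges {G : PlaneGraph V E F} {B : Finset F} {e : E}
    (he : e ∈ G.sharedEdges B) {f : F} (hf : f ∉ B) : G.bd f e = 0 := by
  obtain ⟨g, hg, g', hg', hne, hge, hge'⟩ := mem_sharedEdges.1 he
  by_contra hfe
  rcases G.eq_or_eq_of_bd_ne_zero hne hge hge' hfe with rfl | rfl <;> exact hf ‹_›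

lemma sum_bd_eq_zero_of_mem_sharedEdges {G : PlaneGraph V E F} {B : Finset F} {e : E}
    (he : e ∈ G.sharedEdges B) : ∑ f ∈ B, G.bd f e = 0 := by
  classical
  obtain ⟨g, hg, g', hg', hne, hge, hge'⟩ := mem_sharedEdges.1 he
  rw [← Finset.sum_subset (s₁ := {g, g'}), Finset.sum_pair hne,
    G.bd_add_bd_eq_zero hne hge hge']
  · exact Finset.insert_subset hg (Finset.singleton_subset_iff.2 hg')
  · intro f _ hf
    by_contra hfe
    exact hf (by simpa using G.eq_or_eq_of_bd_ne_zero hne hge hge' hfe)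

lemma atMostOneOuterEdge_sharedEdges (G : PlaneGraph V E F) (B : Finset F) :
    G.AtMostOneOuterEdge B (G.sharedEdges B) := by
  intro f _ e he _ _ _ _ houter _
  obtain ⟨g, hg, g', hg', hne, hge, hge'⟩ := mem_sharedEdges.1 he
  by_cases hgf : g = f
  · exact absurd (houter g' hg' fun h => hne (hgf.trans h.symm)) hge'
  · exact absurd (houter g hg hgf) hge

lemma sum_faceSum_eq_zero_of_support_sharedEdges {R : Type*} [CommRing R] {G : PlaneGraph V E F}
    {B : Finset F} {z : E → R} (hz : ∀ e ∉ G.sharedEdges B, z e = 0) :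
    ∑ f ∈ B, G.faceSum R z f = 0 := by
  simp only [G.faceSum_eq_sum_of_support hz]
  rw [Finset.sum_comm]
  refine Finset.sum_eq_zero fun e he => ?_
  rw [← Finset.sum_mul, ← Int.cast_sum, sum_bd_eq_zero_of_mem_sharedEdges he, Int.cast_zero,
    zero_mul]

lemma card_sharedEdges_add_three_le {G : PlaneGraph V E F} (hG : G.ShareAtMostOneEdge)
    {B : Finset F} (hB : B.Nonempty) : (G.sharedEdges B).card + 3 ≤ 3 * B.card := by
  classical
  obtain ⟨b, hb⟩ := hB
  have bound := G.card_le_or_three_mul_card_add_one_le (K := ℚ) (J := G.sharedEdges B)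
    (I := G.sharedEdges B) (B.erase b) ?_ ?_
  · have := Finset.card_erase_add_one hb
    omega
  · intro z hz hzero
    ext f
    by_cases hf : f ∈ B
    · by_cases hfb : f = b
      · have total := sum_faceSum_eq_zero_of_support_sharedEdges hz
        rw [← Finset.sum_erase_add _ _ hb, Finset.sum_eq_zero hzero, zero_add] at total
        rw [hfb, total, Pi.zero_apply]
      · exact hzero f (Finset.mem_erase.2 ⟨hfb, hf⟩)
    · rw [G.faceSum_eq_sum_of_support hz]
      exact Finset.sum_eq_zero fun e he => by simp [bd_eq_zero_of_mem_sharedEdges he hf]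
  · intro z hz hzero hne
    refine three_le_card_support hG (X := B) (fun e he => ?_)
      (G.atMostOneOuterEdge_sharedEdges B) (fun f _ => ?_) ?_
    · obtain ⟨g, hg, -, -, -, hge, -⟩ := mem_sharedEdges.1 he
      exact ⟨g, hg, hge⟩
    · rw [← G.faceSum_eq_sum_of_support hz, hzero, Pi.zero_apply]
    · by_contra! h
      exact hne (funext fun e => if he : e ∈ G.sharedEdges B then h e he else hz e he)

end SharedEdges

end PlaneGraph

namespace PlaneGraph

variable {V E F : Type*} [Fintype V] [Fintype E] [Fintype F]

section RemainingEdges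

open scoped Classical in
/-- The edges that remain when all faces outside `Φ` are contracted, i.e. the edges on the boundary
of no face outside `Φ`. -/
noncomputable def remainingEdges (G : PlaneGraph V E F) (Φ : Finset F) : Finset E :=
  Finset.univ.filter fun e => ∀ f, f ∉ Φ → G.bd f e = 0

open scoped Classical in
/-- The remaining edges that are on the boundary of a face in `X`. -/
noncomputable def remainingEdgesOn (G : PlaneGraph V E F) (Φ X : Finset F) : Finset E :=
  (G.remainingEdges Φ).filter fun e => ∃ f ∈ X, G.bd f e ≠ 0

/-- A nonempty set `C` of faces that no remaining edge separates from the other faces in `Φ` and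
from the unbounded face. Since the entries `G.bd f e` of an edge on two bounded faces cancel, this
is encoded by a vanishing sum. -/
def IsClosedIn (G : PlaneGraph V E F) (Φ C : Finset F) : Prop :=
  C ⊆ Φ ∧ C.Nonempty ∧ ∀ e ∈ G.remainingEdges Φ, ∑ f ∈ C, G.bd f e = 0

variable {G : PlaneGraph V E F} {Φ X T : Finset F} {e : E}

lemma mem_remainingEdges : e ∈ G.remainingEdges Φ ↔ ∀ f, f ∉ Φ → G.bd f e = 0 := by
  simp [remainingEdges]

lemma mem_remainingEdgesOn : e ∈ G.remainingEdgesOn Φ X ↔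
    e ∈ G.remainingEdges Φ ∧ ∃ f ∈ X, G.bd f e ≠ 0 := by
  simp [remainingEdgesOn]

lemma remainingEdgesOn_mono (G : PlaneGraph V E F) (Φ : Finset F) {X Y : Finset F} (h : X ⊆ Y) :
    G.remainingEdgesOn Φ X ⊆ G.remainingEdgesOn Φ Y := by
  intro e he
  obtain ⟨he, f, hf, hfe⟩ := mem_remainingEdgesOn.1 he
  exact mem_remainingEdgesOn.2 ⟨he, f, h hf, hfe⟩

open scoped Classical in
lemma mem_remainingEdges_sdiff : e ∈ G.remainingEdges (Φ \ T) ↔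
    e ∈ G.remainingEdges Φ ∧ e ∉ G.remainingEdgesOn Φ T := by
  simp only [mem_remainingEdges, mem_remainingEdgesOn, Finset.mem_sdiff, not_and, not_exists,
    not_not]
  constructor
  · intro h
    exact ⟨fun f hf => h f fun hΦ => absurd hΦ hf, fun _ f hf => h f fun _ => hf⟩
  · rintro ⟨h, hT⟩ f hf
    by_cases hΦ : f ∈ Φ
    · exact hT h f (hf hΦ)
    · exact h f hΦ

open scoped Classical in
lemma mem_remainingEdgesOn_sdiff : e ∈ G.remainingEdgesOn (Φ \ T) X ↔
    e ∈ G.remainingEdgesOn Φ X ∧ e ∉ G.remainingEdgesOn Φ T := by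
  rw [mem_remainingEdgesOn, mem_remainingEdges_sdiff, mem_remainingEdgesOn (X := X)]
  tauto

lemma not_isClosedIn_univ (G : PlaneGraph V E F) (C : Finset F) :
    ¬ G.IsClosedIn Finset.univ C := by
  classical
  rintro ⟨-, ⟨f, hf⟩, h⟩
  have := G.eq_zero_of_elim_side_eq (y := fun g => if g ∈ C then (1 : ℤ) else 0) fun e => by
    rw [← sub_eq_zero, ← sum_mul_bd]
    simpa using h e (by simp [mem_remainingEdges])
  simpa [hf] using congrFun this f

end RemainingEdges

section SpanningEdges

variable {K : Type*} [Field K]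

open scoped Classical in
lemma isClosedIn_filter_eq {G : PlaneGraph V E F} {Φ : Finset F} {y : F → K}
    (hy : ∀ f ∉ Φ, y f = 0)
    (hsum : ∀ e ∈ G.remainingEdges Φ, ∑ f, y f * (G.bd f e : K) = 0) {f : F} (hf : y f ≠ 0) :
    G.IsClosedIn Φ (Finset.univ.filter fun g => y g = y f) := by
  refine ⟨fun g hg => ?_, ⟨f, by simp⟩, fun e he => ?_⟩
  · by_contra hgΦ
    exact hf ((Finset.mem_filter.1 hg).2 ▸ hy g hgΦ)
  · have indicator_elim (o : Option F) : (o.elim 0 fun g => if y g = y f then (1 : ℤ) else 0) =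
        if o.elim 0 y = y f then 1 else 0 := by
      cases o
      · simp [Ne.symm hf]
      · rfl
    have elim_eq := hsum e he
    rw [sum_mul_bd, sub_eq_zero] at elim_eq
    have := G.sum_mul_bd (fun g => if y g = y f then (1 : ℤ) else 0) e
    rw [indicator_elim, indicator_elim, elim_eq, sub_self] at this
    simpa [Finset.sum_filter] using this

/-- A functional that vanishes on all these columns would have a closed level set. -/
lemma span_range_bd_eq_top {G : PlaneGraph V E F} {Φ : Finset F}
    (h : ∀ C, ¬ G.IsClosedIn Φ C) :
    Submodule.span K (Set.range fun (e : G.remainingEdges Φ) (f : Φ) => (G.bd f e : K)) = ⊤ := by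
  classical
  by_contra hne
  obtain ⟨φ, hφ, hle⟩ := Submodule.exists_le_ker_of_lt_top _ (lt_top_iff_ne_top.2 hne)
  let y (f : F) : K := if hf : f ∈ Φ then φ (Pi.single ⟨f, hf⟩ 1) else 0
  have y_of_notMem : ∀ f ∉ Φ, y f = 0 := fun f hf => dif_neg hf
  have y_coe (f : Φ) : y f = φ (Pi.single f 1) := dif_pos f.2
  have sum_eq_zero : ∀ e ∈ G.remainingEdges Φ, ∑ f, y f * (G.bd f e : K) = 0 := by
    intro e he
    have hφe : φ (fun f : Φ => (G.bd f e : K)) = 0 :=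
      hle (Submodule.subset_span ⟨⟨e, he⟩, rfl⟩)
    rw [pi_eq_sum_univ (fun f : Φ => (G.bd f e : K)), map_sum] at hφe
    rw [← Finset.sum_subset Φ.subset_univ fun f _ hf => by rw [y_of_notMem f hf, zero_mul],
      ← Finset.sum_coe_sort, ← hφe]
    refine Finset.sum_congr rfl fun f _ => ?_
    rw [y_coe, map_smul, smul_eq_mul, mul_comm]
    congr 2
    ext g
    simp [Pi.single_apply, eq_comm]
  refine hφ (LinearMap.pi_ext' fun f => LinearMap.ext_ring ?_)
  by_contra hf
  exact h _ (isClosedIn_filter_eq y_of_notMem sum_eq_zero (f := f) (by simpa [y_coe] using hf))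

lemma exists_spanning_edges (K : Type*) [Field K] {G : PlaneGraph V E F} {Φ : Finset F}
    (h : ∀ C, ¬ G.IsClosedIn Φ C) :
    ∃ τ ⊆ G.remainingEdges Φ, τ.card = Φ.card ∧
      ∀ z : E → K, (∀ e ∉ τ, z e = 0) → (∀ f ∈ Φ, G.faceSum K z f = 0) → z = 0 := by
  classical
  obtain ⟨κ, a, ha, hspan, hli⟩ := exists_linearIndependent' K
    fun (e : G.remainingEdges Φ) (f : Φ) => (G.bd f e : K)
  rw [span_range_bd_eq_top h] at hspan
  have : Fintype κ := Fintype.ofInjective a ha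
  have card_κ : Fintype.card κ = Φ.card := by
    have := finrank_span_eq_card hli
    rw [hspan, finrank_top, Module.finrank_fintype_fun_eq_card, Fintype.card_coe] at this
    exact this.symm
  have injective : Function.Injective fun i => (a i : E) := Subtype.val_injective.comp ha
  refine ⟨Finset.univ.image fun i => (a i : E), ?_, ?_, fun z hz hsum => ?_⟩
  · exact Finset.image_subset_iff.2 fun i _ => (a i).2
  · rw [Finset.card_image_of_injective _ injective, Finset.card_univ, card_κ]
  · have combination : ∑ i, z (a i) • (fun f : Φ => (G.bd f (a i) : K)) = 0 := by
      ext f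
      have := hsum f f.2
      rw [G.faceSum_eq_sum_of_support hz, Finset.sum_image fun i _ j _ h => injective h] at this
      simpa [Finset.sum_apply, mul_comm] using this
    have zero_on_κ := Fintype.linearIndependent_iff.1 hli _ combination
    ext e
    by_cases he : e ∈ Finset.univ.image fun i => (a i : E)
    · obtain ⟨i, -, rfl⟩ := Finset.mem_image.1 he
      exact zero_on_κ i
    · exact hz e he

open scoped Classical in
/-- If the faces outside `X` are connected to the unbounded face, then they can be merged with it
along spanning edges, and the bound for simple planar graphs applies to the faces in `X`. -/
lemma card_add_three_le {G : PlaneGraph V E F} (hG : G.ShareAtMostOneEdge) {Φ X : Finset F}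
    (hX : X ⊆ Φ) (hX2 : 2 ≤ X.card) (hcl : ∀ C, ¬ G.IsClosedIn (Φ \ X) C) {I : Finset E}
    (hI : I ⊆ G.remainingEdgesOn Φ X) (houter : G.AtMostOneOuterEdge X I) :
    I.card + 3 ≤ 3 * X.card := by
  obtain ⟨τ, hτ, card_τ, eq_zero_of_τ⟩ := exists_spanning_edges ℚ hcl
  have bd_τ : ∀ e ∈ τ, ∀ f, f ∉ Φ \ X → G.bd f e = 0 := fun e he =>
    mem_remainingEdges.1 (hτ he)
  have bd_I : ∀ e ∈ I, ∀ f, f ∉ Φ → G.bd f e = 0 := fun e he =>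
    mem_remainingEdges.1 (mem_remainingEdgesOn.1 (hI he)).1
  have touch : ∀ e ∈ I, ∃ f ∈ X, G.bd f e ≠ 0 := fun e he => (mem_remainingEdgesOn.1 (hI he)).2
  have disjoint : Disjoint I τ := Finset.disjoint_left.2 fun e he heτ => by
    obtain ⟨f, hf, hfe⟩ := touch e he
    exact hfe (bd_τ e heτ f (by simp [hf]))
  have bound := G.card_le_or_three_mul_card_add_one_le (K := ℚ) (J := I ∪ τ) (I := I) Φ ?_ ?_
  · rw [Finset.card_union_of_disjoint disjoint, card_τ, Finset.card_sdiff_of_subset hX] at bound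
    have := Finset.card_le_card hX
    omega
  · intro z hz hsum
    ext f
    by_cases hf : f ∈ Φ
    · exact hsum f hf
    · rw [G.faceSum_eq_sum_of_support hz]
      refine Finset.sum_eq_zero fun e he => ?_
      rcases Finset.mem_union.1 he with heI | heτ
      · rw [bd_I e heI f hf, Int.cast_zero, zero_mul]
      · rw [bd_τ e heτ f (by simp [hf]), Int.cast_zero, zero_mul]
  · intro z hz hsum hne
    refine three_le_card_support hG touch houter (fun f hf => ?_) ?_
    · rw [← Pi.zero_apply (M := fun _ => ℚ) f, ← hsum, G.faceSum_eq_sum_of_support hz,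
        Finset.sum_union disjoint, left_eq_add]
      exact Finset.sum_eq_zero fun e he => by rw [bd_τ e he f (by simp [hf])]; simp
    · by_contra! hzI
      refine hne (eq_zero_of_τ z (fun e heτ => ?_) fun f _ => congrFun hsum f)
      by_cases heI : e ∈ I
      · exact hzI e heI
      · exact hz e (by simp [heI, heτ])

end SpanningEdges

section MinimalContractible

/-- A set of faces that is minimal among the nonempty sets with at most three times as many
remaining edges as faces: this is `Minor.IsMinimalContractible` for the contraction with faces `Φ`,
without reference to its edges. -/
def IsMinContractible (G : PlaneGraph V E F) (Φ X : Finset F) : Prop :=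
  X ⊆ Φ ∧ X.Nonempty ∧ (G.remainingEdgesOn Φ X).card ≤ 3 * X.card ∧
    ∀ T, T ⊂ X → T.Nonempty → 3 * T.card < (G.remainingEdgesOn Φ T).card

lemma exists_isMinContractible (G : PlaneGraph V E F) {Φ X : Finset F} (hX : X ⊆ Φ)
    (hne : X.Nonempty) (hc : (G.remainingEdgesOn Φ X).card ≤ 3 * X.card) :
    ∃ W ⊆ X, G.IsMinContractible Φ W := by
  induction X using Finset.strongInduction with
  | H X ih =>
    by_cases h : ∃ T, T ⊂ X ∧ T.Nonempty ∧ (G.remainingEdgesOn Φ T).card ≤ 3 * T.card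
    · obtain ⟨T, hT, hTne, hTc⟩ := h
      obtain ⟨W, hW, hWm⟩ := ih T hT (hT.subset.trans hX) hTne hTc
      exact ⟨W, hW.trans hT.subset, hWm⟩
    · push Not at h
      exact ⟨X, subset_rfl, hX, hne, hc, fun T hT hTne => h T hT hTne⟩

namespace IsClosedIn

variable {G : PlaneGraph V E F} {Φ C : Finset F}

lemma exists_ne (h : G.IsClosedIn Φ C) {e : E} (he : e ∈ G.remainingEdges Φ) {f : F} (hf : f ∈ C)
    (hfe : G.bd f e ≠ 0) : ∃ f' ∈ C, f' ≠ f ∧ G.bd f' e ≠ 0 := by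
  by_contra! hother
  have := h.2.2 e he
  rw [Finset.sum_eq_single f hother fun h => absurd hf h] at this
  exact hfe this

lemma mem_of_bd_ne_zero (h : G.IsClosedIn Φ C) {e : E} (he : e ∈ G.remainingEdges Φ) {f g : F}
    (hf : f ∈ C) (hfe : G.bd f e ≠ 0) (hge : G.bd g e ≠ 0) : g ∈ C := by
  obtain ⟨f', hf', hne, hfe'⟩ := h.exists_ne he hf hfe
  rcases G.eq_or_eq_of_bd_ne_zero hne hfe' hfe hge with rfl | rfl <;> assumption

lemma card_remainingEdgesOn_add_three_le (hG : G.ShareAtMostOneEdge) (h : G.IsClosedIn Φ C) :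
    (G.remainingEdgesOn Φ C).card + 3 ≤ 3 * C.card := by
  refine le_trans (Nat.add_le_add_right (Finset.card_le_card fun e he => ?_) 3)
    (card_sharedEdges_add_three_le hG h.2.1)
  obtain ⟨he, f, hf, hfe⟩ := mem_remainingEdgesOn.1 he
  obtain ⟨f', hf', hne, hfe'⟩ := h.exists_ne he hf hfe
  exact mem_sharedEdges.2 ⟨f, hf, f', hf', hne.symm, hfe, hfe'⟩

open scoped Classical in
lemma card_remainingEdgesOn_erase_le (hG : G.ShareAtMostOneEdge) (h : G.IsClosedIn Φ C) {f : F}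
    (hf : f ∈ C) : (G.remainingEdgesOn Φ (C.erase f)).card ≤ 3 * (C.erase f).card := by
  have card_le := h.card_remainingEdgesOn_add_three_le hG
  have card_mono := Finset.card_le_card (G.remainingEdgesOn_mono Φ (Finset.erase_subset f C))
  rw [Finset.card_erase_of_mem hf]
  omega

open scoped Classical in
lemma sdiff {D : Finset F} (hC : G.IsClosedIn Φ C) (hD : G.IsClosedIn Φ D) (hDC : D ⊂ C) :
    G.IsClosedIn Φ (C \ D) := by
  refine ⟨Finset.sdiff_subset.trans hC.1, Finset.sdiff_nonempty.2 hDC.2, fun e he => ?_⟩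
  rw [Finset.sum_sdiff_eq_sub hDC.subset, hC.2.2 e he, hD.2.2 e he, sub_zero]

lemma exists_minimal (h : G.IsClosedIn Φ C) {t : F} (ht : t ∈ C) :
    ∃ D ⊆ C, t ∈ D ∧ G.IsClosedIn Φ D ∧ ∀ D', D' ⊂ D → ¬ G.IsClosedIn Φ D' := by
  classical
  induction C using Finset.strongInduction with
  | H C ih =>
    by_cases hmin : ∀ D', D' ⊂ C → ¬ G.IsClosedIn Φ D'
    · exact ⟨C, subset_rfl, ht, h, hmin⟩
    push Not at hmin
    obtain ⟨D', hD', hcl⟩ := hmin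
    by_cases htD : t ∈ D'
    · obtain ⟨D, hD, hrest⟩ := ih D' hD' hcl htD
      exact ⟨D, hD.trans hD'.subset, hrest⟩
    · obtain ⟨D, hD, hrest⟩ := ih (C \ D') (Finset.sdiff_ssubset hD'.subset hcl.2.1)
        (h.sdiff hcl hD') (Finset.mem_sdiff.2 ⟨ht, htD⟩)
      exact ⟨D, hD.trans Finset.sdiff_subset, hrest⟩

open scoped Classical in
lemma disjoint_or_subset (h : G.IsClosedIn Φ C) {T : Finset F} (hT : G.IsMinContractible Φ T) :
    Disjoint T C ∨ T ⊆ C := by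
  by_contra! hn
  rw [Finset.not_disjoint_iff] at hn
  obtain ⟨⟨t, htT, htC⟩, hsub⟩ := hn
  obtain ⟨u, huT, huC⟩ := Finset.not_subset.1 hsub
  have many_inter := hT.2.2.2 (T ∩ C)
    ⟨Finset.inter_subset_left, fun h => huC (Finset.mem_inter.1 (h huT)).2⟩
    ⟨t, by simp [htT, htC]⟩
  have many_sdiff := hT.2.2.2 (T \ C)
    ⟨Finset.sdiff_subset, fun h => (Finset.mem_sdiff.1 (h htT)).2 htC⟩ ⟨u, by simp [huT, huC]⟩
  have disjoint : Disjoint (G.remainingEdgesOn Φ (T ∩ C)) (G.remainingEdgesOn Φ (T \ C)) := by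
    rw [Finset.disjoint_left]
    intro e he he'
    obtain ⟨he, f, hf, hfe⟩ := mem_remainingEdgesOn.1 he
    obtain ⟨-, g, hg, hge⟩ := mem_remainingEdgesOn.1 he'
    exact (Finset.mem_sdiff.1 hg).2
      (h.mem_of_bd_ne_zero he (Finset.mem_inter.1 hf).2 hfe hge)
  have card_union := Finset.card_le_card (Finset.union_subset
    (G.remainingEdgesOn_mono Φ (Finset.inter_subset_left (s₁ := T) (s₂ := C)))
    (G.remainingEdgesOn_mono Φ (Finset.sdiff_subset (s := T) (t := C))))
  rw [Finset.card_union_of_disjoint disjoint] at card_union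
  have card_split := Finset.card_inter_add_card_sdiff T C
  have few := hT.2.2.1
  omega

end IsClosedIn

end MinimalContractible

end PlaneGraph

namespace PlaneGraph

variable {V E F : Type*} [Fintype V] [Fintype E] [Fintype F] {G : PlaneGraph V E F}
  {Φ C S X : Finset F} {f : F}

section ContractionStep

lemma isClosedIn_singleton_iff :
    G.IsClosedIn Φ {f} ↔ f ∈ Φ ∧ ∀ e ∈ G.remainingEdges Φ, G.bd f e = 0 := by
  simp [IsClosedIn]

lemma mem_remainingEdgesOn_singleton {e : E} :
    e ∈ G.remainingEdgesOn Φ {f} ↔ e ∈ G.remainingEdges Φ ∧ G.bd f e ≠ 0 := by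
  simp [mem_remainingEdgesOn]

lemma remainingEdgesOn_nonempty (hC : C ⊆ Φ) (hne : C.Nonempty) (hcl : ¬ G.IsClosedIn Φ C) :
    (G.remainingEdgesOn Φ C).Nonempty := by
  by_contra hempty
  refine hcl ⟨hC, hne, fun e he => Finset.sum_eq_zero fun f hf => ?_⟩
  by_contra hfe
  exact hempty ⟨e, mem_remainingEdgesOn.2 ⟨he, f, hf, hfe⟩⟩

lemma remainingEdges_mono (G : PlaneGraph V E F) {Φ Ψ : Finset F} (h : Φ ⊆ Ψ) :
    G.remainingEdges Φ ⊆ G.remainingEdges Ψ := fun _ he =>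
  mem_remainingEdges.2 fun f hf => mem_remainingEdges.1 he f fun hΦ => hf (h hΦ)

open scoped Classical in
lemma IsClosedIn.sdiff_of_disjoint (hC : G.IsClosedIn Φ C) (hS : Disjoint S C) :
    G.IsClosedIn (Φ \ S) C :=
  ⟨Finset.subset_sdiff.2 ⟨hC.1, hS.symm⟩, hC.2.1, fun e he =>
    hC.2.2 e (mem_remainingEdges_sdiff.1 he).1⟩

open scoped Classical in
lemma IsClosedIn.of_sdiff_of_disjoint {D : Finset F} (hC : G.IsClosedIn Φ C) (hS : Disjoint S C)
    (hDC : D ⊆ C) (hD : G.IsClosedIn (Φ \ S) D) : G.IsClosedIn Φ D := by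
  refine ⟨hDC.trans hC.1, hD.2.1, fun e he => ?_⟩
  by_cases heS : e ∈ G.remainingEdgesOn Φ S
  · obtain ⟨-, s, hs, hse⟩ := mem_remainingEdgesOn.1 heS
    refine Finset.sum_eq_zero fun d hd => ?_
    by_contra hde
    exact Finset.disjoint_left.1 hS hs (hC.mem_of_bd_ne_zero he (hDC hd) hde hse)
  · exact hD.2.2 e (mem_remainingEdges_sdiff.2 ⟨he, heS⟩)

open scoped Classical in
lemma IsClosedIn.sdiff_sdiff (hC : G.IsClosedIn Φ C) (hne : (C \ S).Nonempty) :
    G.IsClosedIn (Φ \ S) (C \ S) := by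
  refine ⟨Finset.sdiff_subset_sdiff hC.1 subset_rfl, hne, fun e he => ?_⟩
  obtain ⟨he, heS⟩ := mem_remainingEdges_sdiff.1 he
  rw [← hC.2.2 e he]
  refine Finset.sum_subset Finset.sdiff_subset fun g hg hgS => ?_
  by_contra hge
  exact heS (mem_remainingEdgesOn.2 ⟨he, g, by simpa [hg] using hgS, hge⟩)

open scoped Classical in
lemma not_isClosedIn_sdiff_singleton {Ψ : Finset F} (hΨ : Ψ ⊆ Φ)
    (hedges : G.remainingEdgesOn Φ {f} ⊆ G.remainingEdgesOn Ψ {f})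
    (hΦcl : ∀ C, ¬ G.IsClosedIn Φ C) (hΨcl : ∀ C, ¬ G.IsClosedIn (Ψ \ {f}) C) (C : Finset F) :
    ¬ G.IsClosedIn (Φ \ {f}) C := by
  intro hC
  obtain ⟨e, he, heC⟩ : ∃ e ∈ G.remainingEdges Φ, ∑ f ∈ C, G.bd f e ≠ 0 := by
    by_contra! h
    exact hΦcl C ⟨hC.1.trans Finset.sdiff_subset, hC.2.1, h⟩
  obtain ⟨g, hg, hge⟩ := Finset.exists_ne_zero_of_sum_ne_zero heC
  have hef : e ∈ G.remainingEdgesOn Ψ {f} := by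
    by_contra hef
    exact heC (hC.2.2 e (mem_remainingEdges_sdiff.2 ⟨he, fun h => hef (hedges h)⟩))
  have hgΨ : g ∈ Ψ := by
    by_contra hgΨ
    exact hge (mem_remainingEdges.1 (mem_remainingEdgesOn.1 hef).1 g hgΨ)
  refine hΨcl (C ∩ Ψ) ⟨fun c hc => ?_, ⟨g, Finset.mem_inter.2 ⟨hg, hgΨ⟩⟩, fun x hx => ?_⟩
  · rw [Finset.mem_inter] at hc
    exact Finset.mem_sdiff.2 ⟨hc.2, (Finset.mem_sdiff.1 (hC.1 hc.1)).2⟩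
  · rw [← hC.2.2 x (G.remainingEdges_mono (Finset.sdiff_subset_sdiff hΨ subset_rfl) hx)]
    refine Finset.sum_subset Finset.inter_subset_left fun c hc hc' => ?_
    exact mem_remainingEdges.1 (mem_remainingEdges_sdiff.1 hx).1 c fun hcΨ =>
      hc' (Finset.mem_inter.2 ⟨hc, hcΨ⟩)

open scoped Classical in
lemma card_remainingEdgesOn_erase_add_two_le {e e' : E} (hee' : e ≠ e')
    (he : e ∈ G.remainingEdgesOn Φ X) (he' : e' ∈ G.remainingEdgesOn Φ X)
    (houter : ∀ g ∈ X, g ≠ f → G.bd g e = 0) (houter' : ∀ g ∈ X, g ≠ f → G.bd g e' = 0) :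
    (G.remainingEdgesOn Φ (X.erase f)).card + 2 ≤ (G.remainingEdgesOn Φ X).card := by
  have notMem {x : E} (hx : ∀ g ∈ X, g ≠ f → G.bd g x = 0) :
      x ∉ G.remainingEdgesOn Φ (X.erase f) := fun h => by
    obtain ⟨-, g, hg, hgx⟩ := mem_remainingEdgesOn.1 h
    exact hgx (hx g (Finset.mem_erase.1 hg).2 (Finset.mem_erase.1 hg).1)
  have insert_le := Finset.card_le_card (Finset.insert_subset he (Finset.insert_subset he'
    (G.remainingEdgesOn_mono Φ (Finset.erase_subset f X))))
  rwa [Finset.card_insert_of_notMem (by simp [hee', notMem houter]),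
    Finset.card_insert_of_notMem (notMem houter')] at insert_le

open scoped Classical in
lemma IsMinContractible.card_remainingEdgesOn (hG : G.ShareAtMostOneEdge)
    (hS : G.IsMinContractible Φ S) (hcl : ∀ C, ¬ G.IsClosedIn (Φ \ S) C) (h2 : 2 ≤ S.card) :
    (G.remainingEdgesOn Φ S).card = 3 * S.card := by
  obtain ⟨hSΦ, ⟨f, hf⟩, few, many⟩ := hS
  by_contra hne
  have many_erase : ∀ f ∈ S,
      3 * S.card < (G.remainingEdgesOn Φ (S.erase f)).card + 3 := fun f hf => by
    have := Finset.card_erase_add_one hf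
    have := many (S.erase f) (Finset.erase_ssubset hf) (Finset.card_pos.1 (by omega))
    omega
  have outer : G.AtMostOneOuterEdge S (G.remainingEdgesOn Φ S) := by
    intro f hf e he e' he' _ _ houter houter'
    by_contra hee'
    have := card_remainingEdgesOn_erase_add_two_le hee' he he' houter houter'
    have := many_erase f hf
    omega
  have := card_add_three_le hG hSΦ h2 hcl subset_rfl outer
  have := many_erase f hf
  have := Finset.card_le_card (G.remainingEdgesOn_mono Φ (Finset.erase_subset f S))
  omega

end ContractionStep

/-- A minimal contractible set of faces that shares no remaining edge with any other one. -/
def IsIsolatedContractible (G : PlaneGraph V E F) (Φ S : Finset F) : Prop :=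
  G.IsMinContractible Φ S ∧ ∀ T, G.IsMinContractible Φ T → T ≠ S →
    Disjoint (G.remainingEdgesOn Φ T) (G.remainingEdgesOn Φ S)

namespace IsIsolatedContractible

lemma eq_of_mem (h : G.IsIsolatedContractible Φ S) {T : Finset F} (hT : G.IsMinContractible Φ T)
    {e : E} (heT : e ∈ G.remainingEdgesOn Φ T) (heS : e ∈ G.remainingEdgesOn Φ S) : T = S := by
  by_contra hne
  exact Finset.disjoint_left.1 (h.2 T hT hne) heT heS

open scoped Classical in
/-- Removing one face of `S` from `C` leaves a contractible set, hence another minimal contractible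
set, whose edges are not contracted along `S`. -/
lemma exists_remainingEdge_of_subset (h : G.IsIsolatedContractible Φ S)
    (hG : G.ShareAtMostOneEdge) (hC : G.IsClosedIn Φ C)
    (hmin : ∀ D, D ⊂ C → ¬ G.IsClosedIn Φ D) (h2 : 2 ≤ C.card) (hSC : S ⊆ C) :
    ∃ t ∈ C \ S, ∃ e ∈ G.remainingEdges (Φ \ S), G.bd t e ≠ 0 := by
  obtain ⟨f, hf⟩ := h.1.2.1
  have card_erase := Finset.card_erase_add_one (hSC hf)
  obtain ⟨T, hT, hTmin⟩ := G.exists_isMinContractible ((Finset.erase_subset f C).trans hC.1)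
    (Finset.card_pos.1 (by omega)) (hC.card_remainingEdgesOn_erase_le hG (hSC hf))
  have hTS : T ≠ S := fun h => Finset.notMem_erase f C (hT (h ▸ hf))
  obtain ⟨t, ht⟩ := hTmin.2.1
  have htC : t ∈ C := (Finset.mem_erase.1 (hT ht)).2
  have not_closed : ¬ G.IsClosedIn Φ {t} := by
    refine hmin _ (Finset.ssubset_iff_subset_ne.2 ⟨Finset.singleton_subset_iff.2 htC, ?_⟩)
    rintro rfl
    rw [Finset.card_singleton] at h2
    omega
  obtain ⟨e, het⟩ := remainingEdgesOn_nonempty (Finset.singleton_subset_iff.2 (hC.1 htC))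
    (Finset.singleton_nonempty t) not_closed
  have heT := G.remainingEdgesOn_mono Φ (Finset.singleton_subset_iff.2 ht) het
  have heS : e ∉ G.remainingEdgesOn Φ S := fun heS => hTS (h.eq_of_mem hTmin heT heS)
  rw [mem_remainingEdgesOn_singleton] at het
  exact ⟨t, Finset.mem_sdiff.2 ⟨htC, fun htS =>
    heS (mem_remainingEdgesOn.2 ⟨het.1, t, htS, het.2⟩)⟩, e,
    mem_remainingEdges_sdiff.2 ⟨het.1, heS⟩, het.2⟩

open scoped Classical in
/-- If all edges of `t` were contracted along `S`, then exchanging a face of `S` for `t` would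
produce another minimal contractible set, sharing an edge with `S`. -/
lemma not_isClosedIn_sdiff_singleton (h : G.IsIsolatedContractible Φ S) {t : F}
    (ht : ¬ G.IsClosedIn Φ {t}) : ¬ G.IsClosedIn (Φ \ S) {t} := by
  rw [isClosedIn_singleton_iff, Finset.mem_sdiff]
  rintro ⟨⟨htΦ, htS⟩, no_edge⟩
  have edges_t : G.remainingEdgesOn Φ {t} ⊆ G.remainingEdgesOn Φ S := fun e he => by
    rw [mem_remainingEdgesOn_singleton] at he
    by_contra heS
    exact he.2 (no_edge e (mem_remainingEdges_sdiff.2 ⟨he.1, heS⟩))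
  obtain ⟨e, he⟩ := remainingEdgesOn_nonempty (Finset.singleton_subset_iff.2 htΦ)
    (Finset.singleton_nonempty t) ht
  obtain ⟨f, hf⟩ := h.1.2.1
  have card_exchange : (insert t (S.erase f)).card = S.card := by
    rw [Finset.card_insert_of_notMem fun ht => htS (Finset.mem_erase.1 ht).2,
      Finset.card_erase_add_one hf]
  have edges_exchange :
      G.remainingEdgesOn Φ (insert t (S.erase f)) ⊆ G.remainingEdgesOn Φ S := by
    intro x hx
    obtain ⟨hxΦ, g, hg, hgx⟩ := mem_remainingEdgesOn.1 hx
    rcases Finset.mem_insert.1 hg with rfl | hg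
    · exact edges_t (mem_remainingEdgesOn_singleton.2 ⟨hxΦ, hgx⟩)
    · exact mem_remainingEdgesOn.2 ⟨hxΦ, g, (Finset.mem_erase.1 hg).2, hgx⟩
  obtain ⟨W, hW, hWmin⟩ := G.exists_isMinContractible
    (Finset.insert_subset htΦ ((Finset.erase_subset f S).trans h.1.1)) (Finset.insert_nonempty _ _)
    ((Finset.card_le_card edges_exchange).trans (card_exchange ▸ h.1.2.2.1))
  have hfW : f ∉ W := fun hfW => by
    rcases Finset.mem_insert.1 (hW hfW) with rfl | hf'
    exacts [htS hf, Finset.notMem_erase f _ hf']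
  have htW : t ∈ W := by
    by_contra htW
    have hWS : W ⊆ S := fun x hx => (Finset.mem_erase.1
      ((Finset.mem_insert.1 (hW hx)).resolve_left fun hxt => htW (hxt ▸ hx))).2
    exact absurd hWmin.2.2.1 (not_le.2 (h.1.2.2.2 W ⟨hWS, fun h => hfW (h hf)⟩ hWmin.2.1))
  exact hfW (h.eq_of_mem hWmin
    (G.remainingEdgesOn_mono Φ (Finset.singleton_subset_iff.2 htW) he) (edges_t he) ▸ hf)

lemma notMem_of_not_disjoint (h : G.IsIsolatedContractible Φ S)
    (hf : ¬ Disjoint (G.remainingEdgesOn Φ {f}) (G.remainingEdgesOn Φ S)) {W : Finset F}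
    (hW : G.IsMinContractible Φ W) (hWS : W ≠ S) : f ∉ W := by
  obtain ⟨e, hef, heS⟩ := Finset.not_disjoint_iff.1 hf
  exact fun hfW => hWS (h.eq_of_mem hW
    (G.remainingEdgesOn_mono Φ (Finset.singleton_subset_iff.2 hfW) hef) heS)

lemma three_lt_card_of_not_disjoint (h : G.IsIsolatedContractible Φ S) (hfΦ : f ∈ Φ) (hfS : f ∉ S)
    (hf : ¬ Disjoint (G.remainingEdgesOn Φ {f}) (G.remainingEdgesOn Φ S)) :
    3 < (G.remainingEdgesOn Φ {f}).card := by
  by_contra! hle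
  obtain ⟨W, hW, hWmin⟩ := G.exists_isMinContractible (Finset.singleton_subset_iff.2 hfΦ)
    (Finset.singleton_nonempty f) (by simpa using hle)
  obtain rfl : W = {f} := (Finset.subset_singleton_iff.1 hW).resolve_left hWmin.2.1.ne_empty
  refine h.notMem_of_not_disjoint hf hWmin ?_ (Finset.mem_singleton_self f)
  rintro rfl
  exact hfS (Finset.mem_singleton_self f)

open scoped Classical in
lemma two_le_card_of_not_disjoint (h : G.IsIsolatedContractible Φ S) (hG : G.ShareAtMostOneEdge)
    (hfΦ : f ∈ Φ) (hfS : f ∉ S)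
    (hf : ¬ Disjoint (G.remainingEdgesOn Φ {f}) (G.remainingEdgesOn Φ S))
    (hcard : (G.remainingEdgesOn (Φ \ S) {f}).card ≤ 2) : 2 ≤ S.card := by
  by_contra! hlt
  obtain ⟨g, rfl⟩ : ∃ g, S = {g} := Finset.card_eq_one.1 (by
    have := Finset.card_pos.2 h.1.2.1
    omega)
  have lost_le_one :
      (G.remainingEdgesOn Φ {f} \ G.remainingEdgesOn (Φ \ {g}) {f}).card ≤ 1 := by
    have on_both (x) (hx : x ∈ G.remainingEdgesOn Φ {f} \ G.remainingEdgesOn (Φ \ {g}) {f}) :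
        G.bd f x ≠ 0 ∧ G.bd g x ≠ 0 := by
      rw [Finset.mem_sdiff, mem_remainingEdgesOn_sdiff] at hx
      have hxg : x ∈ G.remainingEdgesOn Φ {g} := by tauto
      exact ⟨(mem_remainingEdgesOn_singleton.1 hx.1).2, (mem_remainingEdgesOn_singleton.1 hxg).2⟩
    refine Finset.card_le_one.2 fun x hx y hy => ?_
    exact hG f g (by simpa using hfS) x y (on_both x hx).1 (on_both x hx).2 (on_both y hy).1
      (on_both y hy).2
  have := Finset.le_card_sdiff (G.remainingEdgesOn (Φ \ {g}) {f}) (G.remainingEdgesOn Φ {f})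
  have := h.three_lt_card_of_not_disjoint hfΦ hfS hf
  omega

open scoped Classical in
lemma atMostOneOuterEdge_insert (h : G.IsIsolatedContractible Φ S) (hfΦ : f ∈ Φ) (hfS : f ∉ S)
    (hf : ¬ Disjoint (G.remainingEdgesOn Φ {f}) (G.remainingEdgesOn Φ S))
    (hcard : (G.remainingEdgesOn Φ (insert f S)).card ≤ 3 * S.card + 2) {y : E}
    (hy : y ∈ G.remainingEdgesOn Φ {f}) :
    G.AtMostOneOuterEdge (insert f S) (insert y (G.remainingEdgesOn Φ S)) := by
  have edges_subset : insert y (G.remainingEdgesOn Φ S) ⊆ G.remainingEdgesOn Φ (insert f S) :=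
    Finset.insert_subset (G.remainingEdgesOn_mono Φ (by simp) hy)
      (G.remainingEdgesOn_mono Φ (Finset.subset_insert f S))
  intro g hg x hx x' hx' _ _ houter houter'
  by_contra hxx'
  rcases Finset.mem_insert.1 hg with rfl | hgS
  · have eq_y (x) (hx : x ∈ insert y (G.remainingEdgesOn Φ S))
        (houter : ∀ g' ∈ insert g S, g' ≠ g → G.bd g' x = 0) : x = y := by
      refine (Finset.mem_insert.1 hx).resolve_right fun hxS => ?_
      obtain ⟨-, g', hg', hgx⟩ := mem_remainingEdgesOn.1 hxS
      exact hgx (houter g' (Finset.mem_insert_of_mem hg') fun h => hfS (h ▸ hg'))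
    exact hxx' ((eq_y x hx houter).trans (eq_y x' hx' houter').symm)
  · have hfg : f ≠ g := fun h => hfS (h ▸ hgS)
    have few_erase := card_remainingEdgesOn_erase_add_two_le hxx' (edges_subset hx)
      (edges_subset hx') houter houter'
    obtain ⟨W, hW, hWmin⟩ := G.exists_isMinContractible
      ((Finset.erase_subset g _).trans (Finset.insert_subset hfΦ h.1.1))
      ⟨f, Finset.mem_erase.2 ⟨hfg, Finset.mem_insert_self f S⟩⟩ (by
        rw [Finset.card_erase_of_mem hg, Finset.card_insert_of_notMem hfS]
        omega)
    have hgW : g ∉ W := fun hgW => Finset.notMem_erase g _ (hW hgW)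
    have hfW : f ∉ W := h.notMem_of_not_disjoint hf hWmin fun hWS => hgW (hWS ▸ hgS)
    have hWS : W ⊆ S := fun c hc => (Finset.mem_insert.1
      (Finset.mem_erase.1 (hW hc)).2).resolve_left fun hcf => hfW (hcf ▸ hc)
    exact absurd hWmin.2.2.1 (not_le.2 (h.1.2.2.2 W ⟨hWS, fun h => hgW (h hgS)⟩ hWmin.2.1))

open scoped Classical in
lemma disjoint_of_card_le_two (h : G.IsIsolatedContractible Φ S) (hG : G.ShareAtMostOneEdge)
    (hfΦ : f ∈ Φ) (hfS : f ∉ S) (hcard : (G.remainingEdgesOn (Φ \ S) {f}).card ≤ 2)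
    (hcl : ∀ C, ¬ G.IsClosedIn (Φ \ S) C) (hclf : ∀ C, ¬ G.IsClosedIn ((Φ \ S) \ {f}) C) :
    Disjoint (G.remainingEdgesOn Φ {f}) (G.remainingEdgesOn Φ S) := by
  by_contra hf
  have two_le := h.two_le_card_of_not_disjoint hG hfΦ hfS hf hcard
  have edges_S := h.1.card_remainingEdgesOn hG hcl two_le
  have edges_insert : (G.remainingEdgesOn Φ (insert f S)).card ≤ 3 * S.card + 2 := by
    have subset_union : G.remainingEdgesOn Φ (insert f S) ⊆
        G.remainingEdgesOn Φ S ∪ G.remainingEdgesOn (Φ \ S) {f} := by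
      intro x hx
      obtain ⟨hx, g, hg, hgx⟩ := mem_remainingEdgesOn.1 hx
      rw [Finset.mem_union, mem_remainingEdgesOn_sdiff, mem_remainingEdgesOn_singleton]
      rcases Finset.mem_insert.1 hg with rfl | hg
      · tauto
      · exact Or.inl (mem_remainingEdgesOn.2 ⟨hx, g, hg, hgx⟩)
    have := (Finset.card_le_card subset_union).trans (Finset.card_union_le _ _)
    omega
  obtain ⟨y, hy⟩ := remainingEdgesOn_nonempty
    (Finset.singleton_subset_iff.2 (Finset.mem_sdiff.2 ⟨hfΦ, hfS⟩)) (Finset.singleton_nonempty f)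
    (hcl {f})
  rw [mem_remainingEdgesOn_sdiff] at hy
  have bound := card_add_three_le hG (Finset.insert_subset hfΦ h.1.1)
    (by rw [Finset.card_insert_of_notMem hfS]; omega)
    (by rwa [Finset.sdiff_insert, ← Finset.sdiff_singleton_eq_erase])
    (Finset.insert_subset (G.remainingEdgesOn_mono Φ (by simp) hy.1)
      (G.remainingEdgesOn_mono Φ (Finset.subset_insert f S)))
    (h.atMostOneOuterEdge_insert hfΦ hfS hf edges_insert hy.1)
  rw [Finset.card_insert_of_notMem hy.2, Finset.card_insert_of_notMem hfS] at bound
  omega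

end IsIsolatedContractible

open scoped Classical in
/-- The hypotheses of the theorem on the sequence of contractions along `S 0, …, S (k - 1)`, where
`Φ i` is the set of faces that are left after the first `i` contractions. -/
structure IsContractionSeq (G : PlaneGraph V E F) (k : ℕ) (S Φ : ℕ → Finset F) : Prop where
  zero : Φ 0 = Finset.univ
  succ : ∀ i < k, Φ (i + 1) = Φ i \ S i
  isolated : ∀ i < k, G.IsIsolatedContractible (Φ i) (S i)
  last : ∀ T, T ⊂ Φ k → T.Nonempty → 3 * T.card < (G.remainingEdgesOn (Φ k) T).card

namespace IsContractionSeq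

variable {k : ℕ} {S Φ : ℕ → Finset F}

lemma isClosedIn_singleton (h : G.IsContractionSeq k S Φ) (hG : G.ShareAtMostOneEdge) {i : ℕ}
    (hi : i ≤ k) {C : Finset F} (hC : G.IsClosedIn (Φ i) C) {t : F} (ht : t ∈ C) :
    G.IsClosedIn (Φ i) {t} := by
  classical
  induction hi using Nat.decreasingInduction generalizing C t with
  | self =>
    have card_le_one : C.card ≤ 1 := by
      by_contra! h2
      have card_erase := Finset.card_erase_add_one ht
      have := h.last (C.erase t) ((Finset.erase_ssubset ht).trans_subset hC.1)
        (Finset.card_pos.1 (by omega))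
      have := hC.card_remainingEdgesOn_erase_le hG ht
      omega
    rwa [← Finset.eq_singleton_iff_unique_mem.2
      ⟨ht, fun x hx => Finset.card_le_one.1 card_le_one x hx t ht⟩]
  | of_succ i hi ih =>
    obtain ⟨D, -, htD, hD, hmin⟩ := hC.exists_minimal ht
    suffices D.card ≤ 1 by
      rwa [← Finset.eq_singleton_iff_unique_mem.2
        ⟨htD, fun x hx => Finset.card_le_one.1 this x hx t htD⟩]
    by_contra! h2
    have hS := h.isolated i hi
    rw [h.succ i hi] at ih
    rcases hD.disjoint_or_subset hS.1 with hdisj | hsub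
    · refine hmin {t} (Finset.ssubset_iff_subset_ne.2
        ⟨Finset.singleton_subset_iff.2 htD, ?_⟩) (hD.of_sdiff_of_disjoint hdisj
          (Finset.singleton_subset_iff.2 htD) (ih (hD.sdiff_of_disjoint hdisj) htD))
      rintro rfl
      rw [Finset.card_singleton] at h2
      omega
    · obtain ⟨u, hu, e, he, hue⟩ := hS.exists_remainingEdge_of_subset hG hD hmin h2 hsub
      exact hue ((isClosedIn_singleton_iff.1 (ih (hD.sdiff_sdiff ⟨u, hu⟩) hu)).2 e he)

lemma not_isClosedIn (h : G.IsContractionSeq k S Φ) (hG : G.ShareAtMostOneEdge) {i : ℕ}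
    (hi : i ≤ k) (C : Finset F) : ¬ G.IsClosedIn (Φ i) C := by
  induction i generalizing C with
  | zero =>
    rw [h.zero]
    exact G.not_isClosedIn_univ C
  | succ i ih =>
    intro hC
    obtain ⟨t, ht⟩ := hC.2.1
    have singleton_closed := h.isClosedIn_singleton hG hi hC ht
    rw [h.succ i hi] at singleton_closed
    exact (h.isolated i hi).not_isClosedIn_sdiff_singleton (ih (by omega) {t}) singleton_closed

lemma card_eq_or_singleton (h : G.IsContractionSeq k S Φ) (hG : G.ShareAtMostOneEdge)
    {i : ℕ} (hi : i < k) :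
    (G.remainingEdgesOn (Φ i) (S i)).card = 3 * (S i).card ∨
      (∃ f, S i = {f}) ∧ ((G.remainingEdgesOn (Φ i) (S i)).card = 1 ∨
        (G.remainingEdgesOn (Φ i) (S i)).card = 2) := by
  classical
  have hS := (h.isolated i hi).1
  by_cases h1 : (S i).card = 1
  · have edges_pos := Finset.card_pos.2
      (remainingEdgesOn_nonempty hS.1 hS.2.1 (h.not_isClosedIn hG hi.le (S i)))
    have few := hS.2.2.1
    have singleton := Finset.card_eq_one.1 h1
    by_cases h3 : (G.remainingEdgesOn (Φ i) (S i)).card = 3 * (S i).card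
    · exact Or.inl h3
    · exact Or.inr ⟨singleton, by omega⟩
  · have := Finset.card_pos.2 hS.2.1
    refine Or.inl (hS.card_remainingEdgesOn hG ?_ (by omega))
    rw [← h.succ i hi]
    exact h.not_isClosedIn hG hi

lemma subset_of_le (h : G.IsContractionSeq k S Φ) {i l : ℕ} (hil : i ≤ l) (hl : l ≤ k) :
    Φ l ⊆ Φ i := by
  classical
  induction l, hil using Nat.le_induction with
  | base => exact subset_rfl
  | succ l _ ih =>
    rw [h.succ l hl]
    exact Finset.sdiff_subset.trans (ih (by omega))

lemma remainingEdgesOn_eq_of_card_le_two (h : G.IsContractionSeq k S Φ)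
    (hG : G.ShareAtMostOneEdge) {l : ℕ} (hl : l < k) {f : F} (hS : S l = {f})
    (hcard : (G.remainingEdgesOn (Φ l) {f}).card ≤ 2) {i : ℕ} (hil : i ≤ l) :
    G.remainingEdgesOn (Φ i) {f} = G.remainingEdgesOn (Φ l) {f} := by
  classical
  induction hil using Nat.decreasingInduction with
  | self => rfl
  | of_succ i hil ih =>
    have hi : i < k := by omega
    have hfl : f ∈ Φ l := (h.isolated l hl).1.1 (by simp [hS])
    have hf := h.subset_of_le hil hl.le hfl
    have not_closed := h.not_isClosedIn hG (i := i + 1) hi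
    have not_closed_sdiff := h.not_isClosedIn hG (i := l + 1) hl
    rw [h.succ l hl, hS] at not_closed_sdiff
    replace not_closed_sdiff := not_isClosedIn_sdiff_singleton (h.subset_of_le hil hl.le)
      ih.subset not_closed not_closed_sdiff
    rw [← ih] at hcard ⊢
    rw [h.succ i hi] at hf hcard not_closed not_closed_sdiff ⊢
    rw [Finset.mem_sdiff] at hf
    have disjoint := (h.isolated i hi).disjoint_of_card_le_two hG hf.1 hf.2 hcard not_closed
      not_closed_sdiff
    ext e
    rw [mem_remainingEdgesOn_sdiff]
    exact ⟨fun he => ⟨he, Finset.disjoint_left.1 disjoint he⟩, And.left⟩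

end IsContractionSeq

end PlaneGraph

section Transversal

variable {K V V' ι : Type*} [DivisionRing K] [AddCommGroup V] [Module K V]
  [AddCommGroup V'] [Module K V']

open Module (finrank)

open scoped Classical in
lemma exists_transversal_span_sup_le {t s : Finset ι} (hts : t ⊆ s) {A : ι → Set V} {w w' : ι → V}
    (hw : ∀ i ∈ t, w i ∈ A i) (hw' : ∀ i ∈ s \ t, w' i ∈ A i) :
    ∃ v : ι → V, (∀ i ∈ s, v i ∈ A i) ∧
      Submodule.span K (w '' t) ⊔ Submodule.span K (w' '' (s \ t : Finset ι)) ≤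
        Submodule.span K (v '' s) := by
  refine ⟨t.piecewise w w', fun i hi => ?_, sup_le (Submodule.span_mono ?_)
    (Submodule.span_mono ?_)⟩
  · by_cases hit : i ∈ t
    · simpa [hit] using hw i hit
    · simpa [hit] using hw' i (by simp [hi, hit])
  · rintro _ ⟨i, hi, rfl⟩
    exact ⟨i, hts hi, t.piecewise_eq_of_mem w w' hi⟩
  · rintro _ ⟨i, hi, rfl⟩
    rw [Finset.mem_coe, Finset.mem_sdiff] at hi
    exact ⟨i, hi.1, t.piecewise_eq_of_notMem w w' hi.2⟩

lemma finrank_sup_span_singleton [FiniteDimensional K V] {U : Submodule K V} {x : V} (hx : x ∉ U) :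
    finrank K ↥(U ⊔ Submodule.span K {x}) = finrank K U + 1 := by
  refine le_antisymm ((Submodule.finrank_add_le_finrank_add_finrank _ _).trans
    (Nat.add_le_add_left (finrank_span_singleton (ne_of_mem_of_not_mem U.zero_mem hx).symm).le _))
    (Submodule.finrank_lt_finrank_of_lt (lt_of_le_of_ne le_sup_left fun h => hx ?_))
  rw [h]
  exact (le_sup_right : _ ≤ U ⊔ Submodule.span K {x}) (Submodule.mem_span_singleton_self x)

/-- The condition of Rado's theorem, relative to a subspace `U`: any `n` of the sets `A i` with
`i ∈ s` span at least `n` dimensions modulo `U`. -/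
def RadoCondition (A : ι → Set V) (s : Finset ι) (U : Submodule K V) : Prop :=
  ∀ t ⊆ s, finrank K U + t.card ≤ finrank K ↥(U ⊔ Submodule.span K (⋃ i ∈ t, A i))

namespace RadoCondition

variable {A : ι → Set V} {s t : Finset ι} {U : Submodule K V}

open scoped Classical in
lemma sdiff (h : RadoCondition A s U) (hts : t ⊆ s)
    (ht : finrank K ↥(U ⊔ Submodule.span K (⋃ i ∈ t, A i)) ≤ finrank K U + t.card) :
    RadoCondition A (s \ t) (U ⊔ Submodule.span K (⋃ i ∈ t, A i)) := by
  intro r hr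
  have rank_union := h (t ∪ r) (Finset.union_subset hts (hr.trans Finset.sdiff_subset))
  rw [Finset.card_union_of_disjoint (Finset.disjoint_of_subset_right hr Finset.disjoint_sdiff),
    Finset.set_biUnion_union, Submodule.span_union, ← sup_assoc] at rank_union
  omega

lemma sup_span_singleton [FiniteDimensional K V] {x : V} (hx : x ∉ U)
    (h : ∀ t ⊆ s, t.Nonempty →
      finrank K U + t.card < finrank K ↥(U ⊔ Submodule.span K (⋃ i ∈ t, A i))) :
    RadoCondition A s (U ⊔ Submodule.span K {x}) := by
  intro r hr
  rcases r.eq_empty_or_nonempty with rfl | hne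
  · exact Submodule.finrank_mono le_sup_left
  · have := h r hr hne
    have : finrank K ↥(U ⊔ Submodule.span K (⋃ i ∈ r, A i)) ≤
        finrank K ↥(U ⊔ Submodule.span K {x} ⊔ Submodule.span K (⋃ i ∈ r, A i)) :=
      Submodule.finrank_mono (sup_le_sup_right le_sup_left _)
    rw [finrank_sup_span_singleton hx]
    omega

lemma exists_mem_notMem (h : RadoCondition A s U) {i : ι} (hi : i ∈ s) : ∃ x ∈ A i, x ∉ U := by
  by_contra! hAU
  have := h {i} (by simpa using hi)
  rw [Finset.set_biUnion_singleton, sup_eq_left.2 (Submodule.span_le.2 hAU),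
    Finset.card_singleton] at this
  omega

end RadoCondition

/-- **Rado's theorem** for subsets of a vector space, relative to a subspace. -/
theorem RadoCondition.exists_transversal [FiniteDimensional K V] {A : ι → Set V} {s : Finset ι}
    {U : Submodule K V} (h : RadoCondition A s U) :
    ∃ w : ι → V, (∀ i ∈ s, w i ∈ A i) ∧
      finrank K U + s.card ≤ finrank K ↥(U ⊔ Submodule.span K (w '' s)) := by
  classical
  induction s using Finset.strongInduction generalizing U with
  | H s ih =>
    rcases s.eq_empty_or_nonempty with rfl | ⟨i, hi⟩
    · exact ⟨fun _ => 0, by simp, Submodule.finrank_mono le_sup_left⟩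
    suffices ∃ t ⊆ s, t.Nonempty ∧ ∃ w : ι → V, (∀ i ∈ t, w i ∈ A i) ∧
        finrank K U + t.card ≤ finrank K ↥(U ⊔ Submodule.span K (w '' t)) ∧
        RadoCondition A (s \ t) (U ⊔ Submodule.span K (w '' t)) by
      obtain ⟨t, hts, htne, w, hw, rank_w, hr⟩ := this
      obtain ⟨w', hw', rank_w'⟩ := ih (s \ t) (Finset.sdiff_ssubset hts htne) hr
      obtain ⟨v, hv, span_le⟩ := exists_transversal_span_sup_le (K := K) hts hw hw'
      have rank_v := Submodule.finrank_mono (sup_le_sup_left span_le U)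
      rw [← sup_assoc] at rank_v
      have := Finset.card_sdiff_add_card_eq_card hts
      exact ⟨v, hv, by omega⟩
    by_cases tight : ∃ t, t ⊂ s ∧ t.Nonempty ∧
        finrank K ↥(U ⊔ Submodule.span K (⋃ i ∈ t, A i)) ≤ finrank K U + t.card
    · obtain ⟨t, hts, htne, ht⟩ := tight
      obtain ⟨w, hw, rank_w⟩ := ih t hts fun r hr => h r (hr.trans hts.subset)
      have span_w : U ⊔ Submodule.span K (w '' t) = U ⊔ Submodule.span K (⋃ i ∈ t, A i) := by
        refine Submodule.eq_of_le_of_finrank_le (sup_le_sup_left (Submodule.span_mono ?_) U)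
          (ht.trans rank_w)
        rintro _ ⟨j, hj, rfl⟩
        exact Set.mem_biUnion hj (hw j hj)
      exact ⟨t, hts.subset, htne, w, hw, rank_w, span_w ▸ h.sdiff hts.subset ht⟩
    · push Not at tight
      obtain ⟨x, hx, hxU⟩ := h.exists_mem_notMem hi
      have his := Finset.singleton_subset_iff.2 hi
      refine ⟨{i}, his, Finset.singleton_nonempty i, fun _ => x, by simpa using hx, ?_⟩
      rw [Finset.coe_singleton, Set.image_singleton, finrank_sup_span_singleton hxU,
        Finset.card_singleton]
      exact ⟨le_rfl, .sup_span_singleton hxU fun t ht => tight t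
        (ht.trans_ssubset (Finset.sdiff_ssubset his (Finset.singleton_nonempty i)))⟩

lemma finrank_submodule_prod (p : Submodule K V) (q : Submodule K V') [FiniteDimensional K p]
    [FiniteDimensional K q] : finrank K (p.prod q) = finrank K p + finrank K q := by
  have range_eq : LinearMap.range (p.subtype.prodMap q.subtype) = p.prod q := by
    rw [LinearMap.range_prodMap, Submodule.range_subtype, Submodule.range_subtype]
  rw [← range_eq, LinearMap.finrank_range_of_inj
    (p.injective_subtype.prodMap q.injective_subtype), Module.finrank_prod]

lemma span_prod_top_le_span_prod_univ {A : Set V} (hA : A.Nonempty) :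
    (Submodule.span K A).prod (⊤ : Submodule K V') ≤
      Submodule.span K (A ×ˢ (Set.univ : Set V')) := by
  obtain ⟨a, ha⟩ := hA
  have mem_span {x : V} (hx : x ∈ A) (u : V') :
      (x, u) ∈ Submodule.span K (A ×ˢ (Set.univ : Set V')) :=
    Submodule.subset_span ⟨hx, trivial⟩
  rw [LinearMap.prod_eq_sup_map, Submodule.map_span, sup_le_iff, Submodule.span_le]
  refine ⟨?_, ?_⟩
  · rintro _ ⟨x, hx, rfl⟩
    exact mem_span hx 0
  · rintro _ ⟨u, -, rfl⟩
    simpa using sub_mem (mem_span ha u) (mem_span ha 0)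

/-- The form of Rado's theorem with deficiency `d`: it follows by adding `d` dimensions. -/
theorem exists_transversal_card_le_finrank_add [FiniteDimensional K V] (A : ι → Set V)
    (s : Finset ι) (d : ℕ) (hne : ∀ i ∈ s, (A i).Nonempty)
    (hA : ∀ t ⊆ s, t.card ≤ finrank K (Submodule.span K (⋃ i ∈ t, A i)) + d) :
    ∃ w : ι → V, (∀ i ∈ s, w i ∈ A i) ∧ s.card ≤ finrank K (Submodule.span K (w '' s)) + d := by
  have rado : RadoCondition (K := K) (fun i => A i ×ˢ (Set.univ : Set (Fin d → K))) s ⊥ := by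
    intro t ht
    rw [bot_sup_eq, finrank_bot, zero_add, ← Set.iUnion₂_prod_const]
    rcases t.eq_empty_or_nonempty with rfl | ⟨i, hi⟩
    · simp
    have nonempty : (⋃ i ∈ t, A i).Nonempty :=
      (hne i (ht hi)).mono (Set.subset_biUnion_of_mem (Finset.mem_coe.2 hi))
    have rank_le := Submodule.finrank_mono
      (span_prod_top_le_span_prod_univ (K := K) (V' := Fin d → K) nonempty)
    rw [finrank_submodule_prod, finrank_top, Module.finrank_fin_fun] at rank_le
    exact (hA t ht).trans rank_le
  obtain ⟨w, hw, rank_w⟩ := rado.exists_transversal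
  refine ⟨fun i => (w i).1, fun i hi => (hw i hi).1, ?_⟩
  have span_le : Submodule.span K (w '' s) ≤
      (Submodule.span K ((fun i => (w i).1) '' s)).prod ⊤ := by
    rw [Submodule.span_le]
    rintro _ ⟨i, hi, rfl⟩
    exact ⟨Submodule.subset_span ⟨i, hi, rfl⟩, trivial⟩
  have rank_le := Submodule.finrank_mono span_le
  rw [finrank_submodule_prod, finrank_top, Module.finrank_fin_fun] at rank_le
  rw [bot_sup_eq, finrank_bot, zero_add] at rank_w
  exact rank_w.trans rank_le

end Transversal

lemma eq_zero_of_forall_sum_mul_pow_eq_zero {R : Type*} [CommRing R] [IsDomain R] [Infinite R]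
    {n : ℕ} {v : Fin n → R} (h : ∀ b, ∑ t, v t * b ^ (t : ℕ) = 0) : v = 0 :=
  Matrix.eq_zero_of_forall_index_sum_mul_pow_eq_zero
    ((Infinite.natEmbedding R).injective.comp Fin.val_injective) fun _ => h _

lemma card_le_finrank_span_add {K ι W : Type*} [Field K] [Fintype ι] [AddCommGroup W] [Module K W]
    [FiniteDimensional K W] {A : Set (ι → K)} (ev : (ι → K) →ₗ[K] W)
    (h : ∀ c, (∀ x ∈ A, c ⬝ᵥ x = 0) → ev c = 0 → c = 0) :
    Fintype.card ι ≤ Module.finrank K (Submodule.span K A) + Module.finrank K W := by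
  classical
  have injective : Function.Injective (ev ∘ₗ (dotProductEquiv K ι).symm.toLinearMap ∘ₗ
      (Submodule.span K A).dualAnnihilator.subtype) := by
    rw [injective_iff_map_eq_zero]
    rintro ⟨φ, hφ⟩ hev
    obtain ⟨c, rfl⟩ := (dotProductEquiv K ι).surjective φ
    rw [Submodule.mem_dualAnnihilator] at hφ
    have hc := h c (fun x hx => hφ x (Submodule.subset_span hx)) (by simpa using hev)
    exact Subtype.ext (by simp [hc])
  have := LinearMap.finrank_le_finrank_of_injective injective
  have := Subspace.finrank_add_finrank_dualAnnihilator_eq (Submodule.span K A)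
  simp only [Module.finrank_fintype_fun_eq_card] at *
  omega

namespace PlaneGraph

section RowPotential

variable {F K : Type*} [Field K] {Φ : Finset F}

open scoped Classical in
/-- The entries of a vector in the rows of exponent `t`, extended by zero to all faces. -/
noncomputable def rowPotential (Φ : Finset F) (t : Fin 3) (o : Option F) :
    (Φ × Fin 3 → K) →ₗ[K] K :=
  o.elim 0 fun f => if hf : f ∈ Φ then LinearMap.proj (⟨f, hf⟩, t) else 0

lemma rowPotential_coe (c : Φ × Fin 3 → K) (f : Φ) (t : Fin 3) :
    rowPotential Φ t (some f.1) c = c (f, t) := by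
  simp [rowPotential]

lemma rowPotential_of_notMem {f : F} (hf : f ∉ Φ) (c : Φ × Fin 3 → K) (t : Fin 3) :
    rowPotential Φ t (some f) c = 0 := by
  simp [rowPotential, hf]

end RowPotential

section GenericRank

variable {V E F : Type*} [Fintype V] [Fintype E] [Fintype F] {G : PlaneGraph V E F}
  {Φ : Finset F} {X Y : Finset E}

/-- The faces of `G`, where `none` stands for the unbounded face, up to crossing edges in `X`; all
faces outside `Φ` are identified with the unbounded one. -/
def faceSetoid (G : PlaneGraph V E F) (Φ : Finset F) (X : Finset E) : Setoid (Option F) :=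
  Relation.EqvGen.setoid fun o o' =>
    (∃ e ∈ X, o = G.side (e, true) ∧ o' = G.side (e, false)) ∨ ∃ f ∉ Φ, o = none ∧ o' = some f

lemma faceSetoid_side {e : E} (he : e ∈ X) :
    G.faceSetoid Φ X (G.side (e, true)) (G.side (e, false)) :=
  Relation.EqvGen.rel _ _ (Or.inl ⟨e, he, rfl, rfl⟩)

lemma faceSetoid_none_some {f : F} (hf : f ∉ Φ) : G.faceSetoid Φ X none (some f) :=
  Relation.EqvGen.rel _ _ (Or.inr ⟨f, hf, rfl, rfl⟩)

lemma exists_mem_of_faceSetoid {e : E} (he : e ∈ X) {f : F} (hfe : G.bd f e ≠ 0) :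
    ∃ o, G.faceSetoid Φ X (some f) o ∧ o ≠ some f ∧ ∀ g, o = some g → G.bd g e ≠ 0 := by
  have crossing := faceSetoid_side (G := G) (Φ := Φ) he
  simp only [bd_ne_zero_iff] at hfe ⊢
  rcases hfe with ⟨htrue, hfalse⟩ | ⟨hfalse, htrue⟩
  · exact ⟨_, htrue ▸ crossing, hfalse, fun g hg => Or.inr ⟨hg, by grind⟩⟩
  · exact ⟨_, (G.faceSetoid Φ X).symm (hfalse ▸ crossing), htrue, fun g hg => Or.inl ⟨hg, by grind⟩⟩

/-- The classes of faces that do not contain the unbounded face. -/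
abbrev BoundedClass (G : PlaneGraph V E F) (Φ : Finset F) (X : Finset E) : Type _ :=
  {q : Quotient (G.faceSetoid Φ X) // q ≠ Quotient.mk (G.faceSetoid Φ X) none}

open scoped Classical in
/-- The faces in a class of faces. -/
noncomputable def classFaces (q : Quotient (G.faceSetoid Φ X)) : Finset F :=
  Finset.univ.filter fun f => Quotient.mk (G.faceSetoid Φ X) (some f) = q

open scoped Classical in
/-- The faces that are not identified with the unbounded face. -/
noncomputable def boundedClassFaces (G : PlaneGraph V E F) (Φ : Finset F) (X : Finset E) :
    Finset F :=
  Finset.univ.filter fun f =>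
    Quotient.mk (G.faceSetoid Φ X) (some f) ≠ Quotient.mk (G.faceSetoid Φ X) none

lemma mem_boundedClassFaces {f : F} : f ∈ G.boundedClassFaces Φ X ↔
    Quotient.mk (G.faceSetoid Φ X) (some f) ≠ Quotient.mk (G.faceSetoid Φ X) none := by
  classical
  exact Finset.mem_filter_univ f

lemma boundedClassFaces_subset : G.boundedClassFaces Φ X ⊆ Φ := by
  intro f hf
  by_contra hfΦ
  exact mem_boundedClassFaces.1 hf
    (Quotient.sound ((G.faceSetoid Φ X).symm (faceSetoid_none_some hfΦ)))

open scoped Classical in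
lemma sum_card_classFaces (G : PlaneGraph V E F) (Φ : Finset F) (X : Finset E) :
    ∑ q : G.BoundedClass Φ X, (classFaces q.1).card = (G.boundedClassFaces Φ X).card := by
  rw [← Finset.card_biUnion fun q _ q' _ hqq' => Finset.disjoint_left.2 fun f hf hf' =>
    hqq' (Subtype.ext ((Finset.mem_filter.1 hf).2.symm.trans (Finset.mem_filter.1 hf').2))]
  congr 1
  ext f
  simp [classFaces, boundedClassFaces]

open scoped Classical in
lemma card_filter_add_three_mul_card_boundedClass_le (hG : G.ShareAtMostOneEdge) (Φ : Finset F)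
    (X : Finset E) :
    (X.filter fun e => ∃ f ∈ G.boundedClassFaces Φ X, G.bd f e ≠ 0).card +
      3 * Fintype.card (G.BoundedClass Φ X) ≤ 3 * (G.boundedClassFaces Φ X).card := by
  have subset_biUnion : (X.filter fun e => ∃ f ∈ G.boundedClassFaces Φ X, G.bd f e ≠ 0) ⊆
      (Finset.univ : Finset (G.BoundedClass Φ X)).biUnion
        fun q => G.sharedEdges (classFaces q.1) := by
    intro e he
    obtain ⟨heX, f, hf, hfe⟩ := Finset.mem_filter.1 he
    rw [mem_boundedClassFaces] at hf
    obtain ⟨o, ho, hof, hoe⟩ := exists_mem_of_faceSetoid (Φ := Φ) heX hfe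
    cases o with
    | none => exact absurd (Quotient.sound ho) hf
    | some g =>
      exact Finset.mem_biUnion.2 ⟨⟨_, hf⟩, Finset.mem_univ _, mem_sharedEdges.2
        ⟨f, by simp [classFaces], g,
          by simpa [classFaces] using Quotient.sound ((G.faceSetoid Φ X).symm ho),
          fun h => hof (h ▸ rfl), hfe, hoe g rfl⟩⟩
  have nonempty (q : G.BoundedClass Φ X) : (classFaces q.1).Nonempty := by
    obtain ⟨⟨o⟩, hq⟩ := q
    cases o with
    | none => exact absurd rfl hq
    | some f => exact ⟨f, by simp [classFaces]; rfl⟩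
  calc _ ≤ ∑ q : G.BoundedClass Φ X, (G.sharedEdges (classFaces q.1)).card +
        ∑ q : G.BoundedClass Φ X, 3 :=
        Nat.add_le_add ((Finset.card_le_card subset_biUnion).trans Finset.card_biUnion_le)
          (by simp [mul_comm])
    _ = ∑ q : G.BoundedClass Φ X, ((G.sharedEdges (classFaces q.1)).card + 3) :=
        Finset.sum_add_distrib.symm
    _ ≤ ∑ q : G.BoundedClass Φ X, 3 * (classFaces q.1).card :=
        Finset.sum_le_sum fun q _ => card_sharedEdges_add_three_le hG (nonempty q)
    _ = 3 * (G.boundedClassFaces Φ X).card := by rw [← Finset.mul_sum, sum_card_classFaces]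

open scoped Classical in
lemma card_add_three_mul_card_boundedClass_le (hG : G.ShareAtMostOneEdge)
    (touch : ∀ e ∈ Y, ∃ f ∈ Φ, G.bd f e ≠ 0)
    (many : ∀ T, T ⊂ Φ → T.Nonempty →
      3 * T.card < (Y.filter fun e => ∃ f ∈ T, G.bd f e ≠ 0).card) (hXY : X ⊆ Y) :
    X.card + 3 * Fintype.card (G.BoundedClass Φ X) ≤ 3 * Φ.card + (Y.card - 3 * Φ.card) := by
  have on_T := card_filter_add_three_mul_card_boundedClass_le hG Φ X
  have hTΦ : G.boundedClassFaces Φ X ⊆ Φ := boundedClassFaces_subset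
  generalize G.boundedClassFaces Φ X = T at on_T hTΦ
  have off_T := Finset.card_le_card
    (Finset.filter_subset_filter (fun e => ¬ ∃ f ∈ T, G.bd f e ≠ 0) hXY)
  have split_X := Finset.card_filter_add_card_filter_not (s := X) fun e => ∃ f ∈ T, G.bd f e ≠ 0
  have split_Y := Finset.card_filter_add_card_filter_not (s := Y) fun e => ∃ f ∈ T, G.bd f e ≠ 0
  have card_X := Finset.card_le_card hXY
  rcases T.eq_empty_or_nonempty with rfl | hT
  · rw [Finset.card_empty] at on_T
    omega
  · rcases hTΦ.eq_or_ssubset with rfl | hTΦ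
    · rw [Finset.filter_true_of_mem touch] at split_Y
      omega
    · have := many T hTΦ hT
      omega

end GenericRank

section LabelMatrix

variable {V E F K : Type*} [Fintype V] [Fintype E] [Fintype F] [Field K] {G : PlaneGraph V E F}
  {Φ : Finset F} {X Y : Finset E}

/-- The column of the edge `e` with label `b` in the extended cycle basis matrix with the rows of
the faces in `Φ`. -/
noncomputable def labelColumn (G : PlaneGraph V E F) (Φ : Finset F) (e : E) (b : K) :
    Φ × Fin 3 → K :=
  fun r => (G.bd r.1 e : K) * b ^ (r.2 : ℕ)

/-- The extended cycle basis matrix with the rows of the faces in `Φ` and the columns of the edges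
in `X`. -/
noncomputable def labelMatrix (G : PlaneGraph V E F) (a : E → K) (Φ : Finset F) (X : Finset E) :
    Matrix (Φ × Fin 3) X K :=
  fun r e => (G.bd r.1 e : K) * a e ^ (r.2 : ℕ)

lemma dotProduct_labelColumn (G : PlaneGraph V E F) (c : Φ × Fin 3 → K) (e : E) (b : K) :
    c ⬝ᵥ G.labelColumn Φ e b = ∑ t : Fin 3,
      (rowPotential Φ t (G.side (e, true)) c - rowPotential Φ t (G.side (e, false)) c) *
        b ^ (t : ℕ) := by
  have elim_eq (t : Fin 3) (o : Option F) :
      (o.elim 0 fun f => rowPotential Φ t (some f) c) = rowPotential Φ t o c := by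
    cases o <;> rfl
  have sum_univ (t : Fin 3) : ∑ f, rowPotential Φ t (some f) c * (G.bd f e : K) =
      ∑ f : Φ, c (f, t) * (G.bd f e : K) := by
    rw [← Finset.sum_subset Φ.subset_univ fun f _ hf => by
      rw [rowPotential_of_notMem hf, zero_mul], ← Finset.sum_coe_sort]
    simp only [rowPotential_coe]
  simp only [dotProduct, Fintype.sum_prod_type_right]
  refine Finset.sum_congr rfl fun t _ => ?_
  rw [← elim_eq, ← elim_eq, ← sum_mul_bd, sum_univ, Finset.sum_mul]
  exact Finset.sum_congr rfl fun f _ => (mul_assoc _ _ _).symm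

lemma rowPotential_eq_of_faceSetoid [Infinite K] {c : Φ × Fin 3 → K}
    (hc : ∀ e ∈ X, ∀ b, c ⬝ᵥ G.labelColumn Φ e b = 0) {o o' : Option F}
    (ho : G.faceSetoid Φ X o o') (t : Fin 3) : rowPotential Φ t o c = rowPotential Φ t o' c := by
  induction ho with
  | rel o o' h =>
    obtain ⟨e, he, rfl, rfl⟩ | ⟨f, hf, rfl, rfl⟩ := h
    · refine sub_eq_zero.1 (congrFun (eq_zero_of_forall_sum_mul_pow_eq_zero
        (v := fun t => rowPotential Φ t (G.side (e, true)) c -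
          rowPotential Φ t (G.side (e, false)) c) fun b => ?_) t)
      rw [← dotProduct_labelColumn, hc e he]
    · rw [rowPotential_of_notMem hf]
      rfl
  | refl => rfl
  | symm _ _ _ ih => exact ih.symm
  | trans _ _ _ _ _ ih ih' => exact ih.trans ih'

open scoped Classical in
lemma three_mul_card_le_finrank_span_labelColumn_add [Infinite K] (G : PlaneGraph V E F)
    (Φ : Finset F) (X : Finset E) :
    3 * Φ.card ≤ Module.finrank K
      (Submodule.span K (⋃ e ∈ X, Set.range (G.labelColumn (K := K) Φ e))) +
        3 * Fintype.card (G.BoundedClass Φ X) := by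
  let ev : (Φ × Fin 3 → K) →ₗ[K] (G.BoundedClass Φ X × Fin 3 → K) :=
    LinearMap.pi fun p => rowPotential Φ p.2 p.1.1.out
  have := card_le_finrank_span_add
    (A := ⋃ e ∈ X, Set.range (G.labelColumn (K := K) Φ e)) ev fun c hc hev => by
    have on_X : ∀ e ∈ X, ∀ b, c ⬝ᵥ G.labelColumn Φ e b = 0 := fun e he b =>
      hc _ (Set.mem_biUnion he ⟨b, rfl⟩)
    ext ⟨f, t⟩
    rw [← rowPotential_coe c]
    by_cases hf : Quotient.mk (G.faceSetoid Φ X) (some f.1) = Quotient.mk (G.faceSetoid Φ X) none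
    · rw [rowPotential_eq_of_faceSetoid on_X (Quotient.exact hf)]
      rfl
    · rw [rowPotential_eq_of_faceSetoid on_X ((G.faceSetoid Φ X).symm (Quotient.mk_out (some f.1)))]
      exact congrFun hev (⟨_, hf⟩, t)
  simpa [mul_comm] using this

lemma exists_rank_labelMatrix_ge (K : Type*) [Field K] [Infinite K] (hG : G.ShareAtMostOneEdge)
    (touch : ∀ e ∈ Y, ∃ f ∈ Φ, G.bd f e ≠ 0)
    (many : ∀ T, T ⊂ Φ → T.Nonempty →
      3 * T.card < (Y.filter fun e => ∃ f ∈ T, G.bd f e ≠ 0).card) :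
    ∃ b : E → K, min Y.card (3 * Φ.card) ≤ (G.labelMatrix b Φ Y).rank := by
  classical
  obtain ⟨w, hw, card_le⟩ := exists_transversal_card_le_finrank_add (K := K)
    (fun e => Set.range (G.labelColumn (K := K) Φ e)) Y (Y.card - 3 * Φ.card)
    (fun _ _ => Set.range_nonempty _) fun X hX => by
      have := card_add_three_mul_card_boundedClass_le hG touch (by convert many) hX
      have := three_mul_card_le_finrank_span_labelColumn_add (K := K) G Φ X
      omega
  choose! b hb using hw
  refine ⟨b, ?_⟩
  have cols : w '' Y = Set.range (G.labelMatrix b Φ Y).col := by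
    ext x
    constructor
    · rintro ⟨e, he, rfl⟩
      exact ⟨⟨e, he⟩, hb e he⟩
    · rintro ⟨e, rfl⟩
      exact ⟨e, e.2, (hb e e.2).symm⟩
  rw [Matrix.rank_eq_finrank_span_cols, ← cols]
  omega

end LabelMatrix

end PlaneGraph

section MatrixRank

variable {K m n : Type*} [Field K] [Fintype n]

lemma rank_mul_add_rank_mul_le_of_mul_eq_zero {l o : Type*} [Fintype m] [Fintype o]
    (D : Matrix l m K) (N : Matrix m n K) (D' : Matrix n o K) (h : D * N * D' = 0) :
    (D * N).rank + (N * D').rank ≤ N.rank := by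
  let π := D.mulVecLin.domRestrict (LinearMap.range N.mulVecLin)
  have range_π : LinearMap.range π = LinearMap.range (D * N).mulVecLin := by
    rw [Matrix.mulVecLin_mul, LinearMap.range_comp, LinearMap.range_domRestrict]
  have le_map_ker_π : LinearMap.range (N * D').mulVecLin ≤
      (LinearMap.ker π).map (LinearMap.range N.mulVecLin).subtype := by
    rintro _ ⟨x, rfl⟩
    refine ⟨⟨(N * D').mulVecLin x, ⟨D'.mulVecLin x, by simp⟩⟩, ?_, rfl⟩
    change D.mulVecLin ((N * D').mulVecLin x) = 0
    simp [Matrix.mulVec_mulVec, ← Matrix.mul_assoc, h]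
  have := (Submodule.finrank_mono le_map_ker_π).trans (Submodule.finrank_map_le _ _)
  have := LinearMap.finrank_range_add_finrank_ker π
  rw [range_π] at this
  unfold Matrix.rank
  omega

lemma matrix_rank_add_le [Finite m] (A B : Matrix m n K) : (A + B).rank ≤ A.rank + B.rank := by
  have range_le : LinearMap.range (A + B).mulVecLin ≤
      LinearMap.range A.mulVecLin ⊔ LinearMap.range B.mulVecLin := by
    rw [Matrix.mulVecLin_add]
    rintro _ ⟨x, rfl⟩
    exact Submodule.add_mem_sup ⟨x, rfl⟩ ⟨x, rfl⟩
  exact (Submodule.finrank_mono range_le).trans (Submodule.finrank_add_le_finrank_add_finrank _ _)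

lemma rank_submatrix_id_of_col_eq_zero {n₀ : Type*} [Fintype n₀] (N : Matrix m n K) (g : n₀ → n)
    (h : ∀ j ∉ Set.range g, N.col j = 0) : (N.submatrix id g).rank = N.rank := by
  have span_eq : Submodule.span K (Set.range (N.submatrix id g).col) =
      Submodule.span K (Set.range N.col) := by
    refine le_antisymm (Submodule.span_mono ?_) (Submodule.span_le.2 ?_)
    · rintro _ ⟨j, rfl⟩
      exact ⟨g j, rfl⟩
    · rintro _ ⟨j, rfl⟩
      by_cases hj : j ∈ Set.range g
      · obtain ⟨j, rfl⟩ := hj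
        exact Submodule.subset_span ⟨j, rfl⟩
      · simp [h j hj]
  rw [Matrix.rank_eq_finrank_span_cols, Matrix.rank_eq_finrank_span_cols, span_eq]

lemma rank_submatrix_of_eq_zero {m₀ n₀ : Type*} [Finite m] [Finite m₀] [Fintype n₀]
    (N : Matrix m n K) (f : m₀ → m) (g : n₀ → n) (hf : ∀ i ∉ Set.range f, N.row i = 0)
    (hg : ∀ j ∉ Set.range g, N.col j = 0) : (N.submatrix f g).rank = N.rank := by
  have := Fintype.ofFinite m
  have := Fintype.ofFinite m₀
  rw [← rank_submatrix_id_of_col_eq_zero N g hg, ← Matrix.rank_transpose (N.submatrix id g),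
    ← rank_submatrix_id_of_col_eq_zero (N.submatrix id g).transpose f fun i hi => ?_,
    ← Matrix.rank_transpose]
  · rfl
  · ext j
    exact congrFun (hf i hi) (g j)

lemma exists_linearIndependent_cols (N : Matrix m n K) :
    ∃ c : Fin N.rank → n, LinearIndependent K fun i => N.col (c i) := by
  obtain ⟨κ, c, c_injective, span_eq, independent⟩ := exists_linearIndependent' K N.col
  have : Fintype κ := Fintype.ofInjective c c_injective
  have card_κ : Fintype.card κ = N.rank := by
    rw [Matrix.rank_eq_finrank_span_cols, ← span_eq, finrank_span_eq_card independent]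
  let e : Fin N.rank ≃ κ := (Fintype.equivFinOfCardEq card_κ).symm
  exact ⟨c ∘ e, independent.comp e e.injective⟩

variable {σ : Type*}

/-- The polynomial is a maximal minor after multiplication by a left inverse of the independent
columns at `b`. -/
lemma exists_eval_ne_zero_imp_rank_le [Finite m] (N : Matrix m n (MvPolynomial σ K))
    (b : σ → K) : ∃ p : MvPolynomial σ K, MvPolynomial.eval b p ≠ 0 ∧
      ∀ a, MvPolynomial.eval a p ≠ 0 →
        (N.map (MvPolynomial.eval b)).rank ≤ (N.map (MvPolynomial.eval a)).rank := by
  classical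
  have := Fintype.ofFinite m
  obtain ⟨c, independent⟩ := exists_linearIndependent_cols (N.map (MvPolynomial.eval b))
  let L := N.submatrix id c
  obtain ⟨P, hP⟩ : ∃ P : Matrix _ m K, P * L.map (MvPolynomial.eval b) = 1 := by
    obtain ⟨g, hg⟩ := LinearMap.exists_leftInverse_of_injective
      (Matrix.toLin' (L.map (MvPolynomial.eval b)))
      (LinearMap.ker_eq_bot.2 (Matrix.mulVec_injective_iff.2 independent))
    refine ⟨LinearMap.toMatrix' g, Matrix.toLin'.injective ?_⟩
    rw [Matrix.toLin'_mul, Matrix.toLin'_toMatrix', Matrix.toLin'_one, hg]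
  let Q : Matrix _ m (MvPolynomial σ K) := P.map MvPolynomial.C
  have eval_det (a : σ → K) : MvPolynomial.eval a (Q * L).det =
      (P * L.map (MvPolynomial.eval a)).det := by
    rw [RingHom.map_det, RingHom.mapMatrix_apply, Matrix.map_mul, Matrix.map_map]
    congr 2
    ext i j
    simp
  refine ⟨(Q * L).det, ?_, fun a ha => ?_⟩
  · simp [eval_det, hP]
  · rw [eval_det] at ha
    calc (N.map (MvPolynomial.eval b)).rank
        = (P * L.map (MvPolynomial.eval a)).rank := by
          rw [Matrix.rank_of_det_ne_zero ha, Fintype.card_fin]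
      _ ≤ (L.map (MvPolynomial.eval a)).rank := Matrix.rank_mul_le_right _ _
      _ ≤ (N.map (MvPolynomial.eval a)).rank :=
          Matrix.rank_submatrix_le (N.map (MvPolynomial.eval a)) id c

lemma isAlgebraicVariety_rank_lt [Finite m] (N : Matrix m n (MvPolynomial σ K)) (r : ℕ) :
    IsAlgebraicVariety {a : σ → K | (N.map (MvPolynomial.eval a)).rank < r} := by
  refine ⟨{p | ∀ a, (N.map (MvPolynomial.eval a)).rank < r → MvPolynomial.eval a p = 0},
    Set.Subset.antisymm (fun a ha => Set.mem_iInter₂.2 fun p hp => hp a ha) fun b hb => ?_⟩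
  by_contra hr
  obtain ⟨p, hp, rank_le⟩ := exists_eval_ne_zero_imp_rank_le N b
  refine hp (Set.mem_iInter₂.1 hb p fun a ha => ?_)
  by_contra hpa
  exact hr ((rank_le a hpa).trans_lt ha)

end MatrixRank

namespace PlaneGraph

section LabelRank

variable {V E F K : Type*} [Fintype V] [Fintype E] [Fintype F] [Field K]

open scoped Classical in
/-- The extended cycle basis matrix in which all entries outside the rows of `Φ` and the columns of
`Y` are replaced by zero, so that the matrices for different `Φ` and `Y` can be added. -/
noncomputable def maskedMatrix (G : PlaneGraph V E F) (a : E → K) (Φ : Finset F) (Y : Finset E) :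
    Matrix (F × Fin 3) E K :=
  Matrix.of fun r e => if r.1 ∈ Φ ∧ e ∈ Y then (G.bd r.1 e : K) * a e ^ (r.2 : ℕ) else 0

lemma rank_maskedMatrix (G : PlaneGraph V E F) (a : E → K) (Φ : Finset F) (Y : Finset E) :
    (G.maskedMatrix a Φ Y).rank = (G.labelMatrix a Φ Y).rank := by
  rw [← rank_submatrix_of_eq_zero (G.maskedMatrix a Φ Y)
    (fun r : Φ × Fin 3 => (r.1.1, r.2)) (Subtype.val : Y → E)]
  · congr 1
    ext r e
    simp [maskedMatrix, labelMatrix]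
  · rintro ⟨f, t⟩ hf
    have : f ∉ Φ := fun h => hf ⟨(⟨f, h⟩, t), rfl⟩
    ext e
    simp [maskedMatrix, this]
  · intro e he
    have : e ∉ Y := by simpa using he
    ext r
    simp [maskedMatrix, this]

lemma rank_labelMatrix_le_three_mul_card (G : PlaneGraph V E F) (a : E → K) (Φ : Finset F)
    (Y : Finset E) : (G.labelMatrix a Φ Y).rank ≤ 3 * Φ.card := by
  simpa [mul_comm] using (G.labelMatrix a Φ Y).rank_le_card_height

lemma rank_labelMatrix_le_card (G : PlaneGraph V E F) (a : E → K) (Φ : Finset F) (Y : Finset E) :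
    (G.labelMatrix a Φ Y).rank ≤ Y.card := by
  simpa using (G.labelMatrix a Φ Y).rank_le_card_width

open scoped Classical in
lemma rank_labelMatrix_union_faces_le (G : PlaneGraph V E F) (a : E → K) {Φ Ψ : Finset F}
    (h : Disjoint Φ Ψ) (Y : Finset E) :
    (G.labelMatrix a (Φ ∪ Ψ) Y).rank ≤
      (G.labelMatrix a Φ Y).rank + (G.labelMatrix a Ψ Y).rank := by
  have eq_add : G.maskedMatrix a (Φ ∪ Ψ) Y = G.maskedMatrix a Φ Y + G.maskedMatrix a Ψ Y := by
    ext r e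
    have := fun hr : r.1 ∈ Φ => Finset.disjoint_left.1 h hr
    simp only [maskedMatrix, Matrix.add_apply, Matrix.of_apply, Finset.mem_union]
    grind
  simpa only [← rank_maskedMatrix, eq_add] using matrix_rank_add_le _ _

open scoped Classical in
lemma rank_labelMatrix_union_edges_le (G : PlaneGraph V E F) (a : E → K) (Φ : Finset F)
    {Y Z : Finset E} (h : Disjoint Y Z) :
    (G.labelMatrix a Φ (Y ∪ Z)).rank ≤
      (G.labelMatrix a Φ Y).rank + (G.labelMatrix a Φ Z).rank := by
  have eq_add : G.maskedMatrix a Φ (Y ∪ Z) = G.maskedMatrix a Φ Y + G.maskedMatrix a Φ Z := by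
    ext r e
    have := fun he : e ∈ Y => Finset.disjoint_left.1 h he
    simp only [maskedMatrix, Matrix.add_apply, Matrix.of_apply, Finset.mem_union]
    grind
  simpa only [← rank_maskedMatrix, eq_add] using matrix_rank_add_le _ _

lemma rank_labelMatrix_congr (G : PlaneGraph V E F) (a : E → K) {Φ Ψ : Finset F}
    {Y Z : Finset E} (h : ∀ f e, G.bd f e ≠ 0 → (f ∈ Φ ∧ e ∈ Y ↔ f ∈ Ψ ∧ e ∈ Z)) :
    (G.labelMatrix a Φ Y).rank = (G.labelMatrix a Ψ Z).rank := by
  classical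
  rw [← rank_maskedMatrix, ← rank_maskedMatrix]
  congr 1
  ext r e
  simp only [maskedMatrix, Matrix.of_apply]
  by_cases hre : G.bd r.1 e = 0
  · simp [hre]
  · simp only [h r.1 e hre]

open scoped Classical in
lemma add_rank_labelMatrix_le (G : PlaneGraph V E F) (a : E → K) {Φ Ψ : Finset F}
    {Y Z : Finset E} (h : Disjoint Φ Ψ) (block_eq_zero : ∀ f ∈ Φ, ∀ e ∈ Z, G.bd f e = 0) :
    (G.labelMatrix a Φ Y).rank + (G.labelMatrix a Ψ Z).rank ≤
      (G.labelMatrix a (Φ ∪ Ψ) (Y ∪ Z)).rank := by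
  let N := G.maskedMatrix a (Φ ∪ Ψ) (Y ∪ Z)
  let D : Matrix (F × Fin 3) (F × Fin 3) K := Matrix.diagonal fun r => if r.1 ∈ Φ then 1 else 0
  let D' : Matrix E E K := Matrix.diagonal fun e => if e ∈ Z then 1 else 0
  have notMem_Ψ : ∀ {f}, f ∈ Φ → f ∉ Ψ := fun {f} hf => Finset.disjoint_left.1 h hf
  have rows : D * N = G.maskedMatrix a Φ Y := by
    ext r e
    rw [Matrix.diagonal_mul]
    by_cases r.1 ∈ Φ <;> by_cases e ∈ Z <;> simp_all [N, maskedMatrix]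
  have cols : N * D' = G.maskedMatrix a Ψ Z := by
    ext r e
    rw [Matrix.mul_diagonal]
    by_cases r.1 ∈ Φ <;> by_cases e ∈ Z <;> simp_all [N, maskedMatrix]
  rw [← rank_maskedMatrix, ← rank_maskedMatrix, ← rank_maskedMatrix, ← rows, ← cols]
  refine rank_mul_add_rank_mul_le_of_mul_eq_zero D N D' ?_
  rw [rows]
  ext r e
  rw [Matrix.mul_diagonal]
  by_cases r.1 ∈ Φ <;> by_cases e ∈ Z <;> simp_all [maskedMatrix]

/-- The extended cycle basis matrix with indeterminate labels. -/
noncomputable def genericMatrix (G : PlaneGraph V E F) (K : Type*) [Field K] (Φ : Finset F)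
    (Y : Finset E) : Matrix (Φ × Fin 3) Y (MvPolynomial E K) :=
  Matrix.of fun r e => (G.bd r.1 e : MvPolynomial E K) * MvPolynomial.X (e : E) ^ (r.2 : ℕ)

lemma genericMatrix_map (G : PlaneGraph V E F) (Φ : Finset F) (Y : Finset E) (a : E → K) :
    (G.genericMatrix K Φ Y).map (MvPolynomial.eval a) = G.labelMatrix a Φ Y := by
  ext r e
  simp [genericMatrix, labelMatrix]

lemma isAlgebraicVariety_rank_labelMatrix_lt (G : PlaneGraph V E F) (Φ : Finset F) (Y : Finset E)
    (r : ℕ) : IsAlgebraicVariety {a : E → K | (G.labelMatrix a Φ Y).rank < r} := by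
  simpa only [genericMatrix_map] using isAlgebraicVariety_rank_lt (G.genericMatrix K Φ Y) r

lemma exists_forall_rank_labelMatrix_le [Infinite K] (G : PlaneGraph V E F) {ι : Type*}
    (s : Finset ι) (Φ : ι → Finset F) (Y : ι → Finset E) (b : ι → E → K) :
    ∃ a : E → K, ∀ i ∈ s,
      (G.labelMatrix (b i) (Φ i) (Y i)).rank ≤ (G.labelMatrix a (Φ i) (Y i)).rank := by
  choose p hp rank_le using fun i =>
    exists_eval_ne_zero_imp_rank_le (G.genericMatrix K (Φ i) (Y i)) (b i)
  have prod_ne_zero : ∏ i ∈ s, p i ≠ 0 :=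
    Finset.prod_ne_zero_iff.2 fun i _ hi => hp i (by rw [hi, map_zero])
  obtain ⟨a, ha⟩ : ∃ a, MvPolynomial.eval a (∏ i ∈ s, p i) ≠ 0 := by
    by_contra! eval_eq_zero
    exact prod_ne_zero (MvPolynomial.funext fun x => by rw [eval_eq_zero, map_zero])
  rw [map_prod, Finset.prod_ne_zero_iff] at ha
  exact ⟨a, fun i hi => by simpa only [genericMatrix_map] using rank_le i a (ha i hi)⟩

end LabelRank

end PlaneGraph

section Laplace

lemma sign_eq_neg_one_pow_card_inversions_fin {n : ℕ} (σ : Equiv.Perm (Fin n)) :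
    (Equiv.Perm.sign σ : ℤ) =
      (-1) ^ (Finset.univ.filter fun p : Fin n × Fin n => p.1 < p.2 ∧ σ p.2 < σ p.1).card := by
  have factor_eq : ∀ x ∈ Finset.univ.sigma Finset.Ioi,
      ((if σ x.1 < σ x.2 then 1 else -1 : ℤˣ) : ℤ) = if σ x.2 < σ x.1 then -1 else 1 := by
    intro x hx
    have lt : x.1 < x.2 := by simpa using hx
    rcases (σ.injective.ne lt.ne).lt_or_gt with h | h <;> simp [h, h.not_gt]
  rw [σ.sign_eq_prod_prod_Ioi, Finset.prod_sigma', Units.coe_prod, Finset.prod_congr rfl factor_eq,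
    Finset.prod_ite, Finset.prod_const_one, mul_one, Finset.prod_const]
  congr 1
  exact Finset.card_bij (fun x _ => (x.1, x.2)) (fun x hx => by simpa using hx)
    (fun ⟨a, b⟩ _ ⟨c, d⟩ _ h => by simpa using h)
    fun ⟨a, b⟩ hab => ⟨⟨a, b⟩, by simpa using hab, rfl⟩

lemma sign_eq_neg_one_pow_card_inversions {ι : Type*} [Fintype ι] [LinearOrder ι]
    (σ : Equiv.Perm ι) : (Equiv.Perm.sign σ : ℤ) =
      (-1) ^ (Finset.univ.filter fun p : ι × ι => p.1 < p.2 ∧ σ p.2 < σ p.1).card := by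
  let o : ι ≃o Fin (Fintype.card ι) := (monoEquivOfFin ι rfl).symm
  rw [← Equiv.Perm.sign_permCongr o.toEquiv σ, sign_eq_neg_one_pow_card_inversions_fin]
  congr 1
  refine (Finset.card_equiv (o.toEquiv.prodCongr o.toEquiv) fun p => ?_).symm
  simp

variable {α ε : Type*} [LinearOrder ε] {m : ℕ}

/-- The `j`-th smallest element of the block `φ f`. -/
def blockEntry (φ : α → {A : Finset ε // A.card = m}) (p : α × Fin m) : ε :=
  (φ p.1).1.orderEmbOfFin (φ p.1).2 p.2

lemma blockEntry_mem (φ : α → {A : Finset ε // A.card = m}) (p : α × Fin m) :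
    blockEntry φ p ∈ (φ p.1).1 :=
  Finset.orderEmbOfFin_mem _ _ _

lemma range_blockEntry (φ : α → {A : Finset ε // A.card = m}) (f : α) :
    (Set.range fun j => blockEntry φ (f, j)) = ((φ f).1 : Set ε) := by
  rw [← Finset.range_orderEmbOfFin (φ f).1 (φ f).2]
  rfl

lemma exists_blockEntry_eq {φ : α → {A : Finset ε // A.card = m}} {f : α} {x : ε}
    (hx : x ∈ (φ f).1) : ∃ j, blockEntry φ (f, j) = x := by
  rwa [← Finset.mem_coe, ← range_blockEntry] at hx

lemma blockEntry_lt_blockEntry (φ : α → {A : Finset ε // A.card = m}) (f : α) {i j : Fin m} :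
    blockEntry φ (f, i) < blockEntry φ (f, j) ↔ i < j :=
  ((φ f).1.orderEmbOfFin (φ f).2).lt_iff_lt

lemma blockEntry_left_injective (φ : α → {A : Finset ε // A.card = m}) (f : α) :
    Function.Injective fun j => blockEntry φ (f, j) :=
  ((φ f).1.orderEmbOfFin (φ f).2).injective

/-- The blocks `φ` are pairwise disjoint and contained in `C`. -/
def IsBlockFamily (C : Finset ε) (φ : α → {A : Finset ε // A.card = m}) : Prop :=
  (∀ f, ∀ x ∈ (φ f).1, x ∈ C) ∧ ∀ f f', f ≠ f' → Disjoint (φ f).1 (φ f').1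

lemma IsBlockFamily.blockEntry_injective {C : Finset ε} {φ : α → {A : Finset ε // A.card = m}}
    (h : IsBlockFamily C φ) : Function.Injective (blockEntry φ) := by
  rintro ⟨f, j⟩ ⟨f', j'⟩ heq
  obtain rfl : f = f' := by
    by_contra hne
    exact Finset.disjoint_left.1 (h.2 f f' hne) (blockEntry_mem φ (f, j))
      (heq ▸ blockEntry_mem φ (f', j'))
  rw [blockEntry_left_injective φ f heq]

/-- If the positions `α × Fin m` enumerate `C`, then blocks partitioning `C` permute the positions:
this permutation takes each position to the place where `C` lists its block entry. -/
noncomputable def blockPerm [Finite α] {C : Finset ε} (e : α × Fin m ≃ C)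
    {φ : α → {A : Finset ε // A.card = m}} (h : IsBlockFamily C φ) : Equiv.Perm (α × Fin m) :=
  Equiv.ofBijective (fun p => e.symm ⟨blockEntry φ p, h.1 _ _ (blockEntry_mem φ p)⟩)
    (Finite.injective_iff_bijective.1 fun p q hpq =>
      h.blockEntry_injective (by simpa using hpq))

lemma apply_blockPerm [Finite α] {C : Finset ε} (e : α × Fin m ≃ C)
    {φ : α → {A : Finset ε // A.card = m}} (h : IsBlockFamily C φ) (p : α × Fin m) :
    (e (blockPerm e h p) : ε) = blockEntry φ p := by
  simp [blockPerm]

/-- The pairs of elements of different blocks that are listed in the wrong order if the blocks are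
listed one after the other. -/
noncomputable def blockInversions [Fintype α] [Fintype ε] [LinearOrder α]
    (φ : α → {A : Finset ε // A.card = m}) : Finset ((α × ε) × (α × ε)) :=
  Finset.univ.filter fun p =>
    p.1.2 ∈ (φ p.1.1).1 ∧ p.2.2 ∈ (φ p.2.1).1 ∧ p.1.1 < p.2.1 ∧ p.2.2 < p.1.2

lemma card_blockInversions [Fintype α] [Fintype ε] [LinearOrder α]
    (φ : α → {A : Finset ε // A.card = m}) :
    (blockInversions φ).card = (Finset.univ.filter fun p : (α ×ₗ Fin m) × (α ×ₗ Fin m) =>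
      p.1 < p.2 ∧ blockEntry φ (ofLex p.2) < blockEntry φ (ofLex p.1)).card := by
  let entry (p : α ×ₗ Fin m) : α × ε := ((ofLex p).1, blockEntry φ (ofLex p))
  have entry_injective : Function.Injective entry := by
    rintro ⟨f, j⟩ ⟨f', j'⟩ h
    obtain ⟨hf, h⟩ := Prod.mk.inj h
    obtain rfl : f = f' := hf
    exact congrArg (fun i => toLex (f, i)) (blockEntry_left_injective φ f h)
  symm
  refine Finset.card_bij (fun p _ => (entry p.1, entry p.2)) ?_
    (fun p _ q _ h => Prod.ext (entry_injective (Prod.mk.inj h).1)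
      (entry_injective (Prod.mk.inj h).2)) ?_
  · rintro ⟨⟨f, i⟩, ⟨f', j⟩⟩ h
    obtain ⟨lt, entry_lt⟩ := (Finset.mem_filter.1 h).2
    refine Finset.mem_filter.2 ⟨Finset.mem_univ _, blockEntry_mem φ _, blockEntry_mem φ _, ?_,
      entry_lt⟩
    rcases Prod.Lex.lt_iff.1 lt with hf | ⟨hf, hij⟩
    · exact hf
    · obtain rfl : f = f' := hf
      exact absurd ((blockEntry_lt_blockEntry φ f).1 entry_lt) hij.not_gt
  · rintro ⟨⟨f, x⟩, ⟨f', x'⟩⟩ h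
    obtain ⟨hx : x ∈ (φ f).1, hx' : x' ∈ (φ f').1, hf, hlt⟩ := (Finset.mem_filter.1 h).2
    obtain ⟨i, rfl⟩ := exists_blockEntry_eq hx
    obtain ⟨j, rfl⟩ := exists_blockEntry_eq hx'
    exact ⟨(toLex (f, i), toLex (f', j)), Finset.mem_filter.2
      ⟨Finset.mem_univ _, Prod.Lex.lt_iff.2 (Or.inl hf), hlt⟩, rfl⟩

lemma sign_blockPerm [Fintype α] [Fintype ε] [LinearOrder α] {C : Finset ε} (e : α ×ₗ Fin m ≃o C)
    {φ : α → {A : Finset ε // A.card = m}} (h : IsBlockFamily C φ) :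
    (Equiv.Perm.sign (blockPerm (toLex.trans e.toEquiv) h) : ℤ) =
      (-1) ^ (blockInversions φ).card := by
  rw [card_blockInversions, ← Equiv.Perm.sign_permCongr toLex,
    sign_eq_neg_one_pow_card_inversions]
  congr! 4 with p
  rw [← e.lt_iff_lt (x := (toLex.permCongr _) p.2), ← Subtype.coe_lt_coe,
    ← apply_blockPerm _ h, ← apply_blockPerm _ h]
  rfl

lemma exists_blockPerm_mul_eq [Finite α] {C : Finset ε} (e : α × Fin m ≃ C)
    (σ : Equiv.Perm (α × Fin m)) :
    ∃ (φ : α → {A : Finset ε // A.card = m}) (h : IsBlockFamily C φ)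
      (τ : α → Equiv.Perm (Fin m)), blockPerm e h * Equiv.prodCongrRight τ = σ := by
  classical
  have entry_injective (f : α) : Function.Injective fun t => (e (σ (f, t)) : ε) := fun t t' h => by
    simpa using h
  let φ (f : α) : {A : Finset ε // A.card = m} :=
    ⟨Finset.univ.image fun t => (e (σ (f, t)) : ε), by
      simp [Finset.card_image_of_injective _ (entry_injective f)]⟩
  have mem_φ (f : α) (x : ε) : x ∈ (φ f).1 ↔ ∃ t, (e (σ (f, t)) : ε) = x := by simp [φ]
  have h : IsBlockFamily C φ := by
    refine ⟨fun f x hx => ?_, fun f f' hne => Finset.disjoint_left.2 fun x hx hx' => ?_⟩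
    · obtain ⟨t, rfl⟩ := (mem_φ f x).1 hx
      exact (e (σ (f, t))).2
    · obtain ⟨t, rfl⟩ := (mem_φ f x).1 hx
      obtain ⟨t', ht'⟩ := (mem_φ f' _).1 hx'
      have := σ.injective (e.injective (Subtype.ext ht'))
      exact hne (Prod.mk.inj this).1.symm
  choose τ hτ using fun f t => exists_blockEntry_eq ((mem_φ f _).2 ⟨t, rfl⟩)
  have τ_injective (f : α) : Function.Injective (τ f) := fun t t' htt' =>
    entry_injective f (by simp only [← hτ, htt'])
  refine ⟨φ, h, fun f => Equiv.ofBijective (τ f) (Finite.injective_iff_bijective.1 (τ_injective f)),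
    ?_⟩
  ext1 ⟨f, t⟩
  refine e.injective (Subtype.ext ?_)
  rw [Equiv.Perm.mul_apply, apply_blockPerm]
  exact hτ f t

lemma eq_of_blockPerm_mul_eq [Finite α] {C : Finset ε} (e : α × Fin m ≃ C)
    {φ φ' : α → {A : Finset ε // A.card = m}} (h : IsBlockFamily C φ) (h' : IsBlockFamily C φ')
    {τ τ' : α → Equiv.Perm (Fin m)}
    (heq : blockPerm e h * Equiv.prodCongrRight τ = blockPerm e h' * Equiv.prodCongrRight τ') :
    φ = φ' ∧ τ = τ' := by
  have entry_eq (f : α) (t : Fin m) : blockEntry φ (f, τ f t) = blockEntry φ' (f, τ' f t) := by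
    simpa [apply_blockPerm] using congrArg (fun σ => (e (σ (f, t)) : ε)) heq
  obtain rfl : φ = φ' := by
    funext f
    rw [Subtype.ext_iff, ← Finset.coe_inj, ← range_blockEntry, ← range_blockEntry,
      ← (τ f).surjective.range_comp fun j => blockEntry φ (f, j),
      ← (τ' f).surjective.range_comp fun j => blockEntry φ' (f, j)]
    exact congrArg Set.range (funext (entry_eq f))
  refine ⟨rfl, ?_⟩
  ext f t
  rw [blockEntry_left_injective φ f (entry_eq f t)]

variable {R : Type*} [CommRing R]

lemma prod_det_blocks_eq_sum [Fintype α] [DecidableEq α] (M : α → Fin m → ε → R)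
    (φ : α → {A : Finset ε // A.card = m}) :
    ∏ f, (Matrix.of fun t j => M f t (blockEntry φ (f, j))).det =
      ∑ τ : α → Equiv.Perm (Fin m),
        ∏ f, (((Equiv.Perm.sign (τ f) : ℤ) : R) * ∏ t, M f t (blockEntry φ (f, τ f t))) := by
  have block_eq (f : α) : (Matrix.of fun t j => M f t (blockEntry φ (f, j))).det =
      ∑ τ : Equiv.Perm (Fin m), ((Equiv.Perm.sign τ : ℤ) : R) *
        ∏ t, M f t (blockEntry φ (f, τ t)) := by
    rw [← Matrix.det_transpose, Matrix.det_apply']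
    rfl
  simp only [block_eq]
  rw [Finset.prod_univ_sum, Fintype.piFinset_univ]

open scoped Classical in
lemma det_eq_sum_blocks [Fintype α] [Fintype ε] [LinearOrder α] {C : Finset ε}
    (e : α ×ₗ Fin m ≃o C) (M : α → Fin m → ε → R) :
    (Matrix.of fun p q : α × Fin m => M p.1 p.2 (e (toLex q))).det =
      ∑ φ : α → {A : Finset ε // A.card = m} with IsBlockFamily C φ,
        (((-1) ^ (blockInversions φ).card : ℤ) : R) *
          ∏ f, (Matrix.of fun t j => M f t (blockEntry φ (f, j))).det := by
  let e₀ : α × Fin m ≃ C := toLex.trans e.toEquiv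
  rw [← Matrix.det_transpose, Matrix.det_apply']
  simp only [prod_det_blocks_eq_sum, Finset.mul_sum]
  rw [← Finset.sum_product', eq_comm]
  have isBlockFamily {x : (α → {A : Finset ε // A.card = m}) × (α → Equiv.Perm (Fin m))}
      (hx : x ∈ (Finset.univ.filter (IsBlockFamily C)) ×ˢ Finset.univ) : IsBlockFamily C x.1 :=
    (Finset.mem_filter.1 (Finset.mem_product.1 hx).1).2
  refine Finset.sum_bij
    (fun x hx => blockPerm e₀ (isBlockFamily hx) * Equiv.prodCongrRight x.2)
    (fun _ _ => Finset.mem_univ _) ?_ ?_ ?_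
  · intro x hx y hy heq
    obtain ⟨hφ, hτ⟩ := eq_of_blockPerm_mul_eq e₀ (isBlockFamily hx) (isBlockFamily hy) heq
    exact Prod.ext hφ hτ
  · intro σ _
    obtain ⟨φ, h, τ, rfl⟩ := exists_blockPerm_mul_eq e₀ σ
    exact ⟨(φ, τ), by simpa using h, rfl⟩
  · rintro ⟨φ, τ⟩ hx
    have h := isBlockFamily hx
    rw [Equiv.Perm.sign_mul, Equiv.Perm.sign_prodCongrRight, Units.val_mul, sign_blockPerm e h,
      Finset.prod_mul_distrib, Fintype.prod_prod_type]
    push_cast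
    rw [mul_assoc]
    congr! 6 with f _ t _
    exact congrArg (M f t) (apply_blockPerm e₀ h (f, τ f t)).symm

end Laplace

lemma matrix_det_eq_zero_iff_rank_lt {K n : Type*} [Field K] [Fintype n] [DecidableEq n]
    (A : Matrix n n K) : A.det = 0 ↔ A.rank < Fintype.card n := by
  refine ⟨fun h => A.rank_le_card_width.lt_of_ne fun rank_eq => ?_, fun h => ?_⟩
  · have range_eq_top : LinearMap.range A.mulVecLin = ⊤ :=
      Submodule.eq_top_of_finrank_eq (rank_eq.trans (Module.finrank_fintype_fun_eq_card K).symm)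
    exact ((Matrix.isUnit_iff_isUnit_det A).1 (Matrix.mulVec_surjective_iff_isUnit.1
      (LinearMap.range_eq_top.1 range_eq_top))).ne_zero h
  · by_contra hdet
    exact h.ne (Matrix.rank_of_det_ne_zero hdet)

namespace PlaneGraph

section Polynomials

variable {V E F K : Type*} [Fintype V] [Fintype E] [Fintype F] [Field K]

lemma rank_labelMatrix_mono_edges (G : PlaneGraph V E F) (a : E → K) (Φ : Finset F)
    {Y Z : Finset E} (h : Y ⊆ Z) : (G.labelMatrix a Φ Y).rank ≤ (G.labelMatrix a Φ Z).rank :=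
  (G.labelMatrix a Φ Z).rank_submatrix_le id fun e : Y => (⟨e, h e.2⟩ : Z)

lemma exists_card_eq_rank_labelMatrix (G : PlaneGraph V E F) (a : E → K) (Φ : Finset F)
    (Y : Finset E) : ∃ C ⊆ Y, C.card = (G.labelMatrix a Φ Y).rank ∧
      (G.labelMatrix a Φ Y).rank ≤ (G.labelMatrix a Φ C).rank := by
  classical
  obtain ⟨c, independent⟩ := exists_linearIndependent_cols (G.labelMatrix a Φ Y)
  have c_injective : Function.Injective c := fun i j h =>
    independent.injective (congrArg (G.labelMatrix a Φ Y).col h)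
  let C : Finset E := Finset.univ.image fun i => (c i : E)
  have mem_C (i) : (c i : E) ∈ C := Finset.mem_image_of_mem _ (Finset.mem_univ i)
  refine ⟨C, Finset.image_subset_iff.2 fun i _ => (c i).2, ?_, ?_⟩
  · exact (Finset.card_image_of_injective _ (Subtype.val_injective.comp c_injective)).trans
      (Finset.card_fin _)
  · let L := (G.labelMatrix a Φ C).submatrix id fun i => ⟨c i, mem_C i⟩
    have independent_L : LinearIndependent K L.transpose.row := independent
    calc (G.labelMatrix a Φ Y).rank = L.rank := by
          rw [← L.rank_transpose, independent_L.rank_matrix, Fintype.card_fin]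
      _ ≤ (G.labelMatrix a Φ C).rank := Matrix.rank_submatrix_le _ _ _

lemma rank_labelMatrix_lt_iff (G : PlaneGraph V E F) (a : E → K) (Φ : Finset F) (Y : Finset E) :
    (G.labelMatrix a Φ Y).rank < 3 * Φ.card ↔
      ∀ C ∈ Y.powersetCard (3 * Φ.card), (G.labelMatrix a Φ C).rank < 3 * Φ.card := by
  refine ⟨fun h C hC =>
    (G.rank_labelMatrix_mono_edges a Φ (Finset.mem_powersetCard.1 hC).1).trans_lt h, fun h => ?_⟩
  by_contra! hrank
  have rank_eq := le_antisymm (G.rank_labelMatrix_le_three_mul_card a Φ Y) hrank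
  obtain ⟨C, hCY, card_C, rank_le⟩ := G.exists_card_eq_rank_labelMatrix a Φ Y
  exact (h C (Finset.mem_powersetCard.2 ⟨hCY, card_C.trans rank_eq⟩)).not_ge (hrank.trans rank_le)

variable [LinearOrder E] [LinearOrder F] {G : PlaneGraph V E F}

/-- The determinant of `faceMatrix`, hence the summand, vanishes if one of the three edges is not on
the boundary of the face, so the sum may be extended to all disjoint triples. -/
lemma eval_edgeInjectivePoly (H : G.Minor) {C : Finset E} (e : H.faces ×ₗ Fin 3 ≃o C)
    (a : E → K) : MvPolynomial.eval a (H.edgeInjectivePoly K C) =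
      (Matrix.of fun p q : H.faces × Fin 3 =>
        (G.bd p.1 (e (toLex q)) : K) * a (e (toLex q)) ^ (p.2 : ℕ)).det := by
  classical
  let M (f : H.faces) (t : Fin 3) (x : E) : K := (G.bd f x : K) * a x ^ (t : ℕ)
  have eval_faceMatrix (φ : H.faces → {A : Finset E // A.card = 3}) (f : H.faces) :
      MvPolynomial.eval a (Minor.faceMatrix K G f (φ f)).det =
        (Matrix.of fun t j => M f t (blockEntry φ (f, j))).det := by
    rw [RingHom.map_det]
    congr 1
    ext t j
    simp [Minor.faceMatrix, M, blockEntry]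
  rw [show (Matrix.of fun p q : H.faces × Fin 3 =>
    (G.bd p.1 (e (toLex q)) : K) * a (e (toLex q)) ^ (p.2 : ℕ)).det = _ from det_eq_sum_blocks e M,
    Minor.edgeInjectivePoly, map_sum]
  refine Finset.sum_subset_zero_on_sdiff ?_ ?_ ?_
  · intro φ hφ
    simp only [Finset.mem_filter, Finset.mem_univ, true_and] at hφ ⊢
    exact ⟨fun f x hx => (hφ.1 f x hx).1, hφ.2⟩
  · intro φ hφ
    simp only [Finset.mem_sdiff, Finset.mem_filter, Finset.mem_univ, true_and] at hφ
    obtain ⟨f, x, hx, bd_eq_zero⟩ : ∃ f, ∃ x ∈ (φ f).1, G.bd f x = 0 := by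
      by_contra! bd_ne_zero
      exact hφ.2 ⟨fun f x hx => ⟨hφ.1.1 f x hx, bd_ne_zero f x hx⟩, hφ.1.2⟩
    obtain ⟨j, rfl⟩ := exists_blockEntry_eq hx
    rw [Finset.prod_eq_zero (Finset.mem_univ f), mul_zero]
    exact Matrix.det_eq_zero_of_column_eq_zero j fun t => by simp [M, bd_eq_zero]
  · intro φ _
    rw [map_mul, map_prod, map_intCast, Finset.prod_congr rfl fun f _ => eval_faceMatrix φ f]
    rfl

lemma eval_edgeInjectivePoly_eq_zero_iff (H : G.Minor) {C : Finset E}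
    (hC : C.card = 3 * H.faces.card) (a : E → K) :
    MvPolynomial.eval a (H.edgeInjectivePoly K C) = 0 ↔
      (G.labelMatrix a H.faces C).rank < 3 * H.faces.card := by
  have card_rows : Fintype.card (H.faces ×ₗ Fin 3) = 3 * H.faces.card := by simp [Lex, mul_comm]
  let e : H.faces ×ₗ Fin 3 ≃o C :=
    (monoEquivOfFin (H.faces ×ₗ Fin 3) card_rows).symm.trans (C.orderIsoOfFin hC)
  have card_prod : Fintype.card (H.faces × Fin 3) = 3 * H.faces.card := by simp [mul_comm]
  have reindex_rank : ((G.labelMatrix a H.faces C).submatrix (Equiv.refl _)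
      (toLex.trans e.toEquiv)).rank = (G.labelMatrix a H.faces C).rank :=
    Matrix.rank_submatrix _ _ _
  rw [eval_edgeInjectivePoly H e, matrix_det_eq_zero_iff_rank_lt, ← reindex_rank, card_prod]
  rfl

end Polynomials

end PlaneGraph

namespace PlaneGraph

section ExpectedRank

variable {V E F K : Type*} [Fintype V] [Fintype E] [Fintype F] [Field K] {G : PlaneGraph V E F}

lemma rank_labelMatrix_remainingEdgesOn (G : PlaneGraph V E F) (a : E → K) (Φ X : Finset F) :
    (G.labelMatrix a X (G.remainingEdgesOn Φ X)).rank =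
      (G.labelMatrix a X (G.remainingEdges Φ)).rank :=
  G.rank_labelMatrix_congr a fun f _ hfe =>
    ⟨fun h => ⟨h.1, (mem_remainingEdgesOn.1 h.2).1⟩,
      fun h => ⟨h.1, mem_remainingEdgesOn.2 ⟨h.2, f, h.1, hfe⟩⟩⟩

lemma exists_rank_labelMatrix_remainingEdgesOn_ge (K : Type*) [Field K] [Infinite K]
    (hG : G.ShareAtMostOneEdge) {Φ X : Finset F}
    (h : ∀ T, T ⊂ X → T.Nonempty → 3 * T.card < (G.remainingEdgesOn Φ T).card) :
    ∃ b : E → K, min (G.remainingEdgesOn Φ X).card (3 * X.card) ≤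
      (G.labelMatrix b X (G.remainingEdgesOn Φ X)).rank := by
  classical
  refine exists_rank_labelMatrix_ge K hG (fun e he => (mem_remainingEdgesOn.1 he).2)
    fun T hT hne => (h T hT hne).trans_le (Finset.card_le_card fun e he => Finset.mem_filter.2
      ⟨G.remainingEdgesOn_mono Φ hT.subset he, (mem_remainingEdgesOn.1 he).2⟩)

lemma IsMinContractible.exists_card_le_rank (K : Type*) [Field K] [Infinite K]
    (hG : G.ShareAtMostOneEdge) {Φ S : Finset F} (h : G.IsMinContractible Φ S) :
    ∃ b : E → K, (G.remainingEdgesOn Φ S).card ≤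
      (G.labelMatrix b S (G.remainingEdgesOn Φ S)).rank := by
  simpa only [min_eq_left h.2.2.1] using
    exists_rank_labelMatrix_remainingEdgesOn_ge K hG h.2.2.2

/-- The rank that the label matrix of the faces `Φ i` and the edges remaining after `i` contractions
has for generic labels: contracting along `S l` removes as many columns as there are edges on `S l`,
and these are linearly independent, while the last matrix has full rank. -/
noncomputable def expectedRank (G : PlaneGraph V E F) (k : ℕ) (S Φ : ℕ → Finset F) (i : ℕ) : ℕ :=
  ∑ l ∈ Finset.Ico i k, (G.remainingEdgesOn (Φ l) (S l)).card +
    min (G.remainingEdgesOn (Φ k) (Φ k)).card (3 * (Φ k).card)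

variable {k : ℕ} {S Φ : ℕ → Finset F}

lemma expectedRank_self : G.expectedRank k S Φ k =
    min (G.remainingEdgesOn (Φ k) (Φ k)).card (3 * (Φ k).card) := by
  simp [expectedRank]

lemma expectedRank_of_lt {i : ℕ} (hi : i < k) : G.expectedRank k S Φ i =
    (G.remainingEdgesOn (Φ i) (S i)).card + G.expectedRank k S Φ (i + 1) := by
  rw [expectedRank, Finset.sum_eq_sum_Ico_succ_bot hi, add_assoc, expectedRank]

namespace IsContractionSeq

open scoped Classical in
lemma extend (h : G.IsContractionSeq k S Φ) (hne : (Φ k).Nonempty)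
    (hcard : (G.remainingEdgesOn (Φ k) (Φ k)).card ≤ 3 * (Φ k).card) :
    G.IsContractionSeq (k + 1) (Function.update S k (Φ k)) (Function.update Φ (k + 1) ∅) := by
  have update_Φ (i : ℕ) (hi : i ≤ k) : Function.update Φ (k + 1) ∅ i = Φ i :=
    Function.update_of_ne (by omega) _ _
  have update_S (i : ℕ) (hi : i < k) : Function.update S k (Φ k) i = S i :=
    Function.update_of_ne (by omega) _ _
  have isolated : G.IsIsolatedContractible (Φ k) (Φ k) :=
    ⟨⟨subset_rfl, hne, hcard, h.last⟩, fun T hT hTne =>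
      absurd hT.2.2.1 (h.last T (hT.1.ssubset_of_ne hTne) hT.2.1).not_ge⟩
  refine ⟨by rw [update_Φ 0 (Nat.zero_le k), h.zero], fun i hi => ?_, fun i hi => ?_,
    fun T hT _ => ?_⟩
  · rcases Nat.lt_succ_iff_lt_or_eq.1 hi with hi | rfl
    · rw [update_Φ (i + 1) hi, update_Φ i hi.le, update_S i hi, h.succ i hi]
    · simp
  · rcases Nat.lt_succ_iff_lt_or_eq.1 hi with hi | rfl
    · rw [update_Φ i hi.le, update_S i hi]
      exact h.isolated i hi
    · rwa [update_Φ i le_rfl, Function.update_self]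
  · rw [Function.update_self] at hT
    exact absurd hT (Finset.not_ssubset_empty T)

lemma rank_remainingEdges_le_card (h : G.IsContractionSeq k S Φ) (hG : G.ShareAtMostOneEdge)
    (a : E → K) {i l : ℕ} (hil : i ≤ l) (hl : l < k) :
    (G.labelMatrix a (S l) (G.remainingEdges (Φ i))).rank ≤
      (G.remainingEdgesOn (Φ l) (S l)).card := by
  rcases h.card_eq_or_singleton hG hl with hcard | ⟨⟨f, hf⟩, hcard⟩
  · exact (G.rank_labelMatrix_le_three_mul_card a _ _).trans_eq hcard.symm
  · rw [hf] at hcard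
    rw [← rank_labelMatrix_remainingEdgesOn, hf,
      ← h.remainingEdgesOn_eq_of_card_le_two hG hl hf (by omega) hil]
    exact G.rank_labelMatrix_le_card a _ _

lemma rank_last_remainingEdges_le (h : G.IsContractionSeq k S Φ) (hG : G.ShareAtMostOneEdge)
    (a : E → K) {i : ℕ} (hi : i ≤ k) :
    (G.labelMatrix a (Φ k) (G.remainingEdges (Φ i))).rank ≤ G.expectedRank k S Φ k := by
  rw [expectedRank_self]
  have rank_le := G.rank_labelMatrix_le_three_mul_card a (Φ k) (G.remainingEdges (Φ i))
  refine le_min ?_ rank_le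
  by_contra! hlt
  have hne : (Φ k).Nonempty := Finset.card_pos.1 (by omega)
  have := (h.extend hne (hlt.trans_le rank_le).le).rank_remainingEdges_le_card hG a hi
    (Nat.lt_succ_self k)
  rw [Function.update_self, Function.update_of_ne (by omega), Function.update_of_ne (by omega)]
    at this
  omega

open scoped Classical in
lemma union_succ (h : G.IsContractionSeq k S Φ) {i : ℕ} (hi : i < k) : S i ∪ Φ (i + 1) = Φ i := by
  rw [h.succ i hi, Finset.union_sdiff_of_subset (h.isolated i hi).1.1]

lemma disjoint_succ (h : G.IsContractionSeq k S Φ) {i : ℕ} (hi : i < k) :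
    Disjoint (S i) (Φ (i + 1)) := by
  classical
  rw [h.succ i hi]
  exact Finset.disjoint_sdiff

open scoped Classical in
lemma remainingEdges_union_succ (h : G.IsContractionSeq k S Φ) {i : ℕ} (hi : i < k) :
    G.remainingEdgesOn (Φ i) (S i) ∪ G.remainingEdges (Φ (i + 1)) = G.remainingEdges (Φ i) := by
  ext e
  rw [Finset.mem_union, h.succ i hi, mem_remainingEdges_sdiff]
  have := fun he : e ∈ G.remainingEdgesOn (Φ i) (S i) => (mem_remainingEdgesOn.1 he).1
  tauto

lemma rank_remainingEdges_le_expectedRank (h : G.IsContractionSeq k S Φ)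
    (hG : G.ShareAtMostOneEdge) (a : E → K) {i j : ℕ} (hij : i ≤ j) (hj : j ≤ k) :
    (G.labelMatrix a (Φ j) (G.remainingEdges (Φ i))).rank ≤ G.expectedRank k S Φ j := by
  classical
  induction hj using Nat.decreasingInduction with
  | self => exact h.rank_last_remainingEdges_le hG a hij
  | of_succ j hj ih =>
    have rank_union := G.rank_labelMatrix_union_faces_le a (h.disjoint_succ hj)
      (G.remainingEdges (Φ i))
    rw [h.union_succ hj] at rank_union
    rw [expectedRank_of_lt hj]
    exact rank_union.trans (add_le_add (h.rank_remainingEdges_le_card hG a hij hj) (ih (by omega)))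

lemma rank_le_card_add_rank_succ (h : G.IsContractionSeq k S Φ) (a : E → K) {i : ℕ} (hi : i < k) :
    (G.labelMatrix a (Φ i) (G.remainingEdges (Φ i))).rank ≤
      (G.remainingEdgesOn (Φ i) (S i)).card +
        (G.labelMatrix a (Φ (i + 1)) (G.remainingEdges (Φ (i + 1)))).rank := by
  classical
  have disjoint :
      Disjoint (G.remainingEdgesOn (Φ i) (S i)) (G.remainingEdges (Φ (i + 1))) := by
    rw [h.succ i hi]
    exact Finset.disjoint_right.2 fun e he => (mem_remainingEdges_sdiff.1 he).2
  have rank_succ : (G.labelMatrix a (Φ i) (G.remainingEdges (Φ (i + 1)))).rank =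
      (G.labelMatrix a (Φ (i + 1)) (G.remainingEdges (Φ (i + 1)))).rank :=
    G.rank_labelMatrix_congr a fun f e hfe =>
      ⟨fun he => ⟨not_imp_comm.1 (mem_remainingEdges.1 he.2 f) hfe, he.2⟩,
        fun he => ⟨h.subset_of_le (Nat.le_succ i) hi he.1, he.2⟩⟩
  have rank_union := G.rank_labelMatrix_union_edges_le a (Φ i) disjoint
  rw [h.remainingEdges_union_succ hi, rank_succ] at rank_union
  exact rank_union.trans (add_le_add_left (G.rank_labelMatrix_le_card a _ _) _)

lemma add_rank_succ_le_rank (h : G.IsContractionSeq k S Φ) (a : E → K) {i : ℕ} (hi : i < k) :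
    (G.labelMatrix a (S i) (G.remainingEdgesOn (Φ i) (S i))).rank +
      (G.labelMatrix a (Φ (i + 1)) (G.remainingEdges (Φ (i + 1)))).rank ≤
      (G.labelMatrix a (Φ i) (G.remainingEdges (Φ i))).rank := by
  classical
  have := G.add_rank_labelMatrix_le a (Y := G.remainingEdgesOn (Φ i) (S i)) (h.disjoint_succ hi)
    fun f hf e he => mem_remainingEdges.1 he f (Finset.disjoint_left.1 (h.disjoint_succ hi) hf)
  rwa [h.union_succ hi, h.remainingEdges_union_succ hi] at this

lemma rank_lt_expectedRank_iff_succ (h : G.IsContractionSeq k S Φ) (hG : G.ShareAtMostOneEdge)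
    (a : E → K) {i : ℕ} (hi : i < k) :
    (G.labelMatrix a (Φ i) (G.remainingEdges (Φ i))).rank < G.expectedRank k S Φ i ↔
      (G.labelMatrix a (S i) (G.remainingEdgesOn (Φ i) (S i))).rank <
          (G.remainingEdgesOn (Φ i) (S i)).card ∨
        (G.labelMatrix a (Φ (i + 1)) (G.remainingEdges (Φ (i + 1)))).rank <
          G.expectedRank k S Φ (i + 1) := by
  classical
  have rank_union := G.rank_labelMatrix_union_faces_le a (h.disjoint_succ hi)
    (G.remainingEdges (Φ i))
  rw [h.union_succ hi, ← rank_labelMatrix_remainingEdgesOn G a (Φ i) (S i)] at rank_union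
  have := h.rank_remainingEdges_le_expectedRank hG a (Nat.le_add_right i 1) hi
  have := h.rank_le_card_add_rank_succ a hi
  have := h.add_rank_succ_le_rank a hi
  rw [expectedRank_of_lt hi]
  omega

lemma rank_lt_expectedRank_iff (h : G.IsContractionSeq k S Φ) (hG : G.ShareAtMostOneEdge)
    (a : E → K) {i : ℕ} (hi : i ≤ k) :
    (G.labelMatrix a (Φ i) (G.remainingEdges (Φ i))).rank < G.expectedRank k S Φ i ↔
      (∃ l ∈ Set.Ico i k, (G.labelMatrix a (S l) (G.remainingEdgesOn (Φ l) (S l))).rank <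
          (G.remainingEdgesOn (Φ l) (S l)).card) ∨
        (G.labelMatrix a (Φ k) (G.remainingEdges (Φ k))).rank < G.expectedRank k S Φ k := by
  induction hi using Nat.decreasingInduction with
  | self => simp
  | of_succ i hi ih =>
    rw [h.rank_lt_expectedRank_iff_succ hG a hi, ih, ← or_assoc,
      ← Set.insert_Ico_add_one_left_eq_Ico hi]
    simp only [Set.mem_insert_iff, exists_eq_or_imp]

lemma exists_expectedRank_last_le (K : Type*) [Field K] [Infinite K]
    (h : G.IsContractionSeq k S Φ) (hG : G.ShareAtMostOneEdge) : ∃ b : E → K,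
      G.expectedRank k S Φ k ≤ (G.labelMatrix b (Φ k) (G.remainingEdges (Φ k))).rank := by
  simpa only [expectedRank_self, rank_labelMatrix_remainingEdgesOn] using
    exists_rank_labelMatrix_remainingEdgesOn_ge K hG h.last

lemma exists_expectedRank_zero_le (K : Type*) [Field K] [Infinite K]
    (h : G.IsContractionSeq k S Φ) (hG : G.ShareAtMostOneEdge) : ∃ b : E → K,
      G.expectedRank k S Φ 0 ≤ (G.labelMatrix b (Φ 0) (G.remainingEdges (Φ 0))).rank := by
  obtain ⟨c, hc⟩ := h.exists_expectedRank_last_le K hG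
  choose! b hb using fun i (hi : i < k) => (h.isolated i hi).1.exists_card_le_rank K hG
  obtain ⟨a, rank_le⟩ := G.exists_forall_rank_labelMatrix_le (Finset.insertNone (Finset.range k))
    (Option.elim · (Φ k) S)
    (Option.elim · (G.remainingEdges (Φ k)) fun i => G.remainingEdgesOn (Φ i) (S i))
    (Option.elim · c b)
  refine ⟨a, not_lt.1 fun hlt => ?_⟩
  rcases (h.rank_lt_expectedRank_iff hG a (Nat.zero_le k)).1 hlt with ⟨i, ⟨-, hi⟩, hlt⟩ | hlt
  · exact hlt.not_ge ((hb i hi).trans (rank_le (some i) (by simpa using hi)))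
  · exact hlt.not_ge (hc.trans (rank_le none (by simp)))

end IsContractionSeq

end ExpectedRank

end PlaneGraph

namespace PlaneGraph

variable {V E F K : Type*} [Fintype V] [Fintype E] [Fintype F] [Field K] {G : PlaneGraph V E F}

section SingleFace

lemma rank_labelMatrix_pos (a : E → K) {f : F} {j : E} {Φ : Finset F} {Y : Finset E}
    (hf : f ∈ Φ) (hj : j ∈ Y) (hfj : G.bd f j ≠ 0) : 0 < (G.labelMatrix a Φ Y).rank := by
  let N : Matrix Unit Unit K :=
    (G.labelMatrix a Φ Y).submatrix (fun _ => (⟨f, hf⟩, 0)) fun _ => ⟨j, hj⟩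
  have det_ne_zero : N.det ≠ 0 := by
    simpa [N, labelMatrix] using (G.cast_bd_ne_zero_iff f j).2 hfj
  have rank_N : N.rank = 1 := Matrix.rank_of_det_ne_zero det_ne_zero
  exact (rank_N.symm ▸ zero_lt_one).trans_le (Matrix.rank_submatrix_le _ _ _)

lemma rank_labelMatrix_singleton_pair_lt_two_iff [DecidableEq E] (a : E → K) {f : F} {j j' : E}
    (hfj : G.bd f j ≠ 0) (hfj' : G.bd f j' ≠ 0) :
    (G.labelMatrix a {f} {j, j'}).rank < 2 ↔ a j = a j' := by
  constructor
  · intro rank_lt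
    by_contra hne
    let N : Matrix (Fin 2) (Fin 2) K := (G.labelMatrix a {f} {j, j'}).submatrix
      (fun t => (⟨f, by simp⟩, t.castSucc)) ![⟨j, by simp⟩, ⟨j', by simp⟩]
    have det_N : N.det = (G.bd f j : K) * G.bd f j' * (a j' - a j) := by
      simp only [Matrix.det_fin_two, N, labelMatrix, Matrix.submatrix_apply, Matrix.cons_val_zero,
        Matrix.cons_val_one, Fin.castSucc_zero, Fin.castSucc_one, Fin.val_zero, Fin.val_one]
      ring
    have det_ne_zero : N.det ≠ 0 := by
      rw [det_N]
      exact mul_ne_zero (mul_ne_zero (G.cast_bd_ne_zero_iff f j |>.2 hfj)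
        (G.cast_bd_ne_zero_iff f j' |>.2 hfj')) (sub_ne_zero.2 (Ne.symm hne))
    have rank_N : N.rank = 2 := Matrix.rank_of_det_ne_zero det_ne_zero
    exact rank_lt.not_ge (rank_N ▸ Matrix.rank_submatrix_le _ _ _)
  · intro a_eq
    have eq_vecMulVec : G.labelMatrix a {f} {j, j'} =
        Matrix.vecMulVec (fun r : ({f} : Finset F) × Fin 3 => a j ^ (r.2 : ℕ))
          (fun e : ({j, j'} : Finset E) => (G.bd f e : K)) := by
      ext r e
      have face_eq : (r.1 : F) = f := Finset.mem_singleton.1 r.1.2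
      have label_eq : a e = a j := by
        rcases Finset.mem_insert.1 e.2 with he | he
        · rw [he]
        · rw [Finset.mem_singleton.1 he, a_eq]
      simp [labelMatrix, Matrix.vecMulVec_apply, face_eq, label_eq, mul_comm]
    rw [eq_vecMulVec]
    exact (Matrix.rank_vecMulVec_le _ _).trans_lt one_lt_two

end SingleFace

namespace Minor

section SpecialLocus

variable (H : G.Minor)

lemma specialLocus_eq_setOf_rank_lt {r : ℕ} (rank_le : ∀ a : E → K, (H.Mext a).rank ≤ r)
    (exists_le_rank : ∃ b : E → K, r ≤ (H.Mext b).rank) :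
    H.specialLocus K = {a | (H.Mext a).rank < r} := by
  obtain ⟨c, hc⟩ := exists_le_rank
  exact Set.ext fun a => ⟨fun ⟨b, hb⟩ => hb.trans_le (rank_le b), fun ha => ⟨c, ha.trans_le hc⟩⟩

lemma isAlgebraicVariety_specialLocus : IsAlgebraicVariety (H.specialLocus K) := by
  let ranks : Set ℕ := Set.range fun a : E → K => (H.Mext a).rank
  have bddAbove : BddAbove ranks := ⟨3 * H.faces.card, Set.forall_mem_range.2 fun a =>
    G.rank_labelMatrix_le_three_mul_card a H.faces H.edges⟩
  obtain ⟨b, hb⟩ := Nat.sSup_mem (Set.range_nonempty _) bddAbove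
  rw [H.specialLocus_eq_setOf_rank_lt (fun a => le_csSup bddAbove (Set.mem_range_self a))
    ⟨b, hb.ge⟩]
  exact G.isAlgebraicVariety_rank_labelMatrix_lt H.faces H.edges _

lemma specialLocus_eq_empty {f : F} {j : E} (hf : f ∈ H.faces) (hj : H.edges = {j})
    (hfj : G.bd f j ≠ 0) : H.specialLocus K = ∅ := by
  refine Set.eq_empty_of_forall_notMem fun a ⟨b, hb⟩ => ?_
  have rank_pos : 0 < (H.Mext a).rank :=
    rank_labelMatrix_pos a hf (hj ▸ Finset.mem_singleton_self j) hfj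
  have rank_le : (H.Mext b).rank ≤ H.edges.card := G.rank_labelMatrix_le_card b H.faces H.edges
  have card_edges : H.edges.card = 1 := by rw [hj, Finset.card_singleton]
  omega

lemma specialLocus_eq_polyZeros_X_sub_X [DecidableEq E] {f : F} {j j' : E} (hf : H.faces = {f})
    (hjj' : j ≠ j') (hj : H.edges = {j, j'}) (hfj : G.bd f j ≠ 0) (hfj' : G.bd f j' ≠ 0) :
    H.specialLocus K = polyZeros (MvPolynomial.X j - MvPolynomial.X j') := by
  have rank_lt_two_iff (a : E → K) : (H.Mext a).rank < 2 ↔ a j = a j' := by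
    change (G.labelMatrix a H.faces H.edges).rank < 2 ↔ _
    rw [hf, hj, rank_labelMatrix_singleton_pair_lt_two_iff a hfj hfj']
  rw [H.specialLocus_eq_setOf_rank_lt (r := 2) (fun a => ?_)
    ⟨Pi.single j 1, not_lt.1 (by simp [rank_lt_two_iff, hjj'.symm])⟩]
  · ext a
    simp [rank_lt_two_iff, polyZeros, sub_eq_zero]
  · exact (G.rank_labelMatrix_le_card a H.faces H.edges).trans_eq
      (by rw [hj, Finset.card_pair hjj'])

variable [LinearOrder E] [LinearOrder F]

lemma specialLocus_eq_iInter_polyZeros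
    (exists_le_rank : ∃ b : E → K, 3 * H.faces.card ≤ (H.Mext b).rank) :
    H.specialLocus K =
      ⋂ C ∈ H.edges.powersetCard (3 * H.faces.card), polyZeros (H.edgeInjectivePoly K C) := by
  rw [H.specialLocus_eq_setOf_rank_lt
    (fun a => G.rank_labelMatrix_le_three_mul_card a H.faces H.edges) exists_le_rank]
  ext a
  refine (G.rank_labelMatrix_lt_iff a H.faces H.edges).trans ?_
  simp only [Set.mem_iInter]
  exact forall₂_congr fun C hC =>
    (eval_edgeInjectivePoly_eq_zero_iff H (Finset.mem_powersetCard.1 hC).2 a).symm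

lemma specialLocus_eq_polyZeros (hcard : H.edges.card = 3 * H.faces.card)
    (exists_le_rank : ∃ b : E → K, H.edges.card ≤ (H.Mext b).rank) :
    H.specialLocus K = polyZeros (H.edgeInjectivePoly K H.edges) := by
  rw [H.specialLocus_eq_iInter_polyZeros (by rwa [← hcard]), ← hcard, Finset.powersetCard_self]
  simp

lemma edgeInjectivePoly_ne_zero (hcard : H.edges.card = 3 * H.faces.card)
    (exists_le_rank : ∃ b : E → K, H.edges.card ≤ (H.Mext b).rank) :
    H.edgeInjectivePoly K H.edges ≠ 0 := by
  obtain ⟨b, hb⟩ := exists_le_rank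
  intro h
  exact hb.not_gt (hcard ▸ (eval_edgeInjectivePoly_eq_zero_iff H hcard b).1 (by rw [h, map_zero]))

end SpecialLocus

section Contraction

variable {H : G.Minor} (hH : H.edges = G.remainingEdges H.faces) (T : Finset F)

include hH

lemma edgesOn_eq_remainingEdgesOn : H.edgesOn T = G.remainingEdgesOn H.faces T := by
  simp only [edgesOn, remainingEdgesOn, hH]

lemma edges_contract : (H.contract T).edges = G.remainingEdges (H.contract T).faces := by
  classical
  ext e
  simp only [contract]
  rw [mem_remainingEdges_sdiff, ← hH, ← edgesOn_eq_remainingEdgesOn hH]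
  simp

lemma isMinimalContractible_iff : H.IsMinimalContractible T ↔ G.IsMinContractible H.faces T := by
  simp only [IsMinimalContractible, IsContractible, IsMinContractible,
    edgesOn_eq_remainingEdgesOn hH]
  constructor
  · rintro ⟨⟨hT, hne, hcard⟩, hmin⟩
    exact ⟨hT, hne, hcard, fun X hX hXne =>
      not_le.1 fun h => hmin X hX ⟨hX.subset.trans hT, hXne, h⟩⟩
  · rintro ⟨hT, hne, hcard, hmin⟩
    exact ⟨⟨hT, hne, hcard⟩, fun X hX h => absurd h.2.2 (hmin X hX h.2.1).not_ge⟩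

variable {T}

lemma IsMinimalContractible.exists_card_le_rank (K : Type*) [Field K] [Infinite K]
    (hT : H.IsMinimalContractible T) (hG : G.ShareAtMostOneEdge) :
    ∃ b : E → K, (H.sub T).edges.card ≤ ((H.sub T).Mext b).rank := by
  change ∃ b : E → K, (H.edgesOn T).card ≤ (G.labelMatrix b T (H.edgesOn T)).rank
  rw [edgesOn_eq_remainingEdgesOn hH]
  exact ((isMinimalContractible_iff hH T).1 hT).exists_card_le_rank K hG

lemma IsMinimalContractible.specialLocus_sub [Infinite K] (hT : H.IsMinimalContractible T)
    (hG : G.ShareAtMostOneEdge) : (H.sub T).specialLocus K =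
      {a | ((H.sub T).Mext a).rank < (H.sub T).edges.card} :=
  specialLocus_eq_setOf_rank_lt _ (fun a => G.rank_labelMatrix_le_card a T _)
    (hT.exists_card_le_rank hH K hG)

end Contraction

end Minor

/-- The bounded faces that are left after contracting along `S 0, …, S (i - 1)`. -/
noncomputable abbrev remainingFaces (G : PlaneGraph V E F) (S : ℕ → Finset F) (i : ℕ) : Finset F :=
  (G.whole.contractSeq S i).faces

lemma edges_contractSeq (G : PlaneGraph V E F) (S : ℕ → Finset F) (i : ℕ) :
    (G.whole.contractSeq S i).edges = G.remainingEdges (G.remainingFaces S i) := by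
  induction i with
  | zero =>
    ext e
    simp [remainingFaces, Minor.contractSeq, whole, mem_remainingEdges]
  | succ i ih => exact Minor.edges_contract ih (S i)

lemma edgesOn_contractSeq (G : PlaneGraph V E F) (S : ℕ → Finset F) (i : ℕ) (T : Finset F) :
    (G.whole.contractSeq S i).edgesOn T = G.remainingEdgesOn (G.remainingFaces S i) T :=
  Minor.edgesOn_eq_remainingEdgesOn (G.edges_contractSeq S i) T

variable {k : ℕ} {S : ℕ → Finset F}

lemma isContractionSeq_remainingFaces
    (hmin : ∀ i < k, (G.whole.contractSeq S i).IsMinimalContractible (S i))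
    (hisolated : ∀ i < k, ∀ T, (G.whole.contractSeq S i).IsMinimalContractible T → T ≠ S i →
      Disjoint ((G.whole.contractSeq S i).edgesOn T) ((G.whole.contractSeq S i).edgesOn (S i)))
    (hlast : ∀ T, T ⊂ G.remainingFaces S k → ¬ (G.whole.contractSeq S k).IsContractible T) :
    G.IsContractionSeq k S (G.remainingFaces S) := by
  have minimal_iff (i : ℕ) := Minor.isMinimalContractible_iff (G.edges_contractSeq S i)
  simp only [Minor.IsContractible, minimal_iff, edgesOn_contractSeq] at hmin hisolated hlast
  exact ⟨rfl, fun i _ => rfl, fun i hi => ⟨hmin i hi, hisolated i hi⟩,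
    fun T hT hne => not_le.1 fun h => hlast T hT ⟨hT.subset, hne, h⟩⟩

namespace IsContractionSeq

variable (h : G.IsContractionSeq k S (G.remainingFaces S)) (hG : G.ShareAtMostOneEdge)

include h

lemma isMinimalContractible {i : ℕ} (hi : i < k) :
    (G.whole.contractSeq S i).IsMinimalContractible (S i) :=
  (Minor.isMinimalContractible_iff (G.edges_contractSeq S i) _).2 (h.isolated i hi).1

include hG

lemma exists_expectedRank_le_rank_contractSeq (K : Type*) [Field K] [Infinite K] :
    ∃ b : E → K, min ((G.whole.contractSeq S k).edgesOn (G.remainingFaces S k)).card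
      (3 * (G.remainingFaces S k).card) ≤ ((G.whole.contractSeq S k).Mext b).rank := by
  change ∃ b : E → K, _ ≤ (G.labelMatrix b _ (G.whole.contractSeq S k).edges).rank
  rw [edgesOn_contractSeq, edges_contractSeq, ← expectedRank_self (S := S)]
  exact h.exists_expectedRank_last_le K hG

lemma specialLocus_contractSeq [Infinite K] : (G.whole.contractSeq S k).specialLocus K =
    {a | ((G.whole.contractSeq S k).Mext a).rank <
      min ((G.whole.contractSeq S k).edgesOn (G.remainingFaces S k)).card
        (3 * (G.remainingFaces S k).card)} := by
  refine Minor.specialLocus_eq_setOf_rank_lt _ (fun a => ?_)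
    (h.exists_expectedRank_le_rank_contractSeq hG K)
  change (G.labelMatrix a _ (G.whole.contractSeq S k).edges).rank ≤ _
  rw [edgesOn_contractSeq, edges_contractSeq, ← expectedRank_self (S := S)]
  exact h.rank_last_remainingEdges_le hG a le_rfl

lemma specialLocus_whole [Infinite K] : G.whole.specialLocus K =
    (⋃ i ∈ Set.Iio k, ((G.whole.contractSeq S i).sub (S i)).specialLocus K) ∪
      (G.whole.contractSeq S k).specialLocus K := by
  have Mext_whole (a : E → K) : (G.whole.Mext a).rank =
      (G.labelMatrix a (G.remainingFaces S 0) (G.remainingEdges (G.remainingFaces S 0))).rank := by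
    rw [← edges_contractSeq]
    rfl
  rw [Minor.specialLocus_eq_setOf_rank_lt (r := G.expectedRank k S (G.remainingFaces S) 0) _
    (fun a => (Mext_whole a).trans_le
      (h.rank_remainingEdges_le_expectedRank hG a le_rfl (Nat.zero_le k)))
    (by simpa only [Mext_whole] using h.exists_expectedRank_zero_le K hG)]
  ext a
  rw [Set.mem_ofPred_eq, Mext_whole, h.rank_lt_expectedRank_iff hG a (Nat.zero_le k),
    Set.mem_union, Set.mem_iUnion₂]
  refine or_congr (exists_congr fun i => ?_) ?_
  · rw [exists_prop, Set.mem_Ico, Set.mem_Iio, and_iff_right (Nat.zero_le i)]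
    refine and_congr_right fun hi => ?_
    rw [(h.isMinimalContractible hi).specialLocus_sub (G.edges_contractSeq S i) hG,
      ← edgesOn_contractSeq]
    rfl
  · rw [h.specialLocus_contractSeq hG, ← edges_contractSeq, expectedRank_self,
      ← edgesOn_contractSeq]
    rfl

lemma specialLocus_sub_cases [LinearOrder E] [LinearOrder F] [Infinite K] {i : ℕ} (hi : i < k)
    {H : G.Minor} (hH : H = (G.whole.contractSeq S i).sub (S i)) :
    ((H.edges.card : ℤ) - 3 * (S i).card = -2 ∧ (∃ j, H.edges = {j}) ∧ H.specialLocus K = ∅) ∨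
    ((H.edges.card : ℤ) - 3 * (S i).card = -1 ∧ ∃ j j', j ≠ j' ∧ H.edges = {j, j'} ∧
      H.specialLocus K = polyZeros (MvPolynomial.X j - MvPolynomial.X j')) ∨
    ((H.edges.card : ℤ) - 3 * (S i).card = 0 ∧ H.edgeInjectivePoly K H.edges ≠ 0 ∧
      H.specialLocus K = polyZeros (H.edgeInjectivePoly K H.edges)) := by
  have faces_H : H.faces = S i := by rw [hH]; rfl
  have edges_H : H.edges = G.remainingEdgesOn (G.remainingFaces S i) (S i) :=
    hH ▸ G.edgesOn_contractSeq S i (S i)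
  have exists_le_rank : ∃ b : E → K, H.edges.card ≤ (H.Mext b).rank :=
    hH ▸ (h.isMinimalContractible hi).exists_card_le_rank (G.edges_contractSeq S i) K hG
  have cases := h.card_eq_or_singleton hG hi
  rw [← edges_H, ← faces_H] at cases
  rw [← faces_H] at edges_H ⊢
  rcases cases with hcard | ⟨⟨f, hf⟩, hcard⟩
  · exact .inr (.inr ⟨by omega, H.edgeInjectivePoly_ne_zero hcard exists_le_rank,
      H.specialLocus_eq_polyZeros hcard exists_le_rank⟩)
  have bd_ne_zero (e : E) (he : e ∈ H.edges) : G.bd f e ≠ 0 := by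
    rw [edges_H, hf, mem_remainingEdgesOn_singleton] at he
    exact he.2
  have card_faces : H.faces.card = 1 := by rw [hf, Finset.card_singleton]
  rcases hcard with hcard | hcard
  · obtain ⟨j, hj⟩ := Finset.card_eq_one.1 hcard
    exact .inl ⟨by omega, ⟨j, hj⟩,
      H.specialLocus_eq_empty (by simp [hf]) hj (bd_ne_zero j (by simp [hj]))⟩
  · obtain ⟨j, j', hjj', hj⟩ := Finset.card_eq_two.1 hcard
    exact .inr (.inl ⟨by omega, j, j', hjj', hj, H.specialLocus_eq_polyZeros_X_sub_X hf hjj' hj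
      (bd_ne_zero j (by simp [hj])) (bd_ne_zero j' (by simp [hj]))⟩)

end IsContractionSeq

end PlaneGraph

theorem mainTheorem6_general {K : Type*} [Field K] [Infinite K]
    {V E F : Type*} [Fintype V] [Fintype E] [Fintype F] [LinearOrder E] [LinearOrder F]
    (G : PlaneGraph V E F) (hshare : G.ShareAtMostOneEdge)
    (k : ℕ) (S : ℕ → Finset F) (G' : ℕ → G.Minor) (hG' : G' = G.whole.contractSeq S)
    (hmin : ∀ i < k, (G' i).IsMinimalContractible (S i))
    (hisolated : ∀ i < k, ∀ T : Finset F, (G' i).IsMinimalContractible T → T ≠ S i →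
      Disjoint ((G' i).edgesOn T) ((G' i).edgesOn (S i)))
    (hlast : ∀ T, T ⊂ (G' k).faces → ¬ (G' k).IsContractible T) :
    (∀ i < k,
      (∀ a : E → K, ((G' i).sub (S i)).InSpecialPosition a ↔
        (((G' i).sub (S i)).Mext a).rank < ((G' i).sub (S i)).edges.card) ∧
      IsAlgebraicVariety (((G' i).sub (S i)).specialLocus K)) ∧
    (∀ a : E → K, (G' k).InSpecialPosition a ↔
      ((G' k).Mext a).rank < min ((G' k).edgesOn (G' k).faces).card (3 * (G' k).faces.card)) ∧
    IsAlgebraicVariety ((G' k).specialLocus K) ∧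
    G.whole.specialLocus K =
      (⋃ i ∈ Set.Iio k, ((G' i).sub (S i)).specialLocus K) ∪ (G' k).specialLocus K ∧
    IsAlgebraicVariety (G.whole.specialLocus K) ∧
    (∀ i < k,
      (((((G' i).sub (S i)).edges.card : ℤ) - 3 * (S i).card = -2 ∧
          (∃ j, ((G' i).sub (S i)).edges = {j}) ∧
          ((G' i).sub (S i)).specialLocus K = ∅) ∨
        ((((G' i).sub (S i)).edges.card : ℤ) - 3 * (S i).card = -1 ∧
          ∃ j j', j ≠ j' ∧ ((G' i).sub (S i)).edges = {j, j'} ∧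
            ((G' i).sub (S i)).specialLocus K =
              polyZeros (MvPolynomial.X j - MvPolynomial.X j')) ∨
        ((((G' i).sub (S i)).edges.card : ℤ) - 3 * (S i).card = 0 ∧
          ((G' i).sub (S i)).edgeInjectivePoly K ((G' i).sub (S i)).edges ≠ 0 ∧
          ((G' i).sub (S i)).specialLocus K =
            polyZeros (((G' i).sub (S i)).edgeInjectivePoly K ((G' i).sub (S i)).edges)))) ∧
    (3 * (G' k).faces.card ≤ ((G' k).edgesOn (G' k).faces).card →
      (G' k).specialLocus K =
        ⋂ C ∈ (G' k).edges.powersetCard (3 * (G' k).faces.card),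
          polyZeros ((G' k).edgeInjectivePoly K C)) := by
  subst hG'
  have h := PlaneGraph.isContractionSeq_remainingFaces hmin hisolated hlast
  refine ⟨fun i hi => ⟨?_, PlaneGraph.Minor.isAlgebraicVariety_specialLocus _⟩, ?_,
    PlaneGraph.Minor.isAlgebraicVariety_specialLocus _, h.specialLocus_whole hshare,
    PlaneGraph.Minor.isAlgebraicVariety_specialLocus _,
    fun i hi => h.specialLocus_sub_cases hshare hi rfl, fun hcard => ?_⟩
  · exact Set.ext_iff.1 ((hmin i hi).specialLocus_sub (G.edges_contractSeq S i) hshare)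
  · exact Set.ext_iff.1 (h.specialLocus_contractSeq hshare)
  · refine PlaneGraph.Minor.specialLocus_eq_iInter_polyZeros _ ?_
    simpa only [min_eq_right hcard] using h.exists_expectedRank_le_rank_contractSeq hshare K

theorem mainTheorem6 {K : Type*} [Field K] [CharZero K]
    {V E F : Type*} [Fintype V] [Fintype E] [Fintype F] [LinearOrder E] [LinearOrder F]
    (G : PlaneGraph V E F) (hshare : G.ShareAtMostOneEdge)
    (k : ℕ) (S : ℕ → Finset F) (G' : ℕ → G.Minor) (hG' : G' = G.whole.contractSeq S)
    (hmin : ∀ i < k, (G' i).IsMinimalContractible (S i))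
    (hdisj : ∀ i ≤ k, ∀ T T' : Finset F, (G' i).IsMinimalContractible T →
      (G' i).IsMinimalContractible T' → T ≠ T' →
        Disjoint ((G' i).edgesOn T) ((G' i).edgesOn T'))
    (hlast : ∀ T, T ⊂ (G' k).faces → ¬ (G' k).IsContractible T) :
    -- special position for the contracted subgraphs, and the resulting varieties
    (∀ i < k,
      (∀ a : E → K, ((G' i).sub (S i)).InSpecialPosition a ↔
        (((G' i).sub (S i)).Mext a).rank < ((G' i).sub (S i)).edges.card) ∧
      IsAlgebraicVariety (((G' i).sub (S i)).specialLocus K)) ∧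
    -- special position for the last graph
    (∀ a : E → K, (G' k).InSpecialPosition a ↔
      ((G' k).Mext a).rank < min ((G' k).edgesOn (G' k).faces).card (3 * (G' k).faces.card)) ∧
    IsAlgebraicVariety ((G' k).specialLocus K) ∧
    -- special position for the whole graph
    G.whole.specialLocus K =
      (⋃ i ∈ Set.Iio k, ((G' i).sub (S i)).specialLocus K) ∪ (G' k).specialLocus K ∧
    IsAlgebraicVariety (G.whole.specialLocus K) ∧
    -- the explicit polynomials for the contracted subgraphs
    (∀ i < k,
      (((((G' i).sub (S i)).edges.card : ℤ) - 3 * (S i).card = -2 ∧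
          (∃ j, ((G' i).sub (S i)).edges = {j}) ∧
          ((G' i).sub (S i)).specialLocus K = ∅) ∨
        ((((G' i).sub (S i)).edges.card : ℤ) - 3 * (S i).card = -1 ∧
          ∃ j j', j ≠ j' ∧ ((G' i).sub (S i)).edges = {j, j'} ∧
            ((G' i).sub (S i)).specialLocus K =
              polyZeros (MvPolynomial.X j - MvPolynomial.X j')) ∨
        ((((G' i).sub (S i)).edges.card : ℤ) - 3 * (S i).card = 0 ∧
          ((G' i).sub (S i)).edgeInjectivePoly K ((G' i).sub (S i)).edges ≠ 0 ∧
          ((G' i).sub (S i)).specialLocus K =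
            polyZeros (((G' i).sub (S i)).edgeInjectivePoly K ((G' i).sub (S i)).edges)))) ∧
    -- the explicit polynomials for the last graph
    (3 * (G' k).faces.card ≤ ((G' k).edgesOn (G' k).faces).card →
      (G' k).specialLocus K =
        ⋂ C ∈ (G' k).edges.powersetCard (3 * (G' k).faces.card),
          polyZeros ((G' k).edgeInjectivePoly K C)) :=
  mainTheorem6_general G hshare k S G' hG' hmin
    (fun i hi T hT hne => hdisj i hi.le T (S i) hT (hmin i hi) hne) hlast
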